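/- Let $n,N\ge 1$ be integers and write points of $\mathbb R^{nN}$ as $X=(x_1,\dots,x_N)$, $\Xi=(\xi_1,\dots,\xi_N)$ with $x_j,\xi_j\in\mathbb R^n$; put $\langle X,\Xi\rangle=\sum_j x_j\cdot\xi_j$ and $\langle\Xi\rangle=(1+\sum_j|\xi_j|^2)^{1/2}$. For $m,\rho\in\mathbb R$, the class $L^\infty S^m_\rho(nN,1)$ consists of the functions $a:\mathbb R^{nN}\times\mathbb R^{nN}\to\mathbb C$ such that $a(\cdot,\Xi)$ is measurable for every $\Xi$, $a(X,\cdot)$ is smooth for almost every $X$, and for every multi-index $\alpha\in\mathbb Z_+^{nN}$ there is a constant $C_\alpha$ with $$\operatorname*{ess\,sup}_X|\partial_\Xi^\alpha a(X,\Xi)|\le C_\alpha\langle\Xi\rangle^{m-\rho|\alpha|}\qquad\text{for all }\Xi. \tag{1}$$ For $u\in\mathscr S(\mathbb R^{nN})$ let $\widehat u(\Xi)=\int u(Y)e^{-i\langle Y,\Xi\rangle}\,dY$ and $$T_au(X)=\int_{\mathbb R^{nN}}a(X,\Xi)\,\widehat u(\Xi)\,e^{i\langle X,\Xi\rangle}\,d\Xi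 .$$ For $p\ge 1$ and $1\le j\le N$ let $$M^{(j)}_p(u)(X)=\sup_{B\ni x_j}\Big(\frac1{|B|}\int_B|u(x_1,\dots,x_{j-1},y,x_{j+1},\dots,x_N)|^p\,dy\Big)^{1/p},$$ the supremum being over balls $B\subset\mathbb R^n$ containing $x_j$. **Theorem.** Let $p_1,\dots,p_N\in[1,2]$, $0\le\rho\le1$ and $m<(\rho-1)\sum_{j=1}^N\frac n{p_j}$. There is a finite set $F$ of multi-indices, depending only on $n,N,p_j,m,\rho$, such that the following holds for every $a\in L^\infty S^m_\rho(nN,1)$ and all constants $C_\alpha$, $\alpha\in F$, for which (1) holds for every $\alpha\in F$. (i) There is a constant $C$, depending only on $n,N,p_j,m,\rho$ and the $C_\alpha$ with $\alpha\in F$, such that for almost every $X\in\mathbb R^{nN}$ and every $u\in\mathscr S(\mathbb R^{nN})$, $$|T_au(X)|\le C\,M^{(N)}_{p_N}\big(\cdots M^{(2)}_{p_2}(M^{(1)}_{p_1}(u))\cdots\big)(X).$$ More precisely, this holds, for all $u$, at every $X$ such that $a(X,\cdot)$ is smooth and $|\partial_\Xi^\alpha a(X,\Xi)|\le C_\alpha\langle\Xi\rangle^{m-\rho|\alpha|}$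 for all $\Xi$ and all $\alpha\in F$. (ii) Let $p_j<q_j$ for $j=1,\dots,N$ and $1\le q_N\le q_{N-1}\le\dots\le q_1\le2$. Let $L^{q_1}L^{q_2}\cdots L^{q_N}$ be the closure of $\mathscr S(\mathbb R^{nN})$ in the mixed norm whose factors are taken from left to right, $$\Big\{\int\cdots\Big\{\int\Big\{\int|u|^{q_1}dx_1\Big\}^{\frac{q_2}{q_1}}dx_2\Big\}^{\frac{q_3}{q_2}}\cdots dx_N\Big\}^{\frac1{q_N}},$$ and let $L^{q_N}\cdots L^{q_2}L^{q_1}$ be, likewise, its closure in the norm with the reversed order of integration, $$\Big\{\int\cdots\Big\{\int\Big\{\int|u|^{q_N}dx_N\Big\}^{\frac{q_{N-1}}{q_N}}dx_{N-1}\Big\}^{\frac{q_{N-2}}{q_{N-1}}}\cdots dx_1\Big\}^{\frac1{q_1}}.$$ Then $T_a$ extends from $\mathscr S(\mathbb R^{nN})$ to a bounded linear operator from $L^{q_1}L^{q_2}\cdots L^{q_N}$ to $L^{q_N}L^{q_{N-1}}\cdots L^{q_1}$, with norm bounded by a constant depending only on $n,N,p_j,q_j,m,\rho$ and the $C_\alpha$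 with $\alpha\in F$. -/

import Mathlib

open MeasureTheory
open scoped SchwartzMap ENNReal ContDiff

noncomputable section

namespace MixedPDO

/-- `ℝ^{nN}`, written as `N` blocks `x_j ∈ ℝ^n`, with Lebesgue measure. Only its topological
vector space structure and its measure are used: the Euclidean length and the inner product of
`ℝ^{nN}` are written out below, and the Schwartz class does not depend on the norm. -/
abbrev Space (n N : ℕ) : Type := Fin N → EuclideanSpace ℝ (Fin n)

/-- The inner product `⟨X, Ξ⟩ = ∑ x_j · ξ_j`. -/
def dot {n N : ℕ} (X Ξ : Space n N) : ℝ := ∑ j, inner ℝ (X j) (Ξ j)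

/-- The bracket `⟨Ξ⟩ = (1 + |Ξ|²)^{1/2}`, where `|Ξ|² = ∑ |ξ_j|²`. -/
def bracket {n N : ℕ} (Ξ : Space n N) : ℝ := Real.sqrt (1 + ∑ j, ‖Ξ j‖ ^ 2)

/-- Multi-indices in `ℤ_+^{nN}`. -/
abbrev MultiIndex (n N : ℕ) : Type := Fin N × Fin n → ℕ

/-- The length `|α|` of a multi-index. -/
def MultiIndex.length {n N : ℕ} (α : MultiIndex n N) : ℕ := ∑ i, α i

/-- The first order partial derivative in the `i.2`-th coordinate of the block `ξ_{i.1}`. -/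
def partialDeriv {n N : ℕ} (i : Fin N × Fin n) (f : Space n N → ℂ) : Space n N → ℂ :=
  fun Ξ => fderiv ℝ f Ξ (Pi.single i.1 (EuclideanSpace.single i.2 1))

/-- The derivative `∂^α f`: each `∂_i` is applied `α i` times, with the coordinates `i` taken
in lexicographic order. -/
def multiDeriv {n N : ℕ} (α : MultiIndex n N) (f : Space n N → ℂ) : Space n N → ℂ :=
  (List.finRange N ×ˢ List.finRange n).foldr (fun i g => (partialDeriv i)^[α i] g) f

/-- The estimate `ess sup_X |∂_Ξ^α a(X, Ξ)| ≤ c ⟨Ξ⟩^{m - ρ|α|}`, for every `Ξ`. -/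
def SymbolBound {n N : ℕ} (m ρ : ℝ) (a : Space n N → Space n N → ℂ) (α : MultiIndex n N)
    (c : ℝ) : Prop :=
  ∀ Ξ : Space n N, ∀ᵐ X : Space n N,
    ‖multiDeriv α (a X) Ξ‖ ≤ c * bracket Ξ ^ (m - ρ * (α.length : ℝ))

/-- The symbol class `L^∞ S^m_ρ(nN, 1)`: symbols `a(X, Ξ)` that are measurable in `X`, smooth in
`Ξ` for almost every `X`, and satisfy the symbol estimates for all multi-indices. -/
structure IsSymbol {n N : ℕ} (m ρ : ℝ) (a : Space n N → Space n N → ℂ) : Prop where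
  measurable : ∀ Ξ : Space n N, AEStronglyMeasurable (fun X => a X Ξ) volume
  smooth : ∀ᵐ X : Space n N, ContDiff ℝ ∞ (a X)
  bound : ∀ α : MultiIndex n N, ∃ c : ℝ, SymbolBound m ρ a α c

/-- The Fourier transform `û(Ξ) = ∫ u(Y) e^{-i⟨Y, Ξ⟩} dY`. -/
def fourier {n N : ℕ} (u : Space n N → ℂ) (Ξ : Space n N) : ℂ :=
  ∫ Y : Space n N, u Y * Complex.exp (-(Complex.I * (dot Y Ξ : ℂ)))

/-- The operator `T_a u(X) = ∫ a(X, Ξ) û(Ξ) e^{i⟨X, Ξ⟩} dΞ`. -/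
def pseudoOp {n N : ℕ} (a : Space n N → Space n N → ℂ) (u : 𝓢(Space n N, ℂ))
    (X : Space n N) : ℂ :=
  ∫ Ξ : Space n N, a X Ξ * fourier u Ξ * Complex.exp (Complex.I * (dot X Ξ : ℂ))

/-- The partial maximal function `M_p^{(j)}`: the supremum, over the balls `B ∋ x_j` of `ℝ^n`, of
`(|B|⁻¹ ∫_B f(x_1, …, x_{j-1}, y, x_{j+1}, …, x_N)^p dy)^{1/p}`. -/
def partialMaximal {n N : ℕ} (j : Fin N) (p : ℝ) (f : Space n N → ℝ≥0∞)
    (X : Space n N) : ℝ≥0∞ :=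
  ⨆ (z : EuclideanSpace ℝ (Fin n)) (r : ℝ) (_ : X j ∈ Metric.ball z r),
    ((volume (Metric.ball z r))⁻¹ *
      ∫⁻ y in Metric.ball z r, f (Function.update X j y) ^ p) ^ (1 / p)

/-- The iterated maximal function `M^{(N)}_{p_N}(… M^{(2)}_{p_2}(M^{(1)}_{p_1}(f)))`. -/
def iteratedMaximal {n N : ℕ} (p : Fin N → ℝ) (f : Space n N → ℝ≥0∞) : Space n N → ℝ≥0∞ :=
  (List.finRange N).foldl (fun g j => partialMaximal j (p j) g) f

/-- The `L^q` norm in the variable `x_j` alone, as a function of the remaining variables. -/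
def partialNorm {n N : ℕ} (j : Fin N) (q : ℝ) (f : Space n N → ℝ≥0∞)
    (X : Space n N) : ℝ≥0∞ :=
  (∫⁻ y : EuclideanSpace ℝ (Fin n), f (Function.update X j y) ^ q) ^ (1 / q)

/-- The mixed norm in which the `L^{q_j}` norms in the variables `x_j` are taken one after another
in the order of the list `l` (its head is the innermost integration). When `l` lists every index
the result does not depend on the point at which it is evaluated. -/
def mixedNorm {n N : ℕ} (l : List (Fin N)) (q : Fin N → ℝ) (f : Space n N → ℂ) : ℝ≥0∞ :=
  l.foldl (fun g j => partialNorm j (q j) g) (fun X => ‖f X‖ₑ) 0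

/-- The mixed norm space: the closure of the Schwartz class in the mixed norm. -/
def MemMixed {n N : ℕ} (l : List (Fin N)) (q : Fin N → ℝ) (f : Space n N → ℂ) : Prop :=
  AEStronglyMeasurable f volume ∧
    ∀ ε : ℝ≥0∞, 0 < ε → ∃ u : 𝓢(Space n N, ℂ), mixedNorm l q (fun X => f X - u X) ≤ ε

/-- The map `T`, given on Schwartz functions, extends to a bounded linear operator, with norm at
most `C`, from the mixed norm space of order `l` to the mixed norm space of order `l'`
(functions being identified when they agree almost everywhere). -/
def ExtendsBoundedly {n N : ℕ} (l l' : List (Fin N)) (q : Fin N → ℝ)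
    (T : 𝓢(Space n N, ℂ) → Space n N → ℂ) (C : ℝ) : Prop :=
  ∃ S : (Space n N → ℂ) → (Space n N → ℂ),
    (∀ u : 𝓢(Space n N, ℂ), S u =ᵐ[volume] T u) ∧
    (∀ f g, MemMixed l q f → MemMixed l q g → S (f + g) =ᵐ[volume] S f + S g) ∧
    (∀ (c : ℂ) (f), MemMixed l q f → S (c • f) =ᵐ[volume] c • S f) ∧
    (∀ f, MemMixed l q f →
      MemMixed l' q (S f) ∧ mixedNorm l' q (S f) ≤ ENNReal.ofReal C * mixedNorm l q f)

end MixedPDO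

end

open MixedPDO

/-!
Bounds for pseudodifferential operators with rough symbols by iterated maximal functions.

The symbol is split dyadically, `a(X, Ξ) = ∑_k a(X, Ξ) ψ_k(Ξ)` with `ψ_k` living where `|Ξ| ~ 2^k`,
so that `T_a u(X) = ∑_k ∫ K_k(X, X - Y) u(Y) dY`, where `K_k(X, ·)` is the inverse Fourier transform
of `g = a(X, ·) ψ_k`. The point `X` is a frozen parameter throughout, which is why no regularity in
`X` is needed. Write `R = 2^k` and `τ = R^ρ`. By the symbol estimates each derivative of `g` costs a
factor `τ⁻¹`, so `D g = ∏_i (1 - τ² ∂_i²)^n g` is bounded by a constant times `R^m`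
(`exists_norm_diffOps_le`); on the kernel side `D` is multiplication by
`∏_i (1 + τ² z_i²)^n`, which dominates the inverse of `∏_j (1 + τ²|z_j|²)^{-n/p_j}`.

The heart of the proof is the kernel estimate at one frequency scale, `exists_kernel_bound`: the
integral `∫ |K_k(X, X - Y)| f(Y) dY` is at most a constant times `R^{m + ∑ n/p_j}` times the iterated
local average of `f` around `X`, in which the successive `L^{p_j}` norms in `y_j` are taken against
the weight `(1 + τ²|x_j - y_j|²)^{-n}`. Since the frequencies are bounded by `R`, the weighted kernel
can be written as a Gaussian at frequency `R` convolved with a function `k` whose `L²` norm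
Plancherel's theorem bounds. Moving the Gaussian onto `f` times the weight, the Cauchy-Schwarz
inequality leaves the `L²` norm of a Gaussian convolution, which a mixed-norm Young inequality
(`iterNorm_two_conv_le`, where `p_j ≤ 2` enters) bounds by the mixed `L^{p_1} ⋯ L^{p_N}` norm of `f`
times the weight. That norm is the iterated average. For Young's inequality in several blocks, and
again below, norms in different variables are interchanged by Minkowski's integral inequality
(`kernelNorm_swap_le`).

The averages on the scale `1/τ` are at most `τ^{-∑ n/p_j}` times the iterated maximal function
(`iterNorm_decay_le_maximal`, by dyadic shells), so the `k`-th piece contributes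
`2^{k(m - (ρ - 1) ∑ n/p_j)}`, and the hypothesis on `m` makes the sum converge
(`exists_pseudoOp_bound`).

For the mixed norms the maximal function is not needed: for `p_j ≤ q_j` and decreasing `q_j` the
iterated averages themselves map `L^{q_1} ⋯ L^{q_N}` to the space with the reversed order of
integration, with norm a constant times `τ^{-∑ n/p_j}` (`iterNorm_reverse_average_le`). Hence
`∑_k ∫ |K_k(X, X - Y)| |f(Y)| dY` is finite for almost every `X`, and the absolutely convergent sum of
integrals `kernelOp` is the bounded extension of `T_a` (`extendsBoundedly_of_bound`). To make it a
measurable function, the symbol is first changed on a null set of points `X` so as to be jointly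
measurable (`exists_measurable_symbol`). That its values lie in the closure of the Schwartz class
follows by truncation and mollification (`memMixed_of_ne_top`).
-/

namespace MixedPDO

/-! ### Minkowski's integral inequality -/

section Minkowski

variable {α β : Type*} [MeasurableSpace α] [MeasurableSpace β] {μ : Measure α} {ν : Measure β}

/-- The duality step of Minkowski's inequality, for a minorant `G` of `∫ f(·, y) dν(y)` whose
`L^r` norm is finite and may therefore be divided out. -/
lemma lintegral_rpow_le_of_le [SFinite μ] [SFinite ν] {r : ℝ} (hr : 1 < r) {f : α → β → ℝ≥0∞}
    (hf : Measurable (Function.uncurry f)) {G : α → ℝ≥0∞} (hG : Measurable G)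
    (hGf : ∀ x, G x ≤ ∫⁻ y, f x y ∂ν) (hfin : ∫⁻ x, G x ^ r ∂μ ≠ ⊤) :
    (∫⁻ x, G x ^ r ∂μ) ^ (1 / r) ≤ ∫⁻ y, (∫⁻ x, f x y ^ r ∂μ) ^ (1 / r) ∂ν := by
  have hr0 : 0 < r := by linarith
  have hconj : r.HolderConjugate (r / (r - 1)) := Real.HolderConjugate.conjExponent hr
  have hq0 : 0 < r / (r - 1) := hconj.symm.pos
  set I := ∫⁻ x, G x ^ r ∂μ with hI
  rcases eq_or_ne I 0 with h0 | h0
  · rw [h0, ENNReal.zero_rpow_of_pos (by positivity)]; exact zero_le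
  have hG1 : Measurable fun x => G x ^ (r - 1) := hG.pow_const _
  have key : I ≤ (∫⁻ y, (∫⁻ x, f x y ^ r ∂μ) ^ (1 / r) ∂ν) * I ^ (1 / (r / (r - 1))) := by
    calc I ≤ ∫⁻ x, (∫⁻ y, f x y ∂ν) * G x ^ (r - 1) ∂μ := by
          refine lintegral_mono fun x => ?_
          calc G x ^ r = G x ^ (1 + (r - 1)) := by ring_nf
            _ = G x * G x ^ (r - 1) := by
                rw [ENNReal.rpow_add_of_nonneg _ _ zero_le_one (by linarith), ENNReal.rpow_one]
            _ ≤ _ := by gcongr; exact hGf x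
      _ = ∫⁻ x, ∫⁻ y, f x y * G x ^ (r - 1) ∂ν ∂μ := by
          refine lintegral_congr fun x => ?_
          exact (lintegral_mul_const _ (hf.comp measurable_prodMk_left)).symm
      _ = ∫⁻ y, ∫⁻ x, f x y * G x ^ (r - 1) ∂μ ∂ν :=
          lintegral_lintegral_swap
            (hf.mul (hG1.comp measurable_fst)).aemeasurable
      _ ≤ ∫⁻ y, (∫⁻ x, f x y ^ r ∂μ) ^ (1 / r) * I ^ (1 / (r / (r - 1))) ∂ν := by
          refine lintegral_mono fun y => ?_
          refine (ENNReal.lintegral_mul_le_Lp_mul_Lq μ hconj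
            (hf.comp measurable_prodMk_right).aemeasurable hG1.aemeasurable).trans ?_
          have : (r - 1) * (r / (r - 1)) = r := by
            field_simp [show r - 1 ≠ 0 by linarith]
          simp only [← ENNReal.rpow_mul, this]
          exact le_rfl
      _ = _ := lintegral_mul_const' _ _ (ENNReal.rpow_ne_top_of_nonneg (by positivity) hfin)
  have hsplit : I = I ^ (1 / r) * I ^ (1 / (r / (r - 1))) := by
    rw [← ENNReal.rpow_add _ _ h0 hfin]
    have : 1 / r + 1 / (r / (r - 1)) = 1 := by
      field_simp [show r - 1 ≠ 0 by linarith]; ring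
    rw [this, ENNReal.rpow_one]
  refine (ENNReal.mul_le_mul_iff_left ?_ ?_).1 (hsplit.symm.le.trans key)
  · exact (ENNReal.rpow_pos (pos_iff_ne_zero.2 h0) hfin).ne'
  · exact ENNReal.rpow_ne_top_of_nonneg (by positivity) hfin

/-- Minkowski's integral inequality. -/
lemma rpow_lintegral_lintegral_le [SigmaFinite μ] [SFinite ν] {r : ℝ} (hr : 1 ≤ r)
    {f : α → β → ℝ≥0∞} (hf : Measurable (Function.uncurry f)) :
    (∫⁻ x, (∫⁻ y, f x y ∂ν) ^ r ∂μ) ^ (1 / r) ≤ ∫⁻ y, (∫⁻ x, f x y ^ r ∂μ) ^ (1 / r) ∂ν := by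
  rcases hr.eq_or_lt with rfl | hr
  · simp only [ENNReal.rpow_one, div_one]
    exact (lintegral_lintegral_swap hf.aemeasurable).le
  have hr0 : 0 < r := by linarith
  set F : α → ℝ≥0∞ := fun x => ∫⁻ y, f x y ∂ν with hF
  have hFm : Measurable F := hf.lintegral_prod_right'
  -- truncations of `F` in size and support, whose `L^r` norms are finite
  set G : ℕ → α → ℝ≥0∞ := fun k => (spanningSets μ k).indicator fun x => min (F x) k with hGdef
  have hGm : ∀ k, Measurable (G k) := fun k =>
    (hFm.min measurable_const).indicator (measurableSet_spanningSets μ k)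
  have hGF : ∀ k x, G k x ≤ F x := fun k x =>
    (Set.indicator_le_self _ _ x).trans (min_le_left _ _)
  have hGfin : ∀ k, ∫⁻ x, G k x ^ r ∂μ ≠ ⊤ := by
    intro k
    refine ne_top_of_le_ne_top ?_ (lintegral_mono (g := (spanningSets μ k).indicator
      fun _ => (k : ℝ≥0∞) ^ r) fun x => ?_)
    · rw [lintegral_indicator_const (measurableSet_spanningSets μ k)]
      exact ENNReal.mul_ne_top (by simp [hr0.le]) (measure_spanningSets_lt_top μ k).ne
    · by_cases hx : x ∈ spanningSets μ k
      · simp only [hGdef, Set.indicator_of_mem hx]; gcongr; exact min_le_right _ _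
      · simp [hGdef, Set.indicator_of_notMem hx, hr0]
  have hsup : ∀ x, F x ^ r ≤ ⨆ k, G k x ^ r := by
    intro x
    have ht : Filter.Tendsto (fun k : ℕ => G k x ^ r) Filter.atTop (nhds (F x ^ r)) := by
      refine (ENNReal.continuous_rpow_const.tendsto _).comp ?_
      have h1 : Filter.Tendsto (fun k : ℕ => min (F x) (k : ℝ≥0∞)) Filter.atTop
          (nhds (min (F x) ⊤)) := tendsto_const_nhds.min ENNReal.tendsto_nat_nhds_top
      rw [min_eq_left le_top] at h1
      refine h1.congr' ?_
      filter_upwards [Filter.eventually_ge_atTop (spanningSetsIndex μ x)] with k hk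
      have : x ∈ spanningSets μ k :=
        monotone_spanningSets μ hk (mem_spanningSetsIndex μ x)
      simp [hGdef, Set.indicator_of_mem this]
    exact le_of_tendsto' ht fun k => le_iSup (fun k => G k x ^ r) k
  have hmono : Monotone fun k x => G k x ^ r := by
    intro k l hkl x
    refine ENNReal.rpow_le_rpow ?_ hr0.le
    by_cases hx : x ∈ spanningSets μ k
    · simp only [hGdef, Set.indicator_of_mem hx,
        Set.indicator_of_mem (monotone_spanningSets μ hkl hx)]
      gcongr
    · simp [hGdef, Set.indicator_of_notMem hx]
  rw [one_div, ENNReal.rpow_inv_le_iff hr0]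
  calc ∫⁻ x, F x ^ r ∂μ ≤ ∫⁻ x, ⨆ k, G k x ^ r ∂μ := lintegral_mono hsup
    _ = ⨆ k, ∫⁻ x, G k x ^ r ∂μ := lintegral_iSup (fun k => (hGm k).pow_const r) hmono
    _ ≤ _ := by
      refine iSup_le fun k => ?_
      have := lintegral_rpow_le_of_le hr hf (hGm k) (hGF k) (hGfin k)
      rw [one_div, ENNReal.rpow_inv_le_iff hr0] at this
      simpa only [one_div] using this

end Minkowski

/-! ### Norms in one block of variables -/

section KernelNorm

variable {n N : ℕ}

/-- The weighted `L^p` norm in the block `x_j`: the weight `κ(x_j, y)` may depend on the point `x_j`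
at which the norm is evaluated, so that `L^p` norms, convolutions with nonnegative kernels and
local `L^p` averages are all of this form. -/
noncomputable def kernelNorm (j : Fin N) (p : ℝ)
    (κ : EuclideanSpace ℝ (Fin n) → EuclideanSpace ℝ (Fin n) → ℝ≥0∞) (f : Space n N → ℝ≥0∞)
    (X : Space n N) : ℝ≥0∞ :=
  (∫⁻ y, κ (X j) y * f (Function.update X j y) ^ p) ^ (1 / p)

lemma partialNorm_eq_kernelNorm (j : Fin N) (p : ℝ) (f : Space n N → ℝ≥0∞) :
    partialNorm j p f = kernelNorm j p (fun _ _ => 1) f := by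
  funext X; simp [partialNorm, kernelNorm]

variable {κ lam : EuclideanSpace ℝ (Fin n) → EuclideanSpace ℝ (Fin n) → ℝ≥0∞}
  {f g : Space n N → ℝ≥0∞}

lemma measurable_kernelNorm (j : Fin N) (p : ℝ) (hκ : Measurable (Function.uncurry κ))
    (hf : Measurable f) : Measurable (kernelNorm j p κ f) := by
  refine Measurable.pow_const ?_ _
  refine Measurable.lintegral_prod_right' (f := fun z : Space n N × EuclideanSpace ℝ (Fin n) =>
    κ (z.1 j) z.2 * f (Function.update z.1 j z.2) ^ p) ?_
  exact (hκ.comp (((measurable_pi_apply j).comp measurable_fst).prodMk measurable_snd)).mul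
    ((hf.comp measurable_update').pow_const p)

lemma measurable_partialNorm (j : Fin N) (p : ℝ) (hf : Measurable f) :
    Measurable (partialNorm j p f) := by
  rw [partialNorm_eq_kernelNorm]
  exact measurable_kernelNorm j p measurable_const hf

lemma kernelNorm_mono (j : Fin N) {p : ℝ} (hp : 0 ≤ p) (h : f ≤ g) :
    kernelNorm j p κ f ≤ kernelNorm j p κ g := by
  intro X
  unfold kernelNorm
  gcongr with y
  exact h _

/-- A block norm is homogeneous under functions that do not depend on that block. -/
lemma kernelNorm_mul_left (j : Fin N) {p : ℝ} (hp : 0 < p) {c : ℝ≥0∞} (hc : c ≠ ⊤) (X : Space n N)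
    (h : ∀ y, g (Function.update X j y) = c * f (Function.update X j y)) :
    kernelNorm j p κ g X = c * kernelNorm j p κ f X := by
  unfold kernelNorm
  have : ∀ y, κ (X j) y * g (Function.update X j y) ^ p =
      c ^ p * (κ (X j) y * f (Function.update X j y) ^ p) := by
    intro y; rw [h, ENNReal.mul_rpow_of_nonneg _ _ hp.le]; ring
  simp_rw [this]
  rw [lintegral_const_mul' _ _ (ENNReal.rpow_ne_top_of_nonneg hp.le hc),
    ENNReal.mul_rpow_of_nonneg _ _ (by positivity), ← ENNReal.rpow_mul, mul_one_div_cancel hp.ne',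
    ENNReal.rpow_one]

lemma kernelNorm_const_mul (j : Fin N) {p : ℝ} (hp : 0 < p) {c : ℝ≥0∞} (hc : c ≠ ⊤) :
    kernelNorm j p κ (fun X => c * f X) = fun X => c * kernelNorm j p κ f X := by
  funext X; exact kernelNorm_mul_left j hp hc X fun _ => rfl

/-- Two block norms in different blocks: the larger value arises when the larger exponent is taken
inside. -/
lemma kernelNorm_swap_le {i j : Fin N} (hij : i ≠ j) {r s : ℝ} (hs : 0 < s) (hsr : s ≤ r)
    (hκ : Measurable (Function.uncurry κ)) (hlam : Measurable (Function.uncurry lam))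
    (hf : Measurable f) :
    kernelNorm i r κ (kernelNorm j s lam f) ≤ kernelNorm j s lam (kernelNorm i r κ f) := by
  intro X
  have hr : 0 < r := hs.trans_le hsr
  have h1 : 1 ≤ r / s := (one_le_div hs).2 hsr
  have hupd : Measurable fun z : EuclideanSpace ℝ (Fin n) × EuclideanSpace ℝ (Fin n) =>
      Function.update (Function.update X i z.1) j z.2 :=
    measurable_update'.comp (((measurable_update X).comp measurable_fst).prodMk measurable_snd)
  set Φ : EuclideanSpace ℝ (Fin n) → EuclideanSpace ℝ (Fin n) → ℝ≥0∞ := fun x y =>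
    κ (X i) x ^ (s / r) * (lam (X j) y * f (Function.update (Function.update X i x) j y) ^ s)
    with hΦ
  have hκ' : Measurable fun x => κ (X i) x := hκ.comp measurable_prodMk_left
  have hlam' : Measurable fun x => lam (X j) x := hlam.comp measurable_prodMk_left
  have hΦm : Measurable (Function.uncurry Φ) :=
    ((hκ'.pow_const _).comp measurable_fst).mul
      ((hlam'.comp measurable_snd).mul ((hf.comp hupd).pow_const _))
  have hmink := rpow_lintegral_lintegral_le (μ := volume) (ν := volume) h1 hΦm
  have hL : kernelNorm i r κ (kernelNorm j s lam f) X =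
      ((∫⁻ x, (∫⁻ y, Φ x y) ^ (r / s)) ^ (1 / (r / s))) ^ (1 / s) := by
    have hx : ∀ x, (∫⁻ y, Φ x y) ^ (r / s) =
        κ (X i) x * kernelNorm j s lam f (Function.update X i x) ^ r := by
      intro x
      have hm : Measurable fun y =>
          lam (X j) y * f (Function.update (Function.update X i x) j y) ^ s :=
        hlam'.mul ((hf.comp (hupd.comp measurable_prodMk_left)).pow_const _)
      simp only [hΦ]
      rw [lintegral_const_mul _ hm, ENNReal.mul_rpow_of_nonneg _ _ (by positivity),
        ← ENNReal.rpow_mul, show s / r * (r / s) = 1 by field_simp, ENNReal.rpow_one, kernelNorm,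
        ← ENNReal.rpow_mul, Function.update_of_ne hij.symm]
      congr 2
      ring
    simp_rw [hx]
    rw [← ENNReal.rpow_mul, kernelNorm]
    congr 1
    field_simp
  have hR : kernelNorm j s lam (kernelNorm i r κ f) X =
      (∫⁻ y, (∫⁻ x, Φ x y ^ (r / s)) ^ (1 / (r / s))) ^ (1 / s) := by
    rw [kernelNorm]
    congr 1
    refine lintegral_congr fun y => ?_
    have hx : ∀ x, Φ x y ^ (r / s) = lam (X j) y ^ (r / s) *
        (κ (X i) x * f (Function.update (Function.update X j y) i x) ^ r) := by
      intro x
      simp only [hΦ]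
      rw [ENNReal.mul_rpow_of_nonneg _ _ (by positivity),
        ENNReal.mul_rpow_of_nonneg _ _ (by positivity), ← ENNReal.rpow_mul, ← ENNReal.rpow_mul,
        show s / r * (r / s) = 1 by field_simp, show s * (r / s) = r by field_simp,
        ENNReal.rpow_one, Function.update_comm hij]
      ring
    have hm : Measurable fun x =>
        κ (X i) x * f (Function.update (Function.update X j y) i x) ^ r :=
      hκ'.mul ((hf.comp (measurable_update _)).pow_const _)
    simp_rw [hx]
    rw [lintegral_const_mul _ hm, ENNReal.mul_rpow_of_nonneg _ _ (by positivity),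
      ← ENNReal.rpow_mul, show r / s * (1 / (r / s)) = 1 by field_simp, ENNReal.rpow_one,
      kernelNorm, ← ENNReal.rpow_mul, Function.update_of_ne hij]
    rw [show 1 / r * s = 1 / (r / s) by field_simp]
  rw [hL, hR]
  gcongr

/-- The block norm of a countable sum. -/
lemma partialNorm_tsum_le (j : Fin N) {p : ℝ} (hp : 1 ≤ p) {h : ℕ → Space n N → ℝ≥0∞}
    (hh : ∀ k, Measurable (h k)) :
    partialNorm j p (fun X => ∑' k, h k X) ≤ fun X => ∑' k, partialNorm j p (h k) X := by
  intro X
  have hm : Measurable (Function.uncurry fun (y : EuclideanSpace ℝ (Fin n)) (k : ℕ) =>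
      h k (Function.update X j y)) :=
    measurable_from_prod_countable_left fun k => (hh k).comp (measurable_update X)
  have := rpow_lintegral_lintegral_le (μ := volume) (ν := Measure.count) hp hm
  simp only [lintegral_count] at this
  exact this

end KernelNorm

/-! ### Iterated block norms -/

section IterNorm

variable {n N : ℕ}

/-- The successive block norms with exponents `p j` and weights `κ j`, in the order of the list `l`,
whose head is applied first. -/
noncomputable def iterNorm (l : List (Fin N)) (p : Fin N → ℝ)
    (κ : Fin N → EuclideanSpace ℝ (Fin n) → EuclideanSpace ℝ (Fin n) → ℝ≥0∞)
    (f : Space n N → ℝ≥0∞) : Space n N → ℝ≥0∞ :=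
  l.foldl (fun g j => kernelNorm j (p j) (κ j) g) f

variable {p q : Fin N → ℝ}
  {κ : Fin N → EuclideanSpace ℝ (Fin n) → EuclideanSpace ℝ (Fin n) → ℝ≥0∞}
  {f g : Space n N → ℝ≥0∞}

@[simp] lemma iterNorm_nil : iterNorm [] p κ f = f := rfl

@[simp] lemma iterNorm_cons (j : Fin N) (l : List (Fin N)) :
    iterNorm (j :: l) p κ f = iterNorm l p κ (kernelNorm j (p j) (κ j) f) := rfl

lemma iterNorm_concat (j : Fin N) (l : List (Fin N)) :
    iterNorm (l ++ [j]) p κ f = kernelNorm j (p j) (κ j) (iterNorm l p κ f) := by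
  simp [iterNorm]

/-- The mixed norm is the iterated block norm with all weights equal to `1`. -/
lemma mixedNorm_eq_iterNorm (l : List (Fin N)) (q : Fin N → ℝ) (f : Space n N → ℂ) :
    mixedNorm l q f = iterNorm l q (fun _ _ _ => 1) (fun X => ‖f X‖ₑ) 0 := by
  simp only [mixedNorm, iterNorm, partialNorm_eq_kernelNorm]

lemma measurable_iterNorm (l : List (Fin N)) (hκ : ∀ j, Measurable (Function.uncurry (κ j)))
    (hf : Measurable f) : Measurable (iterNorm l p κ f) := by
  induction l generalizing f with
  | nil => exact hf
  | cons j l ih => exact ih (measurable_kernelNorm j _ (hκ j) hf)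

lemma iterNorm_mono (l : List (Fin N)) (hp : ∀ j, 0 ≤ p j) (h : f ≤ g) :
    iterNorm l p κ f ≤ iterNorm l p κ g := by
  induction l generalizing f g with
  | nil => exact h
  | cons j l ih => exact ih (kernelNorm_mono j (hp j) h)

lemma iterNorm_const_mul (l : List (Fin N)) (hp : ∀ j, 0 < p j) {c : ℝ≥0∞} (hc : c ≠ ⊤) :
    iterNorm l p κ (fun X => c * f X) = fun X => c * iterNorm l p κ f X := by
  induction l generalizing f with
  | nil => rfl
  | cons j l ih => rw [iterNorm_cons, kernelNorm_const_mul j (hp j) hc, ih, iterNorm_cons]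

/-- An unweighted iterated norm does not depend on the variables that have been integrated out. -/
lemma iterNorm_one_congr (l : List (Fin N)) {X Y : Space n N} (h : ∀ j ∉ l, X j = Y j) :
    iterNorm l p (fun _ _ _ => 1) f X = iterNorm l p (fun _ _ _ => 1) f Y := by
  induction l using List.reverseRecOn generalizing X Y with
  | nil => congr 1; funext j; exact h j (by simp)
  | append_singleton l j ih =>
    simp only [iterNorm_concat, kernelNorm]
    congr 1
    refine lintegral_congr fun y => ?_
    rw [ih (Y := Function.update Y j y)]
    intro i hi
    by_cases hij : i = j
    · subst hij; simp
    · rw [Function.update_of_ne hij, Function.update_of_ne hij]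
      exact h i (by simp [hi, hij])

/-- Minkowski's inequality for the unweighted iterated norms. -/
lemma iterNorm_tsum_le (l : List (Fin N)) (hq : ∀ j, 1 ≤ q j) {h : ℕ → Space n N → ℝ≥0∞}
    (hh : ∀ k, Measurable (h k)) (X : Space n N) :
    iterNorm l q (fun _ _ _ => 1) (fun X => ∑' k, h k X) X ≤
      ∑' k, iterNorm l q (fun _ _ _ => 1) (h k) X := by
  induction l generalizing h with
  | nil => exact le_rfl
  | cons j l ih =>
    simp only [iterNorm_cons, ← partialNorm_eq_kernelNorm]
    exact (iterNorm_mono l (fun j => zero_le_one.trans (hq j))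
      (partialNorm_tsum_le j (hq j) hh) X).trans (ih fun k => measurable_partialNorm j _ (hh k))

lemma iterNorm_add_le (l : List (Fin N)) (hq : ∀ j, 1 ≤ q j) (hf : Measurable f)
    (hg : Measurable g) (X : Space n N) :
    iterNorm l q (fun _ _ _ => 1) (fun X => f X + g X) X ≤
      iterNorm l q (fun _ _ _ => 1) f X + iterNorm l q (fun _ _ _ => 1) g X := by
  induction l generalizing f g with
  | nil => exact le_rfl
  | cons j l ih =>
    simp only [iterNorm_cons, ← partialNorm_eq_kernelNorm]
    refine (iterNorm_mono l (fun j => zero_le_one.trans (hq j)) (fun X => ?_) X).trans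
      (ih (measurable_partialNorm j _ hf) (measurable_partialNorm j _ hg))
    exact ENNReal.lintegral_Lp_add_le (hf.comp (measurable_update X)).aemeasurable
      (hg.comp (measurable_update X)).aemeasurable (hq j)

/-- Iterated norms with a single exponent are `L^s` norms, by Tonelli's theorem. -/
lemma iterNorm_const_eq_lmarginal {l : List (Fin N)} (hl : l.Nodup) {s : ℝ} (hs : 0 < s)
    (hf : Measurable f) :
    iterNorm l (fun _ => s) (fun _ _ _ => 1) f =
      fun X => (lmarginal (fun _ => volume) l.toFinset (fun Y => f Y ^ s) X) ^ (1 / s) := by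
  induction l generalizing f with
  | nil =>
    funext X
    simp [← ENNReal.rpow_mul, hs.ne']
  | cons j l ih =>
    rw [List.nodup_cons] at hl
    rw [iterNorm_cons, ← partialNorm_eq_kernelNorm, ih hl.2 (measurable_partialNorm j _ hf)]
    funext X
    rw [List.toFinset_cons, lmarginal_insert' _ (hf.pow_const s) (by simpa using hl.1)]
    congr 3
    funext Y
    rw [partialNorm, ← ENNReal.rpow_mul, one_div_mul_cancel hs.ne', ENNReal.rpow_one]

lemma iterNorm_finRange_const {s : ℝ} (hs : 0 < s) (hf : Measurable f) (X : Space n N) :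
    iterNorm (List.finRange N) (fun _ => s) (fun _ _ _ => 1) f X =
      (∫⁻ Y, f Y ^ s) ^ (1 / s) := by
  rw [iterNorm_const_eq_lmarginal (List.nodup_finRange N) hs hf]
  have : (List.finRange N).toFinset = Finset.univ := by ext; simp
  simp only [this]
  rw [volume_pi, lintegral_eq_lmarginal_univ X]

/-- Weights that depend on `X_j - Y_j`, or more generally on `(X_j, Y_j)`, can be moved from the
integrand into the block norms, once these are evaluated at `X`. -/
lemma iterNorm_one_mul_eq {l : List (Fin N)} (hl : l.Nodup) (hp : ∀ j, 0 < p j) {X : Space n N}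
    (w : Fin N → EuclideanSpace ℝ (Fin n) → EuclideanSpace ℝ (Fin n) → ℝ≥0∞)
    (hw : ∀ j x y, w j x y ≠ ⊤) (hκ : ∀ j x y, w j x y ^ p j = κ j x y)
    (h : ∀ Y : Space n N, (∀ j ∉ l, Y j = X j) →
      g Y = (l.map fun j => w j (X j) (Y j)).prod * f Y) :
    iterNorm l p (fun _ _ _ => 1) g X = iterNorm l p κ f X := by
  induction l generalizing f g with
  | nil => simpa using h X fun _ _ => rfl
  | cons j l ih =>
    rw [List.nodup_cons] at hl
    rw [iterNorm_cons, iterNorm_cons]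
    refine ih hl.2 fun Y hY => ?_
    have hc : (l.map fun i => w i (X i) (Y i)).prod ≠ ⊤ := by
      clear * - hw
      induction l with
      | nil => simp
      | cons i l ih => simpa using ENNReal.mul_ne_top (hw _ _ _) ih
    have hjY : Y j = X j := hY j hl.1
    have hmap : ∀ y, (l.map fun i => w i (X i) (Function.update Y j y i)).prod =
        (l.map fun i => w i (X i) (Y i)).prod := by
      intro y
      congr 1
      refine List.map_congr_left fun i hi => ?_
      rw [Function.update_of_ne (by rintro rfl; exact hl.1 hi)]
    have h2 : kernelNorm j (p j) (κ j) f Y =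
        kernelNorm j (p j) (fun _ _ => 1) (fun Z => w j (X j) (Z j) * f Z) Y := by
      simp only [kernelNorm, Function.update_self, one_mul]
      congr 1
      refine lintegral_congr fun y => ?_
      rw [ENNReal.mul_rpow_of_nonneg _ _ (hp j).le, hκ, hjY]
    rw [h2]
    refine kernelNorm_mul_left j (hp j) hc Y fun y => ?_
    rw [h, List.map_cons, List.prod_cons, hmap]
    · ring
    · intro i hi
      simp only [List.mem_cons, not_or] at hi
      rw [Function.update_of_ne hi.1]
      exact hY i hi.2

/-! ### Almost everywhere statements on slices -/

/-- Resampling one block. The factor on the right is infinite when `n ≥ 1`, but it is nonzero, which is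
all that matters when null sets are transferred to almost every slice and back. -/
lemma lintegral_lintegral_update (j : Fin N) (hf : Measurable f) :
    ∫⁻ X : Space n N, ∫⁻ y, f (Function.update X j y) =
      (∫⁻ X, f X) * volume (Set.univ : Set (EuclideanSpace ℝ (Fin n))) := by
  have hH : Measurable fun X : Space n N => ∫⁻ y, f (Function.update X j y) :=
    Measurable.lintegral_prod_right'
      (f := fun z : Space n N × EuclideanSpace ℝ (Fin n) => f (Function.update z.1 j z.2))
      (hf.comp measurable_update')
  rw [volume_pi, lintegral_eq_lmarginal_univ 0, lmarginal_erase _ hH (Finset.mem_univ j),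
    ← lmarginal_erase' _ hf (Finset.mem_univ j)]
  simp only [← lintegral_eq_lmarginal_univ]
  rw [lintegral_const]

lemma ae_ae_update (j : Fin N) {P : Space n N → Prop} (h : ∀ᵐ X, P X) :
    ∀ᵐ X : Space n N, ∀ᵐ y, P (Function.update X j y) := by
  obtain ⟨t, hst, ht, ht0⟩ := exists_measurable_superset_of_null (ae_iff.1 h)
  have hm : Measurable (t.indicator fun _ : Space n N => (1 : ℝ≥0∞)) := measurable_const.indicator ht
  have h0 := lintegral_lintegral_update j hm
  rw [lintegral_indicator_const ht, ht0, mul_zero, zero_mul] at h0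
  have hH : Measurable fun X : Space n N => ∫⁻ y, t.indicator (fun _ => (1 : ℝ≥0∞))
      (Function.update X j y) :=
    Measurable.lintegral_prod_right' (f := fun z : Space n N × EuclideanSpace ℝ (Fin n) =>
      t.indicator (fun _ => (1 : ℝ≥0∞)) (Function.update z.1 j z.2))
      (hm.comp measurable_update')
  rw [lintegral_eq_zero_iff hH] at h0
  filter_upwards [h0] with X hX
  filter_upwards [(lintegral_eq_zero_iff (hm.comp (measurable_update (a := j) X))).1 hX] with y hy
  by_contra hP
  have : Function.update X j y ∈ t := hst hP
  simp [Set.indicator_of_mem this] at hy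

lemma ae_of_ae_ae_update (j : Fin N) {P : Space n N → Prop} (hP : MeasurableSet {X | P X})
    (h : ∀ᵐ X : Space n N, ∀ᵐ y, P (Function.update X j y)) : ∀ᵐ X, P X := by
  have hm : Measurable ({X | P X}ᶜ.indicator fun _ : Space n N => (1 : ℝ≥0∞)) :=
    measurable_const.indicator hP.compl
  have h0 := lintegral_lintegral_update j hm
  have h1 : ∫⁻ X : Space n N, ∫⁻ y, {X | P X}ᶜ.indicator (fun _ => (1 : ℝ≥0∞))
      (Function.update X j y) = 0 := by
    rw [lintegral_congr_ae (g := fun _ => 0), lintegral_zero]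
    filter_upwards [h] with X hX
    rw [lintegral_congr_ae (g := fun _ => 0), lintegral_zero]
    filter_upwards [hX] with y hy
    simp [hy]
  rw [h1, lintegral_indicator_const hP.compl, one_mul] at h0
  have hne : volume (Set.univ : Set (EuclideanSpace ℝ (Fin n))) ≠ 0 :=
    isOpen_univ.measure_ne_zero volume Set.univ_nonempty
  rcases mul_eq_zero.1 h0.symm with h2 | h2
  · exact ae_iff.2 h2
  · exact absurd h2 hne

lemma iterNorm_congr_ae (l : List (Fin N)) (h : f =ᵐ[volume] g) :
    iterNorm l q (fun _ _ _ => 1) f =ᵐ[volume] iterNorm l q (fun _ _ _ => 1) g := by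
  induction l generalizing f g with
  | nil => exact h
  | cons j l ih =>
    refine ih ?_
    filter_upwards [ae_ae_update j h] with X hX
    simp only [kernelNorm]
    congr 1
    refine lintegral_congr_ae ?_
    filter_upwards [hX] with y hy
    rw [hy]

/-- A mixed norm over all variables is a number, so that almost everywhere statements about it hold
at the origin. -/
lemma iterNorm_of_ae {l : List (Fin N)} (hl : ∀ j, j ∈ l) {P : (ℝ≥0∞) → Prop}
    (h : ∀ᵐ X, P (iterNorm l q (fun _ _ _ => 1) f X)) :
    P (iterNorm l q (fun _ _ _ => 1) f 0) := by
  obtain ⟨X, hX⟩ := h.exists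
  rwa [iterNorm_one_congr (Y := 0) l (fun j hj => absurd (hl j) hj)] at hX

lemma iterNorm_eq_of_ae_eq {l : List (Fin N)} (hl : ∀ j, j ∈ l) (h : f =ᵐ[volume] g) :
    iterNorm l q (fun _ _ _ => 1) f 0 = iterNorm l q (fun _ _ _ => 1) g 0 := by
  refine iterNorm_of_ae (P := fun c => c = iterNorm l q (fun _ _ _ => 1) g 0) hl ?_
  filter_upwards [iterNorm_congr_ae (q := q) l h] with X hX
  rw [hX]
  exact iterNorm_one_congr l fun j hj => absurd (hl j) hj

lemma ae_lt_top_of_kernelNorm (j : Fin N) {p : ℝ} (hp : 0 < p) (hf : Measurable f)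
    (h : ∀ᵐ X, kernelNorm j p (fun _ _ => 1) f X < ⊤) : ∀ᵐ X, f X < ⊤ := by
  refine ae_of_ae_ae_update j (hf measurableSet_Iio) ?_
  filter_upwards [h] with X hX
  rw [kernelNorm, ENNReal.rpow_lt_top_iff_of_pos (by positivity)] at hX
  simp only [one_mul] at hX
  filter_upwards [ae_lt_top ((hf.comp (measurable_update X)).pow_const p) hX.ne] with y hy
  exact (ENNReal.rpow_lt_top_iff_of_pos hp).1 hy

lemma ae_lt_top_of_iterNorm (l : List (Fin N)) (hq : ∀ j, 0 < q j) (hf : Measurable f)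
    (h : ∀ᵐ X, iterNorm l q (fun _ _ _ => 1) f X < ⊤) : ∀ᵐ X, f X < ⊤ := by
  induction l generalizing f with
  | nil => exact h
  | cons j l ih =>
    exact ae_lt_top_of_kernelNorm j (hq j) hf
      (ih (measurable_kernelNorm j _ measurable_const hf) h)

/-- Dominated convergence for iterated norms. -/
lemma tendsto_iterNorm_zero (l : List (Fin N)) (hq : ∀ j, 0 < q j) (hg : Measurable g)
    (hgfin : ∀ᵐ X, iterNorm l q (fun _ _ _ => 1) g X < ⊤) {h : ℕ → Space n N → ℝ≥0∞}
    (hh : ∀ k, Measurable (h k)) (hhg : ∀ k, h k ≤ g)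
    (hlim : ∀ᵐ X, Filter.Tendsto (fun k => h k X) Filter.atTop (nhds 0)) :
    ∀ᵐ X, Filter.Tendsto (fun k => iterNorm l q (fun _ _ _ => 1) (h k) X) Filter.atTop
      (nhds 0) := by
  induction l generalizing g h with
  | nil => exact hlim
  | cons j l ih =>
    have hgm := measurable_kernelNorm (κ := fun _ _ => 1) j (q j) measurable_const hg
    refine ih hgm hgfin (fun k => measurable_kernelNorm j (q j) measurable_const (hh k))
      (fun k => kernelNorm_mono j (hq j).le (hhg k)) ?_
    filter_upwards [ae_lt_top_of_iterNorm l hq hgm hgfin, ae_ae_update j hlim] with X hX hX'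
    have h0 : Filter.Tendsto (fun k => ∫⁻ y, (1 : ℝ≥0∞) * h k (Function.update X j y) ^ q j)
        Filter.atTop (nhds (∫⁻ _ : EuclideanSpace ℝ (Fin n), 0)) := by
      simp only [one_mul]
      refine tendsto_lintegral_of_dominated_convergence
        (fun y => g (Function.update X j y) ^ q j)
        (fun k => ((hh k).comp (measurable_update X)).pow_const _)
        (fun k => Filter.Eventually.of_forall fun y =>
          ENNReal.rpow_le_rpow (hhg k _) (hq j).le) ?_ ?_
      · rw [kernelNorm, ENNReal.rpow_lt_top_iff_of_pos (by have := hq j; positivity)] at hX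
        simpa using hX.ne
      · filter_upwards [hX'] with y hy
        have := (ENNReal.continuous_rpow_const (y := q j)).tendsto 0 |>.comp hy
        rwa [ENNReal.zero_rpow_of_pos (hq j)] at this
    rw [lintegral_zero] at h0
    have := (ENNReal.continuous_rpow_const (y := 1 / q j)).tendsto 0 |>.comp h0
    rwa [ENNReal.zero_rpow_of_pos (by have := hq j; positivity)] at this

lemma tendsto_iterNorm_zero_of_mem {l : List (Fin N)} (hl : ∀ j, j ∈ l) (hq : ∀ j, 0 < q j)
    (hg : Measurable g) (hgfin : iterNorm l q (fun _ _ _ => 1) g 0 < ⊤)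
    {h : ℕ → Space n N → ℝ≥0∞} (hh : ∀ k, Measurable (h k)) (hhg : ∀ k, h k ≤ g)
    (hlim : ∀ᵐ X, Filter.Tendsto (fun k => h k X) Filter.atTop (nhds 0)) :
    Filter.Tendsto (fun k => iterNorm l q (fun _ _ _ => 1) (h k) 0) Filter.atTop (nhds 0) := by
  have hX : ∀ (f : Space n N → ℝ≥0∞) (X : Space n N),
      iterNorm l q (fun _ _ _ => 1) f X = iterNorm l q (fun _ _ _ => 1) f 0 :=
    fun f X => iterNorm_one_congr l fun j hj => absurd (hl j) hj
  obtain ⟨X, h'⟩ := (tendsto_iterNorm_zero l hq hg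
    (Filter.Eventually.of_forall fun X => by rwa [hX]) hh hhg hlim).exists
  simpa only [hX] using h'

end IterNorm

/-! ### Young's inequality, blockwise and for mixed norms -/

section Young

variable {n N : ℕ}

/-- Young's inequality `L^1 * L^r ⊆ L^r`. -/
lemma young_le {F k : EuclideanSpace ℝ (Fin n) → ℝ≥0∞} (hF : Measurable F) (hk : Measurable k)
    {r : ℝ} (hr : 1 ≤ r) :
    (∫⁻ x, (∫⁻ y, F y * k (x - y)) ^ r) ^ (1 / r) ≤ (∫⁻ y, F y) * (∫⁻ x, k x ^ r) ^ (1 / r) := by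
  have hr0 : 0 < r := by linarith
  have hm : Measurable (Function.uncurry fun x y => F y * k (x - y)) :=
    (hF.comp measurable_snd).mul (hk.comp (measurable_fst.sub measurable_snd))
  refine (rpow_lintegral_lintegral_le hr hm).trans (le_of_eq ?_)
  rw [← lintegral_mul_const _ hF]
  refine lintegral_congr fun y => ?_
  simp_rw [ENNReal.mul_rpow_of_nonneg _ _ hr0.le]
  rw [lintegral_const_mul _
      (show Measurable fun x => k (x - y) ^ r from (hk.comp (measurable_id.sub_const y)).pow_const r),
    ENNReal.mul_rpow_of_nonneg _ _ (by positivity), ← ENNReal.rpow_mul, mul_one_div_cancel hr0.ne',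
    ENNReal.rpow_one, lintegral_sub_right_eq_self (fun x => k x ^ r) y]

/-- Hölder's inequality with respect to a weight. -/
lemma lintegral_mul_le_weighted {φ h : EuclideanSpace ℝ (Fin n) → ℝ≥0∞} (hφ : Measurable φ)
    (hh : Measurable h) {p : ℝ} (hp : 1 ≤ p) :
    ∫⁻ y, φ y * h y ≤ (∫⁻ y, φ y) ^ (1 - 1 / p) * (∫⁻ y, h y ^ p * φ y) ^ (1 / p) := by
  rcases hp.eq_or_lt with rfl | hp
  · simp [mul_comm]
  have hp0 : 0 < p := by linarith
  have hc := (Real.HolderConjugate.conjExponent hp).symm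
  have hq : 1 / (p / (p - 1)) = 1 - 1 / p := by field_simp [show p - 1 ≠ 0 by linarith]
  have hq' : (1 - 1 / p) * (p / (p - 1)) = 1 := by field_simp [show p - 1 ≠ 0 by linarith]
  have h1 : (0 : ℝ) ≤ 1 - 1 / p := by
    rw [sub_nonneg, div_le_one hp0]; exact hp.le
  have := ENNReal.lintegral_mul_le_Lp_mul_Lq volume hc
    (hφ.pow_const (1 - 1 / p)).aemeasurable ((hφ.pow_const (1 / p)).mul hh).aemeasurable
  refine le_trans (le_of_eq ?_) (this.trans (le_of_eq ?_))
  · refine lintegral_congr fun y => ?_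
    simp only [Pi.mul_apply]
    rw [← mul_assoc, ← ENNReal.rpow_add_of_nonneg _ _ h1 (by positivity), sub_add_cancel,
      ENNReal.rpow_one]
  · have e : Real.conjExponent p = p / (p - 1) := rfl
    rw [e, hq]
    congr 2
    · refine lintegral_congr fun y => ?_
      rw [← ENNReal.rpow_mul, hq', ENNReal.rpow_one]
    · refine lintegral_congr fun y => ?_
      simp only [Pi.mul_apply]
      rw [ENNReal.mul_rpow_of_nonneg _ _ hp0.le, ← ENNReal.rpow_mul, one_div_mul_cancel hp0.ne',
        ENNReal.rpow_one, mul_comm]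

/-- Young's inequality `L^p * L^r ⊆ L^2`, in a form in which the norm of the convolution kernel is
expressed by two integrals that are easy to rescale. -/
lemma young_two_le {φ h : EuclideanSpace ℝ (Fin n) → ℝ≥0∞} (hφ : Measurable φ)
    (hh : Measurable h) {p : ℝ} (hp : 1 ≤ p) (hp2 : p ≤ 2) :
    (∫⁻ x, (∫⁻ y, φ (x - y) * h y) ^ (2 : ℝ)) ^ (1 / (2 : ℝ)) ≤
      ((∫⁻ y, φ y) ^ (1 - 1 / p) * (∫⁻ y, φ y ^ (2 / p)) ^ (1 / (2 : ℝ))) *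
        (∫⁻ y, h y ^ p) ^ (1 / p) := by
  have hp0 : 0 < p := by linarith
  have hpt : ∀ x, (∫⁻ y, φ (x - y) * h y) ^ (2 : ℝ) ≤ ((∫⁻ y, φ y) ^ (1 - 1 / p)) ^ (2 : ℝ) *
      (∫⁻ y, h y ^ p * φ (x - y)) ^ (2 / p) := by
    intro x
    have hφx : Measurable fun y => φ (x - y) := hφ.comp (measurable_const.sub measurable_id)
    refine (ENNReal.rpow_le_rpow (lintegral_mul_le_weighted hφx hh hp) (by norm_num)).trans
      (le_of_eq ?_)
    rw [ENNReal.mul_rpow_of_nonneg _ _ (by norm_num), lintegral_sub_left_eq_self φ x,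
      ← ENNReal.rpow_mul, ← ENNReal.rpow_mul, show 1 / p * 2 = 2 / p by ring]
  have hm : Measurable fun x => (∫⁻ y, h y ^ p * φ (x - y)) ^ (2 / p) :=
    (Measurable.lintegral_prod_right' (f := fun z : EuclideanSpace ℝ (Fin n) ×
      EuclideanSpace ℝ (Fin n) => h z.2 ^ p * φ (z.1 - z.2))
      (((hh.pow_const p).comp measurable_snd).mul
        (hφ.comp (measurable_fst.sub measurable_snd)))).pow_const _
  have hy := young_le (hh.pow_const p) hφ (r := 2 / p) ((one_le_div hp0).2 hp2)
  calc _ ≤ (((∫⁻ y, φ y) ^ (1 - 1 / p)) ^ (2 : ℝ) *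
        ∫⁻ x, (∫⁻ y, h y ^ p * φ (x - y)) ^ (2 / p)) ^ (1 / (2 : ℝ)) := by
        rw [← lintegral_const_mul _ hm]
        gcongr with x
        exact hpt x
    _ = (∫⁻ y, φ y) ^ (1 - 1 / p) *
        ((∫⁻ x, (∫⁻ y, h y ^ p * φ (x - y)) ^ (2 / p)) ^ (1 / (2 / p))) ^ (1 / p) := by
        rw [ENNReal.mul_rpow_of_nonneg _ _ (by norm_num)]
        simp only [← ENNReal.rpow_mul]
        rw [show (1 - 1 / p) * 2 * (1 / 2) = 1 - 1 / p by ring,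
          show 1 / (2 / p) * (1 / p) = 1 / 2 by field_simp]
    _ ≤ (∫⁻ y, φ y) ^ (1 - 1 / p) *
        ((∫⁻ y, h y ^ p) * (∫⁻ y, φ y ^ (2 / p)) ^ (1 / (2 / p))) ^ (1 / p) := by
        gcongr
    _ = _ := by
        rw [ENNReal.mul_rpow_of_nonneg _ _ (by positivity), ← ENNReal.rpow_mul]
        rw [show 1 / (2 / p) * (1 / p) = 1 / 2 by field_simp]
        ring

variable {f : Space n N → ℝ≥0∞}
  {κ lam : Fin N → EuclideanSpace ℝ (Fin n) → EuclideanSpace ℝ (Fin n) → ℝ≥0∞}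

lemma kernelNorm_two_conv_le (j : Fin N) {φ : EuclideanSpace ℝ (Fin n) → ℝ≥0∞} (hφ : Measurable φ)
    (hf : Measurable f) {p : ℝ} (hp : 1 ≤ p) (hp2 : p ≤ 2) (X : Space n N) :
    kernelNorm j 2 (fun _ _ => 1) (kernelNorm j 1 (fun x y => φ (x - y)) f) X ≤
      ((∫⁻ y, φ y) ^ (1 - 1 / p) * (∫⁻ y, φ y ^ (2 / p)) ^ (1 / (2 : ℝ))) *
        kernelNorm j p (fun _ _ => 1) f X := by
  simpa [kernelNorm] using young_two_le hφ (hf.comp (measurable_update (a := j) X)) hp hp2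

/-- Local `L^p` averages are bounded on `L^q` for `q ≥ p`. -/
lemma kernelNorm_average_le (j : Fin N) {k : EuclideanSpace ℝ (Fin n) → ℝ≥0∞} (hk : Measurable k)
    (hf : Measurable f) {p q : ℝ} (hp : 0 < p) (hpq : p ≤ q) (X : Space n N) :
    kernelNorm j q (fun _ _ => 1) (kernelNorm j p (fun x y => k (x - y)) f) X ≤
      (∫⁻ y, k y) ^ (1 / p) * kernelNorm j q (fun _ _ => 1) f X := by
  have hq : 0 < q := hp.trans_le hpq
  have hg : Measurable fun y => f (Function.update X j y) := hf.comp (measurable_update X)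
  have hy := young_le hk (hg.pow_const p) (r := q / p) ((one_le_div hp).2 hpq)
  have hsub : ∀ x, ∫⁻ y, k y * f (Function.update X j (x - y)) ^ p =
      ∫⁻ y, k (x - y) * f (Function.update X j y) ^ p := by
    intro x
    rw [← lintegral_sub_left_eq_self _ x]
    simp
  simp_rw [hsub, ← ENNReal.rpow_mul, show p * (q / p) = q by field_simp] at hy
  have := ENNReal.rpow_le_rpow hy (show 0 ≤ 1 / p by positivity)
  rw [ENNReal.mul_rpow_of_nonneg _ _ (by positivity), ← ENNReal.rpow_mul, ← ENNReal.rpow_mul,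
    show 1 / (q / p) * (1 / p) = 1 / q by field_simp] at this
  simp only [kernelNorm, Function.update_self, Function.update_idem, one_mul, ← ENNReal.rpow_mul]
  simpa only [show 1 / p * q = q / p by ring] using this

/-- A block norm with a larger exponent may be moved inside an iterated norm in the other blocks. -/
lemma kernelNorm_iterNorm_le {j : Fin N} {l : List (Fin N)} (hj : j ∉ l) {r : ℝ} {s : Fin N → ℝ}
    (hs : ∀ i ∈ l, 0 < s i ∧ s i ≤ r) (hs0 : ∀ i, 0 ≤ s i)
    {κ : EuclideanSpace ℝ (Fin n) → EuclideanSpace ℝ (Fin n) → ℝ≥0∞}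
    (hκ : Measurable (Function.uncurry κ)) (hlam : ∀ i, Measurable (Function.uncurry (lam i)))
    (hf : Measurable f) :
    kernelNorm j r κ (iterNorm l s lam f) ≤ iterNorm l s lam (kernelNorm j r κ f) := by
  induction l generalizing f with
  | nil => exact le_rfl
  | cons i l ih =>
    simp only [List.mem_cons, not_or] at hj
    refine (ih hj.2 (fun i hi => hs i (by simp [hi])) (measurable_kernelNorm i _ (hlam i) hf)).trans
      (iterNorm_mono l hs0 ?_)
    exact kernelNorm_swap_le hj.1 (hs i (by simp)).1 (hs i (by simp)).2 hκ (hlam i) hf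

/-- A block norm with a smaller exponent may be moved outside an iterated norm in the other blocks. -/
lemma iterNorm_kernelNorm_le {j : Fin N} {l : List (Fin N)} (hj : j ∉ l) {s : ℝ} {r : Fin N → ℝ}
    (hs0 : 0 < s) (hr : ∀ i, s ≤ r i)
    {lam : EuclideanSpace ℝ (Fin n) → EuclideanSpace ℝ (Fin n) → ℝ≥0∞}
    (hκ : ∀ i, Measurable (Function.uncurry (κ i))) (hlam : Measurable (Function.uncurry lam))
    (hf : Measurable f) :
    iterNorm l r κ (kernelNorm j s lam f) ≤ kernelNorm j s lam (iterNorm l r κ f) := by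
  induction l generalizing f with
  | nil => exact le_rfl
  | cons i l ih =>
    simp only [List.mem_cons, not_or] at hj
    refine (iterNorm_mono l (fun i => hs0.le.trans (hr i)) ?_).trans
      (ih hj.2 (measurable_kernelNorm i _ (hκ i) hf))
    exact kernelNorm_swap_le (Ne.symm hj.1) hs0 (hr i) (hκ i) hlam hf

lemma measurable_uncurry_sub {k : EuclideanSpace ℝ (Fin n) → ℝ≥0∞} (hk : Measurable k) :
    Measurable (Function.uncurry fun x y => k (x - y)) :=
  hk.comp (measurable_fst.sub measurable_snd)

lemma prod_map_ne_top {l : List (Fin N)} {c : Fin N → ℝ≥0∞} (hc : ∀ j, c j ≠ ⊤) :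
    (l.map c).prod ≠ ⊤ := by
  induction l with
  | nil => simp
  | cons j l ih => simpa using ENNReal.mul_ne_top (hc j) ih

/-- The mixed-norm form of Young's inequality `L^p * L^r ⊆ L^2`. -/
lemma iterNorm_two_conv_le {l : List (Fin N)} (hl : l.Nodup)
    {φ : EuclideanSpace ℝ (Fin n) → ℝ≥0∞} (hφ : Measurable φ) {p : Fin N → ℝ}
    (hp : ∀ j, p j ∈ Set.Icc (1 : ℝ) 2) {c : Fin N → ℝ≥0∞} (hc : ∀ j, c j ≠ ⊤)
    (hφc : ∀ j, (∫⁻ y, φ y) ^ (1 - 1 / p j) * (∫⁻ y, φ y ^ (2 / p j)) ^ (1 / (2 : ℝ)) ≤ c j)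
    (hf : Measurable f) (X : Space n N) :
    iterNorm l (fun _ => 2) (fun _ _ _ => 1)
        (iterNorm l (fun _ => 1) (fun _ x y => φ (x - y)) f) X ≤
      (l.map c).prod * iterNorm l p (fun _ _ _ => 1) f X := by
  induction l generalizing f with
  | nil => simp
  | cons j l ih =>
    rw [List.nodup_cons] at hl
    have hφm := measurable_uncurry_sub hφ
    have hp0 : 0 < p j := zero_lt_one.trans_le (hp j).1
    have h2 : ∀ i : Fin N, (0 : ℝ) ≤ (fun _ : Fin N => (2 : ℝ)) i := fun _ => by norm_num
    have hm := measurable_kernelNorm (κ := fun _ _ => 1) j (p j) measurable_const hf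
    simp only [iterNorm_cons, List.map_cons, List.prod_cons]
    have key : kernelNorm j 2 (fun _ _ => 1) (iterNorm l (fun _ => 1) (fun _ x y => φ (x - y))
        (kernelNorm j 1 (fun x y => φ (x - y)) f)) ≤ fun X => c j *
        iterNorm l (fun _ => 1) (fun _ x y => φ (x - y)) (kernelNorm j (p j) (fun _ _ => 1) f) X := by
      intro X
      have h1 := iterNorm_kernelNorm_le hl.1 one_pos (fun _ => le_rfl) (r := fun _ : Fin N => (1 : ℝ))
        (κ := fun _ x y => φ (x - y)) (fun _ => hφm) hφm hf
      refine (kernelNorm_mono j (by norm_num) h1 X).trans ?_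
      refine (kernelNorm_two_conv_le j hφ (measurable_iterNorm l (fun _ => hφm) hf)
        (hp j).1 (hp j).2 X).trans ?_
      have h3 := kernelNorm_iterNorm_le (s := fun _ : Fin N => (1 : ℝ))
        (lam := fun _ x y => φ (x - y)) (κ := fun _ _ => 1) hl.1 (r := p j)
        (fun i _ => ⟨one_pos, (hp j).1⟩) (fun _ => zero_le_one)
        measurable_const (fun _ => hφm) hf X
      exact mul_le_mul' (hφc j) h3
    refine (iterNorm_mono l h2 key X).trans ?_
    rw [iterNorm_const_mul l (fun _ => by norm_num) (hc j)]
    refine (mul_le_mul_right (ih hl.2 hm) (c j)).trans (le_of_eq ?_)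
    ring

/-- Local averages are bounded from the mixed norm space with decreasing exponents to the one with
the reversed order of integration: the averages are bounded on the innermost variable, and
Minkowski's inequality brings the variables with larger exponents inside. -/
lemma iterNorm_reverse_average_le {l : List (Fin N)} {q p : Fin N → ℝ}
    (hl : l.Pairwise fun i j => i ≠ j ∧ q j ≤ q i) (hp : ∀ j, 0 < p j) (hpq : ∀ j, p j ≤ q j)
    {k : EuclideanSpace ℝ (Fin n) → ℝ≥0∞} (hk : Measurable k) (hk' : ∫⁻ y, k y ≠ ⊤)
    (hf : Measurable f) (X : Space n N) :
    iterNorm l.reverse q (fun _ _ _ => 1) (iterNorm l p (fun _ x y => k (x - y)) f) X ≤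
      (l.map fun j => (∫⁻ y, k y) ^ (1 / p j)).prod * iterNorm l q (fun _ _ _ => 1) f X := by
  have hq : ∀ j, 0 < q j := fun j => (hp j).trans_le (hpq j)
  have hc : ∀ j, (∫⁻ y, k y) ^ (1 / p j) ≠ ⊤ := fun j =>
    ENNReal.rpow_ne_top_of_nonneg (by have := hp j; positivity) hk'
  induction l generalizing f X with
  | nil => simp
  | cons i l ih =>
    rw [List.pairwise_cons] at hl
    have hil : i ∉ l := fun h => (hl.1 i h).1 rfl
    have hkm := measurable_uncurry_sub hk
    have hm := measurable_kernelNorm i (p i) hkm hf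
    simp only [iterNorm_cons, List.reverse_cons, iterNorm_concat, List.map_cons, List.prod_cons]
    refine (kernelNorm_mono i (hq i).le (fun X => ih hl.2 hm X) X).trans ?_
    rw [kernelNorm_const_mul i (hq i) (prod_map_ne_top hc), mul_comm ((_ : ℝ≥0∞) ^ _), mul_assoc]
    refine mul_le_mul_right ?_ _
    refine (kernelNorm_iterNorm_le hil (fun j hj => ⟨hq j, (hl.1 j hj).2⟩) (fun j => (hq j).le)
      measurable_const (fun _ => measurable_const) hm X).trans ?_
    have h1 := iterNorm_const_mul (n := n) (κ := fun _ _ _ => 1) l hq (hc i)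
      (f := kernelNorm i (q i) (fun _ _ => 1) f)
    refine le_trans (iterNorm_mono l (fun j => (hq j).le) (fun X => ?_) X) (congrFun h1 X).le
    exact kernelNorm_average_le i hk hf (hp i) (hpq i) X

end Young

/-! ### Local averages and the maximal function -/

section Averages

variable {n N : ℕ}

/-- The weight `(1 + |τ z|²)^{-n}`, which is integrable and decays on the scale `1/τ`. -/
noncomputable def decay (n : ℕ) (τ : ℝ) (z : EuclideanSpace ℝ (Fin n)) : ℝ≥0∞ :=
  ENNReal.ofReal (((1 + ‖τ • z‖ ^ 2) ^ n)⁻¹)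

lemma measurable_decay (τ : ℝ) : Measurable (decay n τ) := by
  unfold decay
  fun_prop

lemma decay_ne_top (τ : ℝ) (z : EuclideanSpace ℝ (Fin n)) : decay n τ z ≠ ⊤ := ENNReal.ofReal_ne_top

lemma lintegral_comp_smul_eq {τ : ℝ} (hτ : 0 < τ) {k : EuclideanSpace ℝ (Fin n) → ℝ≥0∞}
    (hk : Measurable k) :
    ∫⁻ z, k (τ • z) = ENNReal.ofReal (τ ^ n)⁻¹ * ∫⁻ z, k z := by
  have := Measure.map_addHaar_smul (volume : Measure (EuclideanSpace ℝ (Fin n))) hτ.ne'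
  rw [← lintegral_map hk (measurable_const_smul τ), this, lintegral_smul_measure, smul_eq_mul,
    finrank_euclideanSpace_fin, abs_of_pos (by positivity)]

lemma lintegral_decay_one_ne_top (hn : 1 ≤ n) : ∫⁻ z, decay n 1 z ≠ ⊤ := by
  have hi := integrable_rpow_neg_one_add_norm_sq (E := EuclideanSpace ℝ (Fin n)) (μ := volume)
    (r := 2 * n) (by
      rw [finrank_euclideanSpace_fin]
      have : (1 : ℝ) ≤ n := by exact_mod_cast hn
      linarith)
  have h := hi.lintegral_lt_top
  refine ne_of_eq_of_ne (lintegral_congr fun z => ?_) h.ne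
  rw [decay, one_smul, show -(2 * (n : ℝ)) / 2 = -(n : ℝ) by ring,
    Real.rpow_neg (by positivity), Real.rpow_natCast]

lemma lintegral_decay {τ : ℝ} (hτ : 0 < τ) :
    ∫⁻ z, decay n τ z = ENNReal.ofReal (τ ^ n)⁻¹ * ∫⁻ z, decay n 1 z := by
  rw [← lintegral_comp_smul_eq hτ (measurable_decay 1)]
  simp [decay]

/-- Averages against `decay` are controlled by averages over balls, by decomposition into dyadic
shells. -/
lemma lintegral_decay_mul_le (hn : 1 ≤ n) {τ : ℝ} (hτ : 0 < τ) (x : EuclideanSpace ℝ (Fin n))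
    {g : EuclideanSpace ℝ (Fin n) → ℝ≥0∞} {A : ℝ≥0∞}
    (hA : ∀ r : ℝ, 0 < r → ∫⁻ y in Metric.ball x r, g y ≤ volume (Metric.ball x r) * A) :
    ∫⁻ y, decay n τ (x - y) * g y ≤ ENNReal.ofReal (τ ^ n)⁻¹ *
      (2 * 4 ^ n * volume (Metric.ball (0 : EuclideanSpace ℝ (Fin n)) 1)) * A := by
  set v := volume (Metric.ball (0 : EuclideanSpace ℝ (Fin n)) 1) with hv
  set t : EuclideanSpace ℝ (Fin n) → ℝ := fun y => τ * ‖x - y‖ with ht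
  have htm : Measurable t := by fun_prop
  -- on `S i` the weight is at most `4^n 4^{-in}`, while `S i` lies in a ball of radius `2^i / τ`
  set S : ℕ → Set (EuclideanSpace ℝ (Fin n)) :=
    fun i => {y | t y < 2 ^ i ∧ (4 : ℝ) ^ i ≤ 4 * (1 + t y ^ 2)} with hS
  have hSm : ∀ i, MeasurableSet (S i) := fun i =>
    (measurableSet_lt htm measurable_const).inter
      (measurableSet_le measurable_const (((htm.pow_const 2).const_add 1).const_mul 4))
  have hcover : (⋃ i, S i) = Set.univ := by
    refine Set.eq_univ_of_forall fun y => Set.mem_iUnion.2 ?_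
    have hex : ∃ i : ℕ, t y < 2 ^ i := pow_unbounded_of_one_lt _ one_lt_two
    classical
    refine ⟨Nat.find hex, Nat.find_spec hex, ?_⟩
    rcases Nat.eq_zero_or_pos (Nat.find hex) with h0 | h0
    · rw [h0]; nlinarith [sq_nonneg (t y)]
    · obtain ⟨i, hi⟩ : ∃ i, Nat.find hex = i + 1 := ⟨_, (Nat.succ_pred_eq_of_pos h0).symm⟩
      have h1 : (2 : ℝ) ^ i ≤ t y := not_lt.1 (Nat.find_min hex (by omega : i < Nat.find hex))
      have h2 : (4 : ℝ) ^ i ≤ t y ^ 2 := by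
        rw [show (4 : ℝ) ^ i = ((2 : ℝ) ^ i) ^ 2 by rw [← pow_mul, mul_comm, pow_mul]; norm_num]
        gcongr
      rw [hi, pow_succ]
      nlinarith
  have hshell : ∀ i : ℕ, ∫⁻ y in S i, decay n τ (x - y) * g y ≤
      ENNReal.ofReal (τ ^ n)⁻¹ * (4 ^ n * v) * A * (1 / 2) ^ i := by
    intro i
    have hr : (0 : ℝ) < 2 ^ i / τ := by positivity
    have hball : S i ⊆ Metric.ball x (2 ^ i / τ) := by
      intro y hy
      rw [Metric.mem_ball, dist_comm, dist_eq_norm, lt_div_iff₀ hτ, mul_comm]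
      exact hy.1
    calc ∫⁻ y in S i, decay n τ (x - y) * g y
        ≤ ∫⁻ y in S i, ENNReal.ofReal ((4 / 4 ^ i) ^ n) * g y := by
          refine setLIntegral_mono' (hSm i) fun y hy => ?_
          gcongr
          rw [decay]
          refine ENNReal.ofReal_le_ofReal ?_
          rw [← inv_pow]
          gcongr
          rw [norm_smul, Real.norm_of_nonneg hτ.le, inv_eq_one_div,
            div_le_div_iff₀ (by positivity) (by positivity)]
          have := hy.2
          simp only [ht] at this
          linarith
      _ ≤ ∫⁻ y in Metric.ball x (2 ^ i / τ), ENNReal.ofReal ((4 / 4 ^ i) ^ n) * g y :=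
          lintegral_mono_set hball
      _ = ENNReal.ofReal ((4 / 4 ^ i) ^ n) * ∫⁻ y in Metric.ball x (2 ^ i / τ), g y :=
          lintegral_const_mul' _ _ ENNReal.ofReal_ne_top
      _ ≤ ENNReal.ofReal ((4 / 4 ^ i) ^ n) * ((ENNReal.ofReal ((2 ^ i / τ) ^ n) * v) * A) := by
          gcongr
          refine (hA _ hr).trans (le_of_eq ?_)
          rw [Measure.addHaar_ball_of_pos _ _ hr, finrank_euclideanSpace_fin]
      _ = ENNReal.ofReal ((4 / 4 ^ i) ^ n * (2 ^ i / τ) ^ n) * (v * A) := by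
          rw [ENNReal.ofReal_mul (by positivity)]; ring
      _ ≤ ENNReal.ofReal ((τ ^ n)⁻¹ * 4 ^ n * (1 / 2) ^ i) * (v * A) := by
          refine mul_le_mul_left (ENNReal.ofReal_le_ofReal ?_) _
          have h1 : (4 / 4 ^ i : ℝ) ^ n * (2 ^ i / τ) ^ n = (τ ^ n)⁻¹ * 4 ^ n * ((1 / 2) ^ i) ^ n := by
            rw [← mul_pow, ← inv_pow, ← mul_pow, ← mul_pow]
            congr 1
            rw [show (4 : ℝ) ^ i = 2 ^ i * 2 ^ i by rw [← mul_pow]; norm_num, one_div, inv_pow]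
            field_simp
          rw [h1]
          refine mul_le_mul_of_nonneg_left ?_ (by positivity)
          exact pow_le_of_le_one (by positivity) (pow_le_one₀ (by norm_num) (by norm_num)) (by omega)
      _ = _ := by
          rw [ENNReal.ofReal_mul (by positivity), ENNReal.ofReal_mul (by positivity),
            ENNReal.ofReal_pow (by norm_num), ENNReal.ofReal_pow (by norm_num)]
          simp only [one_div, ENNReal.ofReal_ofNat]
          rw [ENNReal.ofReal_inv_of_pos (by norm_num : (0 : ℝ) < 2), ENNReal.ofReal_ofNat]
          ring
  calc ∫⁻ y, decay n τ (x - y) * g y = ∫⁻ y in ⋃ i, S i, decay n τ (x - y) * g y := by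
        rw [hcover, Measure.restrict_univ]
    _ ≤ ∑' i, ∫⁻ y in S i, decay n τ (x - y) * g y := lintegral_iUnion_le _ _
    _ ≤ ∑' i : ℕ, ENNReal.ofReal (τ ^ n)⁻¹ * (4 ^ n * v) * A * (1 / 2) ^ i :=
        ENNReal.tsum_le_tsum hshell
    _ = _ := by
        rw [ENNReal.tsum_mul_left, ENNReal.tsum_geometric, one_div, ENNReal.one_sub_inv_two, inv_inv]
        ring

lemma partialMaximal_mono (j : Fin N) {p : ℝ} (hp : 0 ≤ p) {f g : Space n N → ℝ≥0∞} (h : f ≤ g) :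
    partialMaximal j p f ≤ partialMaximal j p g := by
  intro X
  unfold partialMaximal
  gcongr with z r hr y
  exact h _

lemma partialMaximal_const_mul_le (j : Fin N) {p : ℝ} (hp : 0 < p) {c : ℝ≥0∞} (hc : c ≠ ⊤)
    (f : Space n N → ℝ≥0∞) (X : Space n N) :
    partialMaximal j p (fun X => c * f X) X ≤ c * partialMaximal j p f X := by
  refine iSup_le fun z => iSup_le fun r => iSup_le fun hr => ?_
  have hle : ((volume (Metric.ball z r))⁻¹ *
      ∫⁻ y in Metric.ball z r, f (Function.update X j y) ^ p) ^ (1 / p) ≤ partialMaximal j p f X :=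
    le_iSup_of_le z (le_iSup_of_le r (le_iSup_of_le hr le_rfl))
  refine le_trans (le_of_eq ?_) (mul_le_mul_right hle c)
  simp_rw [ENNReal.mul_rpow_of_nonneg _ _ hp.le]
  rw [lintegral_const_mul' _ _ (ENNReal.rpow_ne_top_of_nonneg hp.le hc), mul_left_comm,
    ENNReal.mul_rpow_of_nonneg _ _ (by positivity), ← ENNReal.rpow_mul, mul_one_div_cancel hp.ne',
    ENNReal.rpow_one]

lemma kernelNorm_decay_le_partialMaximal (hn : 1 ≤ n) (j : Fin N) {p : ℝ} (hp : 0 < p) {τ : ℝ}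
    (hτ : 0 < τ) (f : Space n N → ℝ≥0∞) (X : Space n N) :
    kernelNorm j p (fun x y => decay n τ (x - y)) f X ≤
      (ENNReal.ofReal (τ ^ n)⁻¹ *
        (2 * 4 ^ n * volume (Metric.ball (0 : EuclideanSpace ℝ (Fin n)) 1))) ^ (1 / p) *
        partialMaximal j p f X := by
  have h := lintegral_decay_mul_le hn hτ (X j) (g := fun y => f (Function.update X j y) ^ p)
    (A := partialMaximal j p f X ^ p) ?_
  · refine (ENNReal.rpow_le_rpow h (show 0 ≤ 1 / p by positivity)).trans (le_of_eq ?_)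
    rw [ENNReal.mul_rpow_of_nonneg _ _ (by positivity), ← ENNReal.rpow_mul, mul_one_div_cancel hp.ne',
      ENNReal.rpow_one]
  · intro r hr
    have hle : ((volume (Metric.ball (X j) r))⁻¹ *
        ∫⁻ y in Metric.ball (X j) r, f (Function.update X j y) ^ p) ^ (1 / p) ≤
        partialMaximal j p f X :=
      le_iSup_of_le (X j) (le_iSup_of_le r (le_iSup_of_le (Metric.mem_ball_self hr) le_rfl))
    rw [one_div, ENNReal.rpow_inv_le_iff hp] at hle
    have hv0 : volume (Metric.ball (X j) r) ≠ 0 := (Metric.measure_ball_pos volume _ hr).ne'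
    have hvt : volume (Metric.ball (X j) r) ≠ ⊤ := measure_ball_lt_top.ne
    calc _ = volume (Metric.ball (X j) r) * ((volume (Metric.ball (X j) r))⁻¹ *
          ∫⁻ y in Metric.ball (X j) r, f (Function.update X j y) ^ p) := by
          rw [← mul_assoc, ENNReal.mul_inv_cancel hv0 hvt, one_mul]
      _ ≤ _ := by gcongr

/-- Iterated averages are dominated by the iterated maximal function. -/
lemma iterNorm_decay_le_maximal (hn : 1 ≤ n) (l : List (Fin N)) {p : Fin N → ℝ} (hp : ∀ j, 0 < p j)
    {τ : ℝ} (hτ : 0 < τ) (f : Space n N → ℝ≥0∞) (X : Space n N) :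
    iterNorm l p (fun _ x y => decay n τ (x - y)) f X ≤
      (l.map fun j => (ENNReal.ofReal (τ ^ n)⁻¹ *
        (2 * 4 ^ n * volume (Metric.ball (0 : EuclideanSpace ℝ (Fin n)) 1))) ^ (1 / p j)).prod *
        l.foldl (fun g j => partialMaximal j (p j) g) f X := by
  have hc : ∀ j, (ENNReal.ofReal (τ ^ n)⁻¹ *
      (2 * 4 ^ n * volume (Metric.ball (0 : EuclideanSpace ℝ (Fin n)) 1))) ^ (1 / p j) ≠ ⊤ :=
    fun j => ENNReal.rpow_ne_top_of_nonneg (by have := hp j; positivity)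
      (ENNReal.mul_ne_top ENNReal.ofReal_ne_top
        (ENNReal.mul_ne_top (by finiteness) measure_ball_lt_top.ne))
  induction l using List.reverseRecOn generalizing X with
  | nil => simp
  | append_singleton l j ih =>
    rw [iterNorm_concat, List.foldl_append]
    simp only [List.map_append, List.map_cons, List.map_nil, List.prod_append, List.prod_cons,
      List.prod_nil, mul_one, List.foldl_cons, List.foldl_nil]
    refine (kernelNorm_decay_le_partialMaximal hn j (hp j) hτ _ X).trans ?_
    refine (mul_le_mul_right ((partialMaximal_mono j (hp j).le (fun X => ih X) X).trans
      (partialMaximal_const_mul_le j (hp j) (prod_map_ne_top hc) _ X)) _).trans (le_of_eq ?_)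
    ring

end Averages

/-! ### The Fourier transform on the block space -/

section Fourier

variable {n N : ℕ}

instance isNegInvariant_volume : (volume : Measure (Space n N)).IsNegInvariant :=
  Measure.pi.isNegInvariant _

/-- The unnormalized inverse Fourier transform `∫ g(Ξ) e^{i⟨Z, Ξ⟩} dΞ`. -/
noncomputable def invFourier (g : Space n N → ℂ) (Z : Space n N) : ℂ :=
  ∫ Ξ, g Ξ * Complex.exp (Complex.I * (dot Z Ξ : ℂ))

lemma continuous_dot : Continuous fun z : Space n N × Space n N => dot z.1 z.2 := by
  unfold dot
  fun_prop

lemma dot_add_left (X Y Ξ : Space n N) : dot (X + Y) Ξ = dot X Ξ + dot Y Ξ := by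
  simp [dot, inner_add_left, Finset.sum_add_distrib]

lemma dot_neg_left (X Ξ : Space n N) : dot (-X) Ξ = -dot X Ξ := by
  simp [dot]

lemma dot_sub_left (X Y Ξ : Space n N) : dot (X - Y) Ξ = dot X Ξ - dot Y Ξ := by
  rw [sub_eq_add_neg, dot_add_left, dot_neg_left, sub_eq_add_neg]

lemma dot_comm (X Ξ : Space n N) : dot X Ξ = dot Ξ X := by
  simp only [dot]
  exact Finset.sum_congr rfl fun j _ => real_inner_comm _ _

@[simp] lemma norm_exp_I_mul (t : ℝ) : ‖Complex.exp (Complex.I * (t : ℂ))‖ = 1 := by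
  rw [mul_comm, Complex.norm_exp_ofReal_mul_I]

lemma continuous_phase_right (Z : Space n N) :
    Continuous fun Ξ : Space n N => Complex.exp (Complex.I * (dot Z Ξ : ℂ)) := by
  unfold dot
  fun_prop

lemma continuous_phase_left (Ξ : Space n N) :
    Continuous fun Z : Space n N => Complex.exp (Complex.I * (dot Z Ξ : ℂ)) := by
  unfold dot
  fun_prop

lemma integrable_mul_phase {g : Space n N → ℂ} (hg : Integrable g) (Z : Space n N) :
    Integrable fun Ξ => g Ξ * Complex.exp (Complex.I * (dot Z Ξ : ℂ)) :=
  hg.mul_bdd (c := 1) (continuous_phase_right Z).aestronglyMeasurable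
    (Filter.Eventually.of_forall fun Ξ => by simp)

lemma continuous_invFourier {g : Space n N → ℂ} (hg : Integrable g) : Continuous (invFourier g) := by
  refine continuous_of_dominated (bound := fun Ξ => ‖g Ξ‖) (fun Z => ?_) (fun Z => ?_) hg.norm ?_
  · exact hg.aestronglyMeasurable.mul (continuous_phase_right Z).aestronglyMeasurable
  · exact Filter.Eventually.of_forall fun Ξ => by simp
  · exact Filter.Eventually.of_forall fun Ξ =>
      continuous_const.mul (continuous_phase_left Ξ)

/-- The unit vector in the direction of a coordinate. -/
noncomputable def unitVec (i : Fin N × Fin n) : Space n N :=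
  Pi.single i.1 (EuclideanSpace.single i.2 1)

lemma dot_unitVec (Z : Space n N) (i : Fin N × Fin n) : dot Z (unitVec i) = Z i.1 i.2 := by
  classical
  simp only [dot, unitVec]
  rw [Finset.sum_eq_single i.1]
  · simp [EuclideanSpace.inner_single_right]
  · intro j _ hj; simp [Pi.single_eq_of_ne hj]
  · simp

lemma hasFDerivAt_phase (Z Ξ : Space n N) (i : Fin N × Fin n) :
    DifferentiableAt ℝ (fun Ξ : Space n N => Complex.exp (Complex.I * (dot Z Ξ : ℂ))) Ξ ∧
    fderiv ℝ (fun Ξ : Space n N => Complex.exp (Complex.I * (dot Z Ξ : ℂ))) Ξ (unitVec i) =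
      Complex.I * (Z i.1 i.2 : ℂ) * Complex.exp (Complex.I * (dot Z Ξ : ℂ)) := by
  let L : Space n N →L[ℝ] ℝ :=
    ∑ j, (innerSL ℝ (Z j)).comp (ContinuousLinearMap.proj (R := ℝ) j)
  have hL : ∀ Ξ, L Ξ = dot Z Ξ := by
    intro Ξ; simp [L, dot]
  have h1 : HasFDerivAt (fun Ξ : Space n N => (dot Z Ξ : ℂ)) (Complex.ofRealCLM.comp L) Ξ := by
    have := (Complex.ofRealCLM.comp L).hasFDerivAt (x := Ξ)
    refine this.congr_of_eventuallyEq (Filter.Eventually.of_forall fun Y => ?_)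
    simp [hL]
  have h2 := (h1.const_mul Complex.I).cexp
  refine ⟨h2.differentiableAt, ?_⟩
  rw [h2.fderiv]
  simp only [smul_apply, ContinuousLinearMap.comp_apply, hL, dot_unitVec,
    Complex.ofRealCLM_apply, smul_eq_mul]
  ring

lemma contDiff_partialDeriv {g : Space n N → ℂ} (hg : ContDiff ℝ ∞ g) (i : Fin N × Fin n) :
    ContDiff ℝ ∞ (partialDeriv i g) :=
  (hg.fderiv_right (by simp)).clm_apply contDiff_const

lemma hasCompactSupport_partialDeriv {g : Space n N → ℂ} (hg : HasCompactSupport g)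
    (i : Fin N × Fin n) : HasCompactSupport (partialDeriv i g) :=
  hg.fderiv_apply ℝ _

lemma invFourier_partialDeriv {g : Space n N → ℂ} (hg : ContDiff ℝ ∞ g) (hc : HasCompactSupport g)
    (i : Fin N × Fin n) (Z : Space n N) :
    invFourier (partialDeriv i g) Z = -(Complex.I * (Z i.1 i.2 : ℂ)) * invFourier g Z := by
  have hph := continuous_phase_right Z
  have hf := fun Ξ => hasFDerivAt_phase Z Ξ i
  have h := integral_mul_fderiv_eq_neg_fderiv_mul_of_integrable (μ := volume) (f := g)
    (g := fun Ξ : Space n N => Complex.exp (Complex.I * (dot Z Ξ : ℂ))) (v := unitVec i)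
    (((contDiff_partialDeriv hg i).continuous.mul hph).integrable_of_hasCompactSupport
      (hasCompactSupport_partialDeriv hc i).mul_right)
    (by
      simp only [(hf _).2]
      exact (hg.continuous.mul (continuous_const.mul hph)).integrable_of_hasCompactSupport
        hc.mul_right)
    ((hg.continuous.mul hph).integrable_of_hasCompactSupport hc.mul_right)
    (fun Ξ _ => hg.differentiable (by simp) Ξ) (fun Ξ _ => (hf Ξ).1)
  simp only [(hf _).2] at h
  have h' : ∫ Ξ, g Ξ * (Complex.I * (Z i.1 i.2 : ℂ) * Complex.exp (Complex.I * (dot Z Ξ : ℂ))) =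
      (Complex.I * (Z i.1 i.2 : ℂ)) * invFourier g Z := by
    rw [invFourier, ← integral_const_mul]
    exact integral_congr_ae (Filter.Eventually.of_forall fun Ξ => by ring)
  rw [h'] at h
  rw [neg_mul, h, neg_neg]
  rfl

/-- The differential operator `1 - τ² ∂_i²`, which is dual to multiplication by `1 + τ² z_i²`. -/
noncomputable def diffOp (τ : ℝ) (i : Fin N × Fin n) (g : Space n N → ℂ) : Space n N → ℂ :=
  fun Ξ => g Ξ - (τ ^ 2 : ℝ) * partialDeriv i (partialDeriv i g) Ξ

lemma contDiff_diffOp {g : Space n N → ℂ} (hg : ContDiff ℝ ∞ g) (τ : ℝ) (i : Fin N × Fin n) :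
    ContDiff ℝ ∞ (diffOp τ i g) :=
  hg.sub (contDiff_const.mul (contDiff_partialDeriv (contDiff_partialDeriv hg i) i))

lemma hasCompactSupport_diffOp {g : Space n N → ℂ} (hg : HasCompactSupport g) (τ : ℝ)
    (i : Fin N × Fin n) : HasCompactSupport (diffOp τ i g) :=
  hg.sub (hasCompactSupport_partialDeriv (hasCompactSupport_partialDeriv hg i) i).mul_left

lemma invFourier_diffOp {g : Space n N → ℂ} (hg : ContDiff ℝ ∞ g) (hc : HasCompactSupport g)
    (τ : ℝ) (i : Fin N × Fin n) (Z : Space n N) :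
    invFourier (diffOp τ i g) Z = (1 + (τ ^ 2 * Z i.1 i.2 ^ 2 : ℝ) : ℂ) * invFourier g Z := by
  have h1 := contDiff_partialDeriv hg i
  have h1c := hasCompactSupport_partialDeriv hc i
  have h2 := contDiff_partialDeriv h1 i
  have h2c := hasCompactSupport_partialDeriv h1c i
  have e : invFourier (diffOp τ i g) Z =
      invFourier g Z - (τ ^ 2 : ℝ) * invFourier (partialDeriv i (partialDeriv i g)) Z := by
    simp only [invFourier, diffOp, sub_mul, mul_assoc]
    rw [integral_sub (integrable_mul_phase (hg.continuous.integrable_of_hasCompactSupport hc) Z)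
      ((integrable_mul_phase (h2.continuous.integrable_of_hasCompactSupport h2c) Z).const_mul _),
      integral_const_mul]
  rw [e, invFourier_partialDeriv h1 h1c, invFourier_partialDeriv hg hc]
  push_cast
  linear_combination (-(τ : ℂ) ^ 2 * (Z i.1 i.2 : ℂ) ^ 2 * invFourier g Z) * Complex.I_sq

/-- The composition of the operators `1 - τ² ∂_i²` over a list of coordinates. -/
noncomputable def diffOps (τ : ℝ) (l : List (Fin N × Fin n)) (g : Space n N → ℂ) :
    Space n N → ℂ :=
  l.foldr (diffOp τ) g

/-- On the Fourier side `diffOps` is multiplication by a polynomial weight. -/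
lemma diffOps_spec {g : Space n N → ℂ} (hg : ContDiff ℝ ∞ g) (hc : HasCompactSupport g) (τ : ℝ)
    (l : List (Fin N × Fin n)) :
    ContDiff ℝ ∞ (diffOps τ l g) ∧ HasCompactSupport (diffOps τ l g) ∧
      ∀ Z, invFourier (diffOps τ l g) Z =
        ((l.map fun i => 1 + τ ^ 2 * Z i.1 i.2 ^ 2).prod : ℝ) * invFourier g Z := by
  induction l with
  | nil => exact ⟨hg, hc, fun Z => by simp [diffOps]⟩
  | cons i l ih =>
    obtain ⟨h1, h2, h3⟩ := ih
    refine ⟨contDiff_diffOp h1 τ i, hasCompactSupport_diffOp h2 τ i, fun Z => ?_⟩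
    change invFourier (diffOp τ i (diffOps τ l g)) Z = _
    rw [invFourier_diffOp h1 h2, h3, List.map_cons, List.prod_cons]
    push_cast
    ring

/-! ### Plancherel's inequality and Gaussians -/

/-- The `ℓ²` sum of the blocks: the block space with its Euclidean norm. -/
abbrev EuclSpace (n N : ℕ) : Type := PiLp 2 fun _ : Fin N => EuclideanSpace ℝ (Fin n)

/-- Volumes on the two spaces agree up to a constant; its value is irrelevant here. -/
lemma exists_map_volume_eq (A : EuclSpace n N ≃L[ℝ] Space n N) :
    ∃ c : NNReal, c ≠ 0 ∧ Measure.map A volume = c • (volume : Measure (Space n N)) := by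
  have := A.isAddHaarMeasure_map (volume : Measure (EuclSpace n N))
  exact ⟨_, (Measure.addHaarScalarFactor_pos_of_isAddHaarMeasure _ _).ne',
    Measure.isAddLeftInvariant_eq_smul (Measure.map A volume) volume⟩

/-- The identification of the Euclidean space with the block space, scaled by `a`. -/
noncomputable def scaledEquiv (n N : ℕ) (a : ℝ) (ha : a ≠ 0) : EuclSpace n N ≃L[ℝ] Space n N :=
  (PiLp.continuousLinearEquiv 2 ℝ fun _ : Fin N => EuclideanSpace ℝ (Fin n)).trans
    (LinearEquiv.smulOfNeZero ℝ (Space n N) a ha).toContinuousLinearEquiv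

lemma scaledEquiv_apply (a : ℝ) (ha : a ≠ 0) (v : EuclSpace n N) :
    scaledEquiv n N a ha v = a • v.ofLp := rfl

open FourierTransform in
lemma fourier_comp_scaledEquiv (h : Space n N → ℂ) {c : NNReal}
    (hc : Measure.map (scaledEquiv n N 1 one_ne_zero) volume = c • (volume : Measure (Space n N)))
    (w : EuclSpace n N) :
    𝓕 (h ∘ scaledEquiv n N 1 one_ne_zero) w =
      (c : ℂ) * invFourier h (scaledEquiv n N (-2 * Real.pi) (by simp [Real.pi_ne_zero]) w) := by
  rw [Real.fourier_eq']
  have hmap := integral_map_equiv (μ := (volume : Measure (EuclSpace n N)))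
    (scaledEquiv n N 1 one_ne_zero).toHomeomorph.toMeasurableEquiv
    (fun Ξ : Space n N => h Ξ * Complex.exp (Complex.I *
      (dot (scaledEquiv n N (-2 * Real.pi) (by simp [Real.pi_ne_zero]) w) Ξ : ℂ)))
  change ∫ Ξ, _ ∂(Measure.map (scaledEquiv n N 1 one_ne_zero) volume) = _ at hmap
  rw [hc, integral_smul_nnreal_measure] at hmap
  rw [invFourier]
  refine Eq.trans ?_ (hmap.symm.trans ?_)
  · refine integral_congr_ae (Filter.Eventually.of_forall fun v => ?_)
    change _ = h (scaledEquiv n N 1 one_ne_zero v) * Complex.exp (Complex.I *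
      (dot (scaledEquiv n N (-2 * Real.pi) (by simp [Real.pi_ne_zero]) w)
        (scaledEquiv n N 1 one_ne_zero v) : ℂ))
    have : dot (scaledEquiv n N (-2 * Real.pi) (by simp [Real.pi_ne_zero]) w)
        (scaledEquiv n N 1 one_ne_zero v) = -2 * Real.pi * inner ℝ v w := by
      rw [PiLp.inner_apply, scaledEquiv_apply, scaledEquiv_apply, dot, Finset.mul_sum]
      refine Finset.sum_congr rfl fun j _ => ?_
      rw [Pi.smul_apply, Pi.smul_apply, one_smul, real_inner_smul_left, real_inner_comm]
    simp only [Function.comp_apply, smul_eq_mul, this]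
    rw [mul_comm, mul_comm Complex.I]
  · rw [NNReal.smul_def, Complex.real_smul]

lemma lintegral_scaledEquiv {a : ℝ} {ha : a ≠ 0} {c : NNReal}
    (hc : Measure.map (scaledEquiv n N a ha) volume = c • (volume : Measure (Space n N)))
    (G : Space n N → ℝ≥0∞) : ∫⁻ v, G (scaledEquiv n N a ha v) = c * ∫⁻ Ξ, G Ξ := by
  have := lintegral_map_equiv (μ := (volume : Measure (EuclSpace n N))) G
    (scaledEquiv n N a ha).toHomeomorph.toMeasurableEquiv
  change ∫⁻ Ξ, _ ∂(Measure.map (scaledEquiv n N a ha) volume) = _ at this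
  rw [hc, lintegral_smul_measure] at this
  rw [ENNReal.smul_def, smul_eq_mul] at this
  exact this.symm

lemma lintegral_enorm_sq_schwartz (φ : 𝓢(EuclSpace n N, ℂ)) :
    ∫⁻ v, ‖φ v‖ₑ ^ 2 = ENNReal.ofReal (∫ v, ‖φ v‖ ^ 2) := by
  rw [ofReal_integral_eq_lintegral_ofReal]
  · refine lintegral_congr fun v => ?_
    rw [ENNReal.ofReal_pow (norm_nonneg _), ofReal_norm]
  · exact (φ.memLp 2 volume).integrable_norm_pow (by norm_num)
  · exact Filter.Eventually.of_forall fun v => by positivity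

/-- Plancherel's inequality for test functions. -/
lemma exists_plancherel (n N : ℕ) : ∃ C : ℝ≥0∞, C ≠ ⊤ ∧ ∀ h : Space n N → ℂ, ContDiff ℝ ∞ h →
    HasCompactSupport h → ∫⁻ Z, ‖invFourier h Z‖ₑ ^ 2 ≤ C * ∫⁻ Ξ, ‖h Ξ‖ₑ ^ 2 := by
  obtain ⟨c, hc0, hc⟩ := exists_map_volume_eq (scaledEquiv n N 1 one_ne_zero)
  obtain ⟨d, hd0, hd⟩ := exists_map_volume_eq
    (scaledEquiv n N (-2 * Real.pi) (by simp [Real.pi_ne_zero]))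
  have hc0' : (c : ℝ≥0∞) ≠ 0 := by exact_mod_cast hc0
  have hd0' : (d : ℝ≥0∞) ≠ 0 := by exact_mod_cast hd0
  refine ⟨(d : ℝ≥0∞)⁻¹ * ((c : ℝ≥0∞)⁻¹ ^ 2 * c), ?_, fun h hh hcs => ?_⟩
  · have h1 : (c : ℝ≥0∞)⁻¹ ≠ ⊤ := ENNReal.inv_ne_top.2 hc0'
    have h2 : (d : ℝ≥0∞)⁻¹ ≠ ⊤ := ENNReal.inv_ne_top.2 hd0'
    exact ENNReal.mul_ne_top h2 (ENNReal.mul_ne_top (ENNReal.pow_ne_top h1) ENNReal.coe_ne_top)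
  · have hs : ContDiff ℝ ∞ (h ∘ scaledEquiv n N 1 one_ne_zero) :=
      hh.comp (scaledEquiv n N 1 one_ne_zero).contDiff
    have hcs' : HasCompactSupport (h ∘ scaledEquiv n N 1 one_ne_zero) :=
      hcs.comp_homeomorph (scaledEquiv n N 1 one_ne_zero).toHomeomorph
    set φ : 𝓢(EuclSpace n N, ℂ) := hcs'.toSchwartzMap hs with hφ
    have hφv : ∀ v, φ v = h (scaledEquiv n N 1 one_ne_zero v) := fun v => rfl
    have hpl := congrArg ENNReal.ofReal (SchwartzMap.integral_norm_sq_fourier φ)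
    rw [← lintegral_enorm_sq_schwartz, ← lintegral_enorm_sq_schwartz] at hpl
    simp only [hφv, SchwartzMap.fourier_coe] at hpl
    have hφ' : (φ : EuclSpace n N → ℂ) = h ∘ scaledEquiv n N 1 one_ne_zero := rfl
    rw [hφ', lintegral_scaledEquiv hc (fun Ξ => ‖h Ξ‖ₑ ^ 2)] at hpl
    simp only [fourier_comp_scaledEquiv h hc, enorm_mul, mul_pow] at hpl
    rw [lintegral_scaledEquiv hd
      (fun Z => ‖(c : ℂ)‖ₑ ^ 2 * ‖invFourier h Z‖ₑ ^ 2)] at hpl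
    have hcn : ‖(c : ℂ)‖ₑ = (c : ℝ≥0∞) := by
      rw [← ofReal_norm]; simp
    rw [lintegral_const_mul' _ _ (by rw [hcn]; exact ENNReal.pow_ne_top ENNReal.coe_ne_top),
      hcn] at hpl
    refine le_of_eq ?_
    rw [mul_assoc, mul_assoc, ← hpl]
    set J := ∫⁻ Z, ‖invFourier h Z‖ₑ ^ 2
    calc J = ((d : ℝ≥0∞)⁻¹ * d) * ((c : ℝ≥0∞)⁻¹ * c) ^ 2 * J := by
          rw [ENNReal.inv_mul_cancel hd0' ENNReal.coe_ne_top,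
            ENNReal.inv_mul_cancel hc0' ENNReal.coe_ne_top]
          simp
      _ = _ := by ring

lemma fourier_eq_invFourier (u : Space n N → ℂ) (Ξ : Space n N) : fourier u Ξ = invFourier u (-Ξ) := by
  refine integral_congr_ae (Filter.Eventually.of_forall fun Y => ?_)
  simp only [dot_neg_left, dot_comm Ξ Y]
  push_cast
  ring_nf

open FourierTransform in
/-- The Fourier transform of a Schwartz function is integrable. -/
lemma integrable_fourier (u : 𝓢(Space n N, ℂ)) : Integrable (fourier u) := by
  obtain ⟨c, hc0, hc⟩ := exists_map_volume_eq (scaledEquiv n N 1 one_ne_zero)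
  obtain ⟨d, hd0, hd⟩ := exists_map_volume_eq
    (scaledEquiv n N (-2 * Real.pi) (by simp [Real.pi_ne_zero]))
  set φ : 𝓢(EuclSpace n N, ℂ) :=
    SchwartzMap.compCLMOfContinuousLinearEquiv ℂ (scaledEquiv n N 1 one_ne_zero) u
  have hφ : (φ : EuclSpace n N → ℂ) = u ∘ scaledEquiv n N 1 one_ne_zero := rfl
  have h1 : Integrable (𝓕 (φ : EuclSpace n N → ℂ)) := by
    rw [← SchwartzMap.fourier_coe]
    exact (𝓕 φ : 𝓢(EuclSpace n N, ℂ)).integrable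
  rw [hφ] at h1
  have h2 : Integrable (fun w => (c : ℂ) * invFourier u
      (scaledEquiv n N (-2 * Real.pi) (by simp [Real.pi_ne_zero]) w)) :=
    h1.congr (Filter.Eventually.of_forall fun w => fourier_comp_scaledEquiv u hc w)
  have h3 : Integrable (fun w => invFourier u
      (scaledEquiv n N (-2 * Real.pi) (by simp [Real.pi_ne_zero]) w)) := by
    refine (h2.const_mul (c : ℂ)⁻¹).congr (Filter.Eventually.of_forall fun w => ?_)
    simp only [← mul_assoc]
    rw [inv_mul_cancel₀ (by exact_mod_cast hc0), one_mul]
  have h4 : Integrable (invFourier u) (Measure.map (scaledEquiv n N (-2 * Real.pi)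
      (by simp [Real.pi_ne_zero])) volume) :=
    (integrable_map_equiv (scaledEquiv n N (-2 * Real.pi)
      (by simp [Real.pi_ne_zero])).toHomeomorph.toMeasurableEquiv _).2 h3
  rw [hd] at h4
  have h5 : Integrable (invFourier u) :=
    (integrable_smul_measure (c := (d : ℝ≥0∞)) (by exact_mod_cast hd0) ENNReal.coe_ne_top).1 h4
  exact h5.comp_neg.congr (Filter.Eventually.of_forall fun Ξ => (fourier_eq_invFourier u Ξ).symm)

end Fourier

section Gauss

variable {n N : ℕ}

/-- The Gaussian on one block whose Fourier transform is `e^{-|ξ|²/R²}`. -/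
noncomputable def gauss (R : ℝ) (v : EuclideanSpace ℝ (Fin n)) : ℝ :=
  (R ^ 2 / (4 * Real.pi)) ^ ((n : ℝ) / 2) * Real.exp (-(R ^ 2 / 4) * ‖v‖ ^ 2)

lemma gauss_nonneg (R : ℝ) (v : EuclideanSpace ℝ (Fin n)) : 0 ≤ gauss R v := by
  unfold gauss; positivity

lemma continuous_gauss (R : ℝ) : Continuous (gauss R : EuclideanSpace ℝ (Fin n) → ℝ) := by
  unfold gauss; fun_prop

lemma gauss_mul_phase {R : ℝ} (v ξ : EuclideanSpace ℝ (Fin n)) :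
    (gauss R v : ℂ) * Complex.exp (-(Complex.I * (inner ℝ v ξ : ℂ))) =
      ((R ^ 2 / (4 * Real.pi)) ^ ((n : ℝ) / 2) : ℝ) *
        Complex.exp (-((R ^ 2 / 4 : ℝ) : ℂ) * ‖v‖ ^ 2 + -Complex.I * (inner ℝ ξ v : ℂ)) := by
  rw [gauss, Complex.exp_add, real_inner_comm]
  push_cast
  rw [neg_mul Complex.I, mul_assoc]

lemma integrable_gauss {R : ℝ} (hR : 0 < R) :
    Integrable (gauss R : EuclideanSpace ℝ (Fin n) → ℝ) := by
  have h := GaussianFourier.integrable_cexp_neg_mul_sq_norm_add (V := EuclideanSpace ℝ (Fin n))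
    (b := ((R ^ 2 / 4 : ℝ) : ℂ)) (by rw [Complex.ofReal_re]; positivity) 0 0
  refine (h.norm.const_mul ((R ^ 2 / (4 * Real.pi)) ^ ((n : ℝ) / 2))).congr
    (Filter.Eventually.of_forall fun v => ?_)
  have e : -((R ^ 2 / 4 : ℝ) : ℂ) * ‖v‖ ^ 2 + 0 * (inner ℝ (0 : EuclideanSpace ℝ (Fin n)) v : ℂ) =
      ((-(R ^ 2 / 4) * ‖v‖ ^ 2 : ℝ) : ℂ) := by push_cast; ring
  simp only [e, Complex.norm_exp_ofReal, gauss]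

lemma integral_gauss_mul_phase {R : ℝ} (hR : 0 < R) (ξ : EuclideanSpace ℝ (Fin n)) :
    ∫ v, (gauss R v : ℂ) * Complex.exp (-(Complex.I * (inner ℝ v ξ : ℂ))) =
      (Real.exp (-(‖ξ‖ ^ 2 / R ^ 2)) : ℂ) := by
  have h := GaussianFourier.integral_cexp_neg_mul_sq_norm_add (V := EuclideanSpace ℝ (Fin n))
    (b := ((R ^ 2 / 4 : ℝ) : ℂ)) (by rw [Complex.ofReal_re]; positivity) (-Complex.I) ξ
  simp_rw [gauss_mul_phase]
  rw [integral_const_mul, h, finrank_euclideanSpace_fin, ← mul_assoc]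
  have h1 : (Real.pi / ((R ^ 2 / 4 : ℝ) : ℂ)) ^ ((n : ℂ) / 2) =
      ((Real.pi / (R ^ 2 / 4)) ^ ((n : ℝ) / 2) : ℝ) := by
    rw [Complex.ofReal_cpow (by positivity)]
    push_cast
    rfl
  rw [h1, ← Complex.ofReal_mul, ← Real.mul_rpow (by positivity) (by positivity),
    show R ^ 2 / (4 * Real.pi) * (Real.pi / (R ^ 2 / 4)) = 1 by
      field_simp [Real.pi_ne_zero], Real.one_rpow]
  push_cast
  rw [one_mul, neg_sq, Complex.I_sq]
  congr 1
  have : (R : ℂ) ≠ 0 := by exact_mod_cast hR.ne'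
  field_simp

lemma gauss_eq_smul {R : ℝ} (hR : 0 < R) (v : EuclideanSpace ℝ (Fin n)) :
    gauss R v = R ^ n * gauss 1 (R • v) := by
  have h : (R ^ 2 / (4 * Real.pi)) ^ ((n : ℝ) / 2) =
      R ^ n * (1 ^ 2 / (4 * Real.pi)) ^ ((n : ℝ) / 2) := by
    rw [div_eq_mul_one_div, Real.mul_rpow (by positivity) (by positivity), ← Real.rpow_natCast R 2,
      ← Real.rpow_mul hR.le, one_pow]
    congr 1
    rw [← Real.rpow_natCast R n]
    congr 1
    push_cast; ring
  rw [gauss, gauss, h, norm_smul, Real.norm_of_nonneg hR.le, mul_assoc]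
  congr 3
  ring

lemma gauss_one_le_one (v : EuclideanSpace ℝ (Fin n)) : gauss 1 v ≤ 1 := by
  rw [gauss]
  refine mul_le_one₀ (Real.rpow_le_one (by positivity) ?_ (by positivity)) (by positivity) ?_
  · rw [div_le_one (by positivity)]; nlinarith [Real.pi_gt_three]
  · refine Real.exp_le_one_iff.2 ?_
    nlinarith [sq_nonneg ‖v‖]

/-- The constants of `young_two_le` for the Gaussian at frequency `R`. -/
lemma gauss_young_const {p : ℝ} (hp : 1 ≤ p) (hp2 : p ≤ 2) {R : ℝ} (hR : 0 < R) :
    (∫⁻ v : EuclideanSpace ℝ (Fin n), ENNReal.ofReal (gauss R v)) ^ (1 - 1 / p) *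
      (∫⁻ v : EuclideanSpace ℝ (Fin n), ENNReal.ofReal (gauss R v) ^ (2 / p)) ^ (1 / (2 : ℝ)) ≤
    ENNReal.ofReal (R ^ (n / p - n / 2)) *
      ((∫⁻ v : EuclideanSpace ℝ (Fin n), ENNReal.ofReal (gauss 1 v)) ^ (1 - 1 / p) *
      (∫⁻ v : EuclideanSpace ℝ (Fin n), ENNReal.ofReal (gauss 1 v)) ^ (1 / (2 : ℝ))) := by
  have hp0 : 0 < p := by linarith
  have hm : Measurable fun v : EuclideanSpace ℝ (Fin n) => ENNReal.ofReal (gauss 1 v) :=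
    (continuous_gauss 1).measurable.ennreal_ofReal
  have hscale : ∀ v : EuclideanSpace ℝ (Fin n), ENNReal.ofReal (gauss R v) =
      ENNReal.ofReal (R ^ n) * ENNReal.ofReal (gauss 1 (R • v)) := by
    intro v
    rw [gauss_eq_smul hR, ENNReal.ofReal_mul (by positivity)]
  have h1 : ∫⁻ v : EuclideanSpace ℝ (Fin n), ENNReal.ofReal (gauss R v) =
      ∫⁻ v : EuclideanSpace ℝ (Fin n), ENNReal.ofReal (gauss 1 v) := by
    simp_rw [hscale]
    rw [lintegral_const_mul' _ _ ENNReal.ofReal_ne_top, lintegral_comp_smul_eq hR hm, ← mul_assoc,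
      ← ENNReal.ofReal_mul (by positivity), mul_inv_cancel₀ (by positivity), ENNReal.ofReal_one,
      one_mul]
  have h2 : ∫⁻ v : EuclideanSpace ℝ (Fin n), ENNReal.ofReal (gauss R v) ^ (2 / p) ≤
      ENNReal.ofReal (R ^ (2 * n / p - n)) *
        ∫⁻ v : EuclideanSpace ℝ (Fin n), ENNReal.ofReal (gauss 1 v) := by
    have : ∀ v : EuclideanSpace ℝ (Fin n), ENNReal.ofReal (gauss R v) ^ (2 / p) ≤
        ENNReal.ofReal ((R ^ n) ^ (2 / p)) * ENNReal.ofReal (gauss 1 (R • v)) := by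
      intro v
      rw [hscale, ENNReal.mul_rpow_of_nonneg _ _ (by positivity),
        ENNReal.ofReal_rpow_of_pos (by positivity)]
      gcongr
      refine (ENNReal.rpow_le_rpow_of_exponent_ge
        (ENNReal.ofReal_le_one.2 (gauss_one_le_one _)) ((one_le_div hp0).2 hp2)).trans_eq ?_
      rw [ENNReal.rpow_one]
    refine (lintegral_mono this).trans (le_of_eq ?_)
    rw [lintegral_const_mul' _ _ ENNReal.ofReal_ne_top, lintegral_comp_smul_eq hR hm, ← mul_assoc,
      ← ENNReal.ofReal_mul (by positivity)]
    congr 2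
    rw [← Real.rpow_natCast, ← Real.rpow_mul hR.le, ← Real.rpow_neg hR.le, ← Real.rpow_add hR]
    congr 1
    ring
  rw [h1]
  refine (mul_le_mul_right (ENNReal.rpow_le_rpow h2 (by norm_num)) _).trans (le_of_eq ?_)
  rw [ENNReal.mul_rpow_of_nonneg _ _ (by norm_num), ENNReal.ofReal_rpow_of_pos (by positivity),
    ← Real.rpow_mul hR.le, show (2 * n / p - n) * (1 / 2) = n / p - n / 2 by ring]
  ring

/-- The product Gaussian. -/
noncomputable def gaussProd (R : ℝ) (V : Space n N) : ℝ := ∏ j, gauss R (V j)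

lemma gaussProd_nonneg (R : ℝ) (V : Space n N) : 0 ≤ gaussProd R V :=
  Finset.prod_nonneg fun _ _ => gauss_nonneg R _

lemma continuous_gaussProd (R : ℝ) : Continuous (gaussProd R : Space n N → ℝ) := by
  unfold gaussProd
  exact continuous_finsetProd _ fun j _ => (continuous_gauss R).comp (continuous_apply j)

lemma integrable_gaussProd {R : ℝ} (hR : 0 < R) :
    Integrable (gaussProd R : Space n N → ℝ) :=
  Integrable.fintype_prod (μ := fun _ => volume) fun _ => integrable_gauss hR

lemma integral_gaussProd_mul_phase {R : ℝ} (hR : 0 < R) (Ξ : Space n N) :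
    ∫ V, (gaussProd R V : ℂ) * Complex.exp (-(Complex.I * (dot V Ξ : ℂ))) =
      (Real.exp (-((∑ j, ‖Ξ j‖ ^ 2) / R ^ 2)) : ℂ) := by
  have h : ∀ V : Space n N, (gaussProd R V : ℂ) * Complex.exp (-(Complex.I * (dot V Ξ : ℂ))) =
      ∏ j, (gauss R (V j) : ℂ) * Complex.exp (-(Complex.I * (inner ℝ (V j) (Ξ j) : ℂ))) := by
    intro V
    rw [Finset.prod_mul_distrib, ← Complex.exp_sum, gaussProd, dot]
    push_cast
    rw [Finset.mul_sum, Finset.sum_neg_distrib]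
  simp_rw [h]
  rw [integral_fintype_prod_volume_eq_prod (fun j v => (gauss R v : ℂ) *
    Complex.exp (-(Complex.I * (inner ℝ v (Ξ j) : ℂ))))]
  simp_rw [integral_gauss_mul_phase hR]
  rw [← Complex.ofReal_prod, ← Real.exp_sum, Finset.sum_neg_distrib, Finset.sum_div]

/-- Multiplication by a Gaussian on the frequency side is convolution with a Gaussian. -/
lemma invFourier_mul_gauss {R : ℝ} (hR : 0 < R) {h : Space n N → ℂ} (hh : Integrable h)
    (Z : Space n N) :
    invFourier (fun Ξ => h Ξ * (Real.exp (-((∑ j, ‖Ξ j‖ ^ 2) / R ^ 2)) : ℂ)) Z =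
      ∫ V, (gaussProd R V : ℂ) * invFourier h (Z - V) := by
  have hint : Integrable (Function.uncurry fun (Ξ V : Space n N) => h Ξ * (gaussProd R V : ℂ) *
      Complex.exp (Complex.I * (dot (Z - V) Ξ : ℂ))) := by
    refine (hh.mul_prod (integrable_gaussProd (n := n) (N := N) hR).ofReal).mul_bdd (c := 1) ?_ ?_
    · have hc : Continuous fun z : Space n N × Space n N =>
          Complex.exp (Complex.I * (dot (Z - z.2) z.1 : ℂ)) := by
        unfold dot; fun_prop
      exact hc.aestronglyMeasurable
    · exact Filter.Eventually.of_forall fun z => by simp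
  calc _ = ∫ Ξ, ∫ V, h Ξ * (gaussProd R V : ℂ) *
        Complex.exp (Complex.I * (dot (Z - V) Ξ : ℂ)) := by
        refine integral_congr_ae (Filter.Eventually.of_forall fun Ξ => ?_)
        simp only
        rw [← integral_gaussProd_mul_phase hR, mul_right_comm, ← integral_const_mul]
        refine integral_congr_ae (Filter.Eventually.of_forall fun V => ?_)
        simp only [dot_sub_left]
        push_cast
        rw [mul_sub, sub_eq_add_neg, Complex.exp_add]
        ring
    _ = ∫ V, ∫ Ξ, h Ξ * (gaussProd R V : ℂ) *
        Complex.exp (Complex.I * (dot (Z - V) Ξ : ℂ)) := integral_integral_swap hint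
    _ = _ := by
        refine integral_congr_ae (Filter.Eventually.of_forall fun V => ?_)
        simp only [invFourier]
        rw [← integral_const_mul]
        exact integral_congr_ae (Filter.Eventually.of_forall fun Ξ => by ring)

end Gauss

/-! ### The kernel estimate at a single frequency scale -/

section Kernel

variable {n N : ℕ}

lemma partialDeriv_eventuallyEq_zero {g : Space n N → ℂ} {Ξ : Space n N} (h : g =ᶠ[nhds Ξ] 0)
    (i : Fin N × Fin n) : partialDeriv i g =ᶠ[nhds Ξ] 0 := by
  filter_upwards [eventually_eventually_nhds.2 h] with Y hY
  have : g =ᶠ[nhds Y] fun _ => 0 := hY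
  simp [partialDeriv, this.fderiv_eq]

lemma diffOps_eventuallyEq_zero {g : Space n N → ℂ} {Ξ : Space n N} (h : g =ᶠ[nhds Ξ] 0) (τ : ℝ)
    (l : List (Fin N × Fin n)) : diffOps τ l g =ᶠ[nhds Ξ] 0 := by
  induction l with
  | nil => exact h
  | cons i l ih =>
    change diffOp τ i (diffOps τ l g) =ᶠ[nhds Ξ] 0
    filter_upwards [ih, partialDeriv_eventuallyEq_zero (partialDeriv_eventuallyEq_zero ih i) i]
      with Y h1 h2
    simp [diffOp, h1, h2]

/-- Every coordinate of the block space, repeated `n` times. -/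
def coordList (n N : ℕ) : List (Fin N × Fin n) :=
  (List.replicate n (List.finRange N ×ˢ List.finRange n)).flatten

lemma prod_map_coordList (f : Fin N × Fin n → ℝ) :
    ((coordList n N).map f).prod = (∏ j, ∏ l, f (j, l)) ^ n := by
  have h : ((List.finRange N ×ˢ List.finRange n).map f).prod = ∏ j, ∏ l, f (j, l) := by
    have hnd : (List.finRange N ×ˢ List.finRange n).Nodup :=
      (List.nodup_finRange N).product (List.nodup_finRange n)
    rw [← List.prod_toFinset f hnd, ← Fintype.prod_prod_type]
    congr 1
    ext ⟨a, b⟩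
    simp
  rw [coordList, List.map_flatten, List.prod_flatten, List.map_replicate, List.map_replicate,
    List.prod_replicate, h]

lemma one_add_sum_le_prod {ι : Type*} (s : Finset ι) {x : ι → ℝ} (hx : ∀ i, 0 ≤ x i) :
    1 + ∑ i ∈ s, x i ≤ ∏ i ∈ s, (1 + x i) := by
  classical
  induction s using Finset.induction_on with
  | empty => simp
  | insert a s ha ih =>
    rw [Finset.sum_insert ha, Finset.prod_insert ha]
    have := Finset.sum_nonneg fun i (_ : i ∈ s) => hx i
    nlinarith [hx a, mul_nonneg (hx a) this, mul_le_mul_of_nonneg_left ih (hx a)]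

lemma decay_le_one (τ : ℝ) (z : EuclideanSpace ℝ (Fin n)) : decay n τ z ≤ 1 := by
  rw [decay, ENNReal.ofReal_le_one]
  refine inv_le_one_of_one_le₀ (one_le_pow₀ ?_)
  nlinarith [sq_nonneg ‖τ • z‖]

/-- The polynomial weight produced by `diffOps` dominates the inverse of the product of the weights
`decay^{1/p_j}`. -/
lemma one_le_weight_mul {p : Fin N → ℝ} (hp : ∀ j, 1 ≤ p j) (τ : ℝ) (Z : Space n N) :
    1 ≤ (∏ j, decay n τ (Z j) ^ (1 / p j)) *
      ENNReal.ofReal ((coordList n N).map fun i => 1 + τ ^ 2 * Z i.1 i.2 ^ 2).prod := by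
  have h1 : ∏ j, decay n τ (Z j) ≤ ∏ j, decay n τ (Z j) ^ (1 / p j) := by
    refine Finset.prod_le_prod' fun j _ => ?_
    have hpj : 1 / p j ≤ 1 := by
      rw [div_le_one (by linarith [hp j])]; exact hp j
    calc decay n τ (Z j) = decay n τ (Z j) ^ (1 : ℝ) := (ENNReal.rpow_one _).symm
      _ ≤ _ := ENNReal.rpow_le_rpow_of_exponent_ge (decay_le_one _ _) hpj
  refine le_trans ?_ (mul_le_mul_left h1 _)
  have hpos : ∀ j, 0 < (1 + ‖τ • Z j‖ ^ 2) ^ n := fun j => by positivity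
  rw [prod_map_coordList, ← Finset.prod_pow]
  have h2 : ENNReal.ofReal (∏ j, (1 + ‖τ • Z j‖ ^ 2) ^ n) ≤
      ENNReal.ofReal (∏ j, (∏ l, (1 + τ ^ 2 * Z j l ^ 2)) ^ n) := by
    refine ENNReal.ofReal_le_ofReal (Finset.prod_le_prod (fun j _ => (hpos j).le) fun j _ => ?_)
    refine pow_le_pow_left₀ (by positivity) ?_ n
    refine le_trans (le_of_eq ?_)
      (one_add_sum_le_prod Finset.univ fun l => mul_nonneg (sq_nonneg τ) (sq_nonneg (Z j l)))
    rw [norm_smul, mul_pow, EuclideanSpace.norm_sq_eq, Real.norm_eq_abs, sq_abs, Finset.mul_sum]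
    simp
  refine le_trans (le_of_eq ?_) (mul_le_mul_right h2 _)
  rw [ENNReal.ofReal_prod_of_nonneg fun j _ => (hpos j).le, ← Finset.prod_mul_distrib]
  refine (Finset.prod_eq_one fun j _ => ?_).symm
  rw [decay, ← ENNReal.ofReal_mul (by have := hpos j; positivity), inv_mul_cancel₀ (hpos j).ne',
    ENNReal.ofReal_one]

lemma enorm_ofReal_of_nonneg {t : ℝ} (ht : 0 ≤ t) : ‖(t : ℂ)‖ₑ = ENNReal.ofReal t := by
  rw [← ofReal_norm, Complex.norm_real, Real.norm_of_nonneg ht]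

/-- Up to the weight, the kernel of a symbol supported in `‖Ξ‖ ≤ 2R` is a Gaussian average of the
inverse Fourier transform of a function `h` of comparable size. -/
lemma enorm_invFourier_le {p : Fin N → ℝ} (hp : ∀ j, 1 ≤ p j) {R : ℝ} (hR : 0 < R) (τ : ℝ)
    {g h : Space n N → ℂ} (hg : ContDiff ℝ ∞ g) (hc : HasCompactSupport g)
    (hh : Integrable h)
    (hgh : ∀ Ξ, diffOps τ (coordList n N) g Ξ =
      h Ξ * (Real.exp (-((∑ j, ‖Ξ j‖ ^ 2) / R ^ 2)) : ℂ)) (Z : Space n N) :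
    ‖invFourier g Z‖ₑ ≤ (∏ j, decay n τ (Z j) ^ (1 / p j)) *
      ∫⁻ V, ENNReal.ofReal (gaussProd R V) * ‖invFourier h (Z - V)‖ₑ := by
  obtain ⟨-, -, h3⟩ := diffOps_spec hg hc τ (coordList n N)
  have hW : (0 : ℝ) ≤ ((coordList n N).map fun i => 1 + τ ^ 2 * Z i.1 i.2 ^ 2).prod := by
    rw [prod_map_coordList]; positivity
  have h4 : ENNReal.ofReal ((coordList n N).map fun i => 1 + τ ^ 2 * Z i.1 i.2 ^ 2).prod *
      ‖invFourier g Z‖ₑ = ‖invFourier (diffOps τ (coordList n N) g) Z‖ₑ := by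
    rw [h3, enorm_mul, enorm_ofReal_of_nonneg hW]
  have h5 : ‖invFourier (diffOps τ (coordList n N) g) Z‖ₑ ≤
      ∫⁻ V, ENNReal.ofReal (gaussProd R V) * ‖invFourier h (Z - V)‖ₑ := by
    rw [funext hgh, invFourier_mul_gauss hR hh]
    refine (enorm_integral_le_lintegral_enorm _).trans (le_of_eq (lintegral_congr fun V => ?_))
    rw [enorm_mul, enorm_ofReal_of_nonneg (gaussProd_nonneg R V)]
  calc ‖invFourier g Z‖ₑ = 1 * ‖invFourier g Z‖ₑ := (one_mul _).symm
    _ ≤ _ := mul_le_mul_left (one_le_weight_mul hp τ Z) _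
    _ = _ := by rw [mul_assoc, h4]
    _ ≤ _ := mul_le_mul_right h5 _

/-- The convolution with the product Gaussian is an iterated block convolution. -/
lemma lintegral_gaussProd_mul (R : ℝ) {H : Space n N → ℝ≥0∞} (hH : Measurable H) (X : Space n N) :
    ∫⁻ Y, ENNReal.ofReal (gaussProd R (X - Y)) * H Y =
      iterNorm (List.finRange N) (fun _ => 1)
        (fun _ x y => ENNReal.ofReal (gauss R (x - y))) H X := by
  have hm : Measurable fun Y => ENNReal.ofReal (gaussProd R (X - Y)) * H Y :=
    ((continuous_gaussProd R).measurable.comp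
      (measurable_const.sub measurable_id)).ennreal_ofReal.mul hH
  have h1 := iterNorm_finRange_const (s := 1) one_pos hm X
  simp only [ENNReal.rpow_one, div_one] at h1
  rw [← h1]
  refine iterNorm_one_mul_eq (List.nodup_finRange N) (fun _ => one_pos)
    (fun _ x y => ENNReal.ofReal (gauss R (x - y))) (fun _ _ _ => ENNReal.ofReal_ne_top)
    (fun _ _ _ => ENNReal.rpow_one _) fun Y _ => ?_
  rw [← Fin.prod_univ_def, gaussProd, ENNReal.ofReal_prod_of_nonneg fun _ _ => gauss_nonneg R _]
  rfl

/-- Tonelli's theorem and the Cauchy-Schwarz inequality for a kernel of the form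
`w(X - Y) (G * k)(X - Y)`. -/
lemma lintegral_kernel_mul_le {G k : Space n N → ℝ≥0∞} (hG : Measurable G) (hk : Measurable k)
    {f w : Space n N → ℝ≥0∞} (hf : Measurable f) (hw : Measurable w) (X : Space n N) :
    ∫⁻ Y, (w (X - Y) * ∫⁻ V, G V * k (X - Y - V)) * f Y ≤
      (∫⁻ Z, k Z ^ (2 : ℝ)) ^ (1 / (2 : ℝ)) *
        (∫⁻ Y', (∫⁻ Y, G (Y' - Y) * (w (X - Y) * f Y)) ^ (2 : ℝ)) ^ (1 / (2 : ℝ)) := by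
  have hH : Measurable fun Y => w (X - Y) * f Y := (hw.comp (measurable_const.sub measurable_id)).mul hf
  have hmeas : Measurable (Function.uncurry fun Y Y' : Space n N =>
      k (X - Y') * (G (Y' - Y) * (w (X - Y) * f Y))) :=
    (hk.comp (measurable_const.sub measurable_snd)).mul
      ((hG.comp (measurable_snd.sub measurable_fst)).mul (hH.comp measurable_fst))
  have hGH : Measurable fun Y' => ∫⁻ Y, G (Y' - Y) * (w (X - Y) * f Y) :=
    Measurable.lintegral_prod_right' (f := fun z : Space n N × Space n N =>
      G (z.1 - z.2) * (w (X - z.2) * f z.2))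
      ((hG.comp (measurable_fst.sub measurable_snd)).mul (hH.comp measurable_snd))
  calc _ = ∫⁻ Y, ∫⁻ Y', k (X - Y') * (G (Y' - Y) * (w (X - Y) * f Y)) := by
        refine lintegral_congr fun Y => ?_
        rw [← lintegral_sub_right_eq_self (fun V => G V * k (X - Y - V)) Y, mul_right_comm,
          ← lintegral_const_mul]
        · refine lintegral_congr fun Y' => ?_
          rw [show X - Y - (Y' - Y) = X - Y' by abel]
          ring
        · exact (hG.comp (measurable_id.sub_const Y)).mul
            (hk.comp (measurable_const.sub (measurable_id.sub_const Y)))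
    _ = ∫⁻ Y', ∫⁻ Y, k (X - Y') * (G (Y' - Y) * (w (X - Y) * f Y)) :=
        lintegral_lintegral_swap hmeas.aemeasurable
    _ = ∫⁻ Y', k (X - Y') * ∫⁻ Y, G (Y' - Y) * (w (X - Y) * f Y) := by
        refine lintegral_congr fun Y' => lintegral_const_mul _ ?_
        exact (hG.comp (measurable_const.sub measurable_id)).mul hH
    _ ≤ (∫⁻ Y', k (X - Y') ^ (2 : ℝ)) ^ (1 / (2 : ℝ)) *
        (∫⁻ Y', (∫⁻ Y, G (Y' - Y) * (w (X - Y) * f Y)) ^ (2 : ℝ)) ^ (1 / (2 : ℝ)) :=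
        ENNReal.lintegral_mul_le_Lp_mul_Lq volume Real.HolderConjugate.two_two
          (hk.comp (measurable_const.sub measurable_id)).aemeasurable hGH.aemeasurable
    _ = _ := by rw [lintegral_sub_left_eq_self (fun Z => k Z ^ (2 : ℝ)) X]

lemma finrank_space : Module.finrank ℝ (Space n N) = N * n := by
  rw [Module.finrank_pi_fintype]
  simp

/-- The `L²` norm of a function of size at most `A` supported in `‖Ξ‖ ≤ 2R`. -/
lemma lintegral_sq_le_of_support {R A : ℝ} (hR : 0 < R) (hA : 0 ≤ A) {h : Space n N → ℂ}
    (hsupp : ∀ Ξ, 2 * R < ‖Ξ‖ → h Ξ = 0) (hbound : ∀ Ξ, ‖h Ξ‖ ≤ A) :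
    (∫⁻ Ξ, ‖h Ξ‖ₑ ^ 2) ^ (1 / (2 : ℝ)) ≤ ENNReal.ofReal (A * R ^ ((N * n : ℕ) / 2 : ℝ)) *
      (ENNReal.ofReal (2 ^ (N * n)) * volume (Metric.closedBall (0 : Space n N) 1)) ^
        (1 / (2 : ℝ)) := by
  have h1 : ∫⁻ Ξ, ‖h Ξ‖ₑ ^ 2 ≤ ENNReal.ofReal (A ^ 2 * R ^ (N * n)) *
      (ENNReal.ofReal (2 ^ (N * n)) * volume (Metric.closedBall (0 : Space n N) 1)) := by
    calc ∫⁻ Ξ, ‖h Ξ‖ₑ ^ 2 ≤ ∫⁻ Ξ, (Metric.closedBall (0 : Space n N) (2 * R)).indicator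
          (fun _ => ENNReal.ofReal (A ^ 2)) Ξ := by
          refine lintegral_mono fun Ξ => ?_
          by_cases hΞ : Ξ ∈ Metric.closedBall (0 : Space n N) (2 * R)
          · simp only [Set.indicator_of_mem hΞ]
            rw [← ofReal_norm, ← ENNReal.ofReal_pow (norm_nonneg _)]
            exact ENNReal.ofReal_le_ofReal (pow_le_pow_left₀ (norm_nonneg _) (hbound Ξ) 2)
          · rw [mem_closedBall_zero_iff, not_le] at hΞ
            simp [hsupp Ξ hΞ]
      _ = ENNReal.ofReal (A ^ 2) * (ENNReal.ofReal ((2 * R) ^ (N * n)) *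
          volume (Metric.closedBall (0 : Space n N) 1)) := by
          rw [lintegral_indicator_const Metric.isClosed_closedBall.measurableSet,
            Measure.addHaar_closedBall' _ _ (by positivity), finrank_space]
      _ = _ := by
          rw [mul_pow, ENNReal.ofReal_mul (by positivity), ENNReal.ofReal_mul (by positivity)]
          ring
  refine (ENNReal.rpow_le_rpow h1 (by norm_num)).trans (le_of_eq ?_)
  rw [ENNReal.mul_rpow_of_nonneg _ _ (by norm_num), ENNReal.ofReal_rpow_of_nonneg (by positivity)
    (by norm_num), Real.mul_rpow (by positivity) (by positivity), ← Real.sqrt_eq_rpow,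
    Real.sqrt_sq hA, ← Real.rpow_natCast R, ← Real.rpow_mul hR.le]
  congr 4
  ring

/-- The kernel estimate at frequency scale `R` and resolution `1/τ`: if `g` is supported in
`‖Ξ‖ ≤ 2R` and its derivatives are bounded on the scale `τ`, in the sense that `diffOps τ` maps it
to a function bounded by `A`, then integration against the kernel with symbol `g` is controlled by
iterated local averages on the scale `1/τ`. By Plancherel's theorem the weighted kernel is bounded
in `L²`, and the mixed-norm Young inequality for a Gaussian at frequency `R` passes from the exponents
`p_j` to `2`. -/
lemma exists_kernel_bound (n N : ℕ) {p : Fin N → ℝ}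
    (hp : ∀ j, p j ∈ Set.Icc (1 : ℝ) 2) :
    ∃ C : ℝ≥0∞, C ≠ ⊤ ∧ ∀ (R τ A : ℝ), 0 < R → 0 ≤ A → ∀ g : Space n N → ℂ,
      ContDiff ℝ ∞ g → (∀ Ξ, 2 * R < ‖Ξ‖ → g Ξ = 0) →
      (∀ Ξ, ‖diffOps τ (coordList n N) g Ξ‖ ≤ A) →
      ∀ f : Space n N → ℝ≥0∞, Measurable f → ∀ X,
        ∫⁻ Y, ‖invFourier g (X - Y)‖ₑ * f Y ≤
          C * ENNReal.ofReal (A * R ^ (∑ j, (n : ℝ) / p j)) *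
            iterNorm (List.finRange N) p (fun _ x y => decay n τ (x - y)) f X := by
  obtain ⟨C₁, hC₁, hpl⟩ := exists_plancherel n N
  set v := ENNReal.ofReal (2 ^ (N * n)) * volume (Metric.closedBall (0 : Space n N) 1) with hv
  set D : Fin N → ℝ≥0∞ := fun j =>
    ((∫⁻ v : EuclideanSpace ℝ (Fin n), ENNReal.ofReal (gauss 1 v)) ^ (1 - 1 / p j) *
      (∫⁻ v : EuclideanSpace ℝ (Fin n), ENNReal.ofReal (gauss 1 v)) ^ (1 / (2 : ℝ))) with hD
  have hgtop : ∫⁻ v : EuclideanSpace ℝ (Fin n), ENNReal.ofReal (gauss 1 v) ≠ ⊤ :=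
    (integrable_gauss one_pos).lintegral_lt_top.ne
  have hDtop : ∀ j, D j ≠ ⊤ := by
    intro j
    have hp0 : 0 < p j := zero_lt_one.trans_le (hp j).1
    refine ENNReal.mul_ne_top (ENNReal.rpow_ne_top_of_nonneg ?_ hgtop)
      (ENNReal.rpow_ne_top_of_nonneg (by norm_num) hgtop)
    rw [sub_nonneg, div_le_one hp0]; exact (hp j).1
  have hvtop : v ≠ ⊤ := ENNReal.mul_ne_top ENNReal.ofReal_ne_top
    (isCompact_closedBall _ _).measure_lt_top.ne
  refine ⟨C₁ ^ (1 / (2 : ℝ)) * v ^ (1 / (2 : ℝ)) * ENNReal.ofReal (Real.exp (4 * N)) * ∏ j, D j,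
    ?_, ?_⟩
  · refine ENNReal.mul_ne_top (ENNReal.mul_ne_top (ENNReal.mul_ne_top ?_ ?_)
      ENNReal.ofReal_ne_top) (ENNReal.prod_ne_top fun j _ => hDtop j)
    · exact ENNReal.rpow_ne_top_of_nonneg (by norm_num) hC₁
    · exact ENNReal.rpow_ne_top_of_nonneg (by norm_num) hvtop
  intro R τ A hR hA g hg hgs hgb f hf X
  have hc : HasCompactSupport g := by
    refine HasCompactSupport.intro (isCompact_closedBall (0 : Space n N) (2 * R)) fun Ξ hΞ => ?_
    rw [mem_closedBall_zero_iff, not_le] at hΞ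
    exact hgs Ξ hΞ
  obtain ⟨h1, h2, -⟩ := diffOps_spec hg hc τ (coordList n N)
  -- `h` is chosen so that `diffOps τ g` is `h` times a Gaussian; on the support of `g` the factor
  -- `e^{|Ξ|²/R²}` is at most `e^{4N}`.
  set h : Space n N → ℂ := fun Ξ => diffOps τ (coordList n N) g Ξ *
    (Real.exp ((∑ j, ‖Ξ j‖ ^ 2) / R ^ 2) : ℂ) with hh
  have hexp : ContDiff ℝ ∞ fun Ξ : Space n N => (Real.exp ((∑ j, ‖Ξ j‖ ^ 2) / R ^ 2) : ℂ) := by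
    refine Complex.ofRealCLM.contDiff.comp (Real.contDiff_exp.comp (ContDiff.div_const ?_ _))
    exact ContDiff.sum fun j _ => (contDiff_norm_sq ℝ).comp (contDiff_apply ℝ _ j)
  have hhs : ContDiff ℝ ∞ h := h1.mul hexp
  have hhc : HasCompactSupport h := h2.mul_right
  have hhi : Integrable h := hhs.continuous.integrable_of_hasCompactSupport hhc
  have hgh : ∀ Ξ, diffOps τ (coordList n N) g Ξ =
      h Ξ * (Real.exp (-((∑ j, ‖Ξ j‖ ^ 2) / R ^ 2)) : ℂ) := by
    intro Ξ
    simp only [hh]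
    rw [mul_assoc, ← Complex.ofReal_mul, ← Real.exp_add, add_neg_cancel, Real.exp_zero,
      Complex.ofReal_one, mul_one]
  have hzero : ∀ Ξ, 2 * R < ‖Ξ‖ → h Ξ = 0 := by
    intro Ξ hΞ
    have : g =ᶠ[nhds Ξ] 0 := by
      filter_upwards [(isOpen_lt continuous_const continuous_norm).mem_nhds hΞ] with Y hY
      exact hgs Y hY
    simp [hh, (diffOps_eventuallyEq_zero this τ (coordList n N)).eq_of_nhds]
  have hsize : ∀ Ξ, ‖h Ξ‖ ≤ A * Real.exp (4 * N) := by
    intro Ξ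
    rcases lt_or_ge (2 * R) ‖Ξ‖ with hΞ | hΞ
    · rw [hzero Ξ hΞ, norm_zero]; positivity
    · simp only [hh]
      rw [norm_mul, Complex.norm_real, Real.norm_of_nonneg (Real.exp_pos _).le]
      refine mul_le_mul (hgb Ξ) (Real.exp_le_exp.2 ?_) (Real.exp_pos _).le hA
      rw [div_le_iff₀ (by positivity)]
      calc ∑ j, ‖Ξ j‖ ^ 2 ≤ ∑ _j : Fin N, (2 * R) ^ 2 := by
            gcongr with j
            exact (norm_le_pi_norm Ξ j).trans hΞ
        _ = _ := by simp; ring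
  have hK : ∀ Y, ‖invFourier g (X - Y)‖ₑ * f Y ≤ ((∏ j, decay n τ ((X - Y) j) ^ (1 / p j)) *
      ∫⁻ V, ENNReal.ofReal (gaussProd R V) * ‖invFourier h (X - Y - V)‖ₑ) * f Y := fun Y =>
    mul_le_mul_left (enorm_invFourier_le (fun j => (hp j).1) hR τ hg hc hhi hgh (X - Y)) _
  have hwm : Measurable fun Z : Space n N => ∏ j, decay n τ (Z j) ^ (1 / p j) :=
    Finset.measurable_prod _ fun j _ =>
      ((measurable_decay τ).comp (measurable_pi_apply j)).pow_const _
  have hHm : Measurable fun Y => (∏ j, decay n τ ((X - Y) j) ^ (1 / p j)) * f Y :=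
    (hwm.comp (measurable_const.sub measurable_id)).mul hf
  have hφm : Measurable fun v : EuclideanSpace ℝ (Fin n) => ENNReal.ofReal (gauss R v) :=
    (continuous_gauss R).measurable.ennreal_ofReal
  have hcs := lintegral_kernel_mul_le (G := fun V => ENNReal.ofReal (gaussProd R V))
    (k := fun Z => ‖invFourier h Z‖ₑ) (continuous_gaussProd R).measurable.ennreal_ofReal
    (continuous_invFourier hhi).measurable.enorm hf hwm X
  have hL2 : (∫⁻ Z, ‖invFourier h Z‖ₑ ^ (2 : ℝ)) ^ (1 / (2 : ℝ)) ≤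
      C₁ ^ (1 / (2 : ℝ)) * (ENNReal.ofReal (A * Real.exp (4 * N) * R ^ ((N * n : ℕ) / 2 : ℝ)) *
        v ^ (1 / (2 : ℝ))) := by
    have h3 := ENNReal.rpow_le_rpow (hpl h hhs hhc) (show (0 : ℝ) ≤ 1 / 2 by norm_num)
    rw [ENNReal.mul_rpow_of_nonneg _ _ (by norm_num)] at h3
    simp only [ENNReal.rpow_ofNat]
    exact h3.trans (mul_le_mul_right (lintegral_sq_le_of_support hR (by positivity) hzero hsize) _)
  have hY2 : (∫⁻ Y', (∫⁻ Y, ENNReal.ofReal (gaussProd R (Y' - Y)) *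
      ((∏ j, decay n τ ((X - Y) j) ^ (1 / p j)) * f Y)) ^ (2 : ℝ)) ^ (1 / (2 : ℝ)) ≤
      ((List.finRange N).map fun j => ENNReal.ofReal (R ^ (n / p j - n / 2)) * D j).prod *
        iterNorm (List.finRange N) p (fun _ x y => decay n τ (x - y)) f X := by
    simp_rw [lintegral_gaussProd_mul R hHm]
    rw [← iterNorm_finRange_const (by norm_num) (measurable_iterNorm _
      (fun _ => measurable_uncurry_sub hφm) hHm) X]
    refine (iterNorm_two_conv_le (List.nodup_finRange N) hφm hp
      (fun j => ENNReal.mul_ne_top ENNReal.ofReal_ne_top (hDtop j))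
      (fun j => gauss_young_const (hp j).1 (hp j).2 hR) hHm X).trans ?_
    refine mul_le_mul_right (le_of_eq ?_) _
    refine iterNorm_one_mul_eq (List.nodup_finRange N) (fun j => zero_lt_one.trans_le (hp j).1)
      (fun j x y => decay n τ (x - y) ^ (1 / p j)) (fun j x y => ?_) (fun j x y => ?_)
      fun Y _ => ?_
    · have := zero_lt_one.trans_le (hp j).1
      exact ENNReal.rpow_ne_top_of_nonneg (by positivity) (decay_ne_top τ _)
    · have := zero_lt_one.trans_le (hp j).1
      rw [← ENNReal.rpow_mul, one_div_mul_cancel this.ne', ENNReal.rpow_one]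
    · rw [← Fin.prod_univ_def]
      rfl
  refine (lintegral_mono hK).trans (hcs.trans ((mul_le_mul' hL2 hY2).trans (le_of_eq ?_)))
  rw [← Fin.prod_univ_def, Finset.prod_mul_distrib, ← ENNReal.ofReal_prod_of_nonneg
    fun j _ => by positivity, ← Real.rpow_sum_of_pos hR]
  have hpow : A * R ^ (∑ j, (n : ℝ) / p j) * Real.exp (4 * N) =
      A * Real.exp (4 * N) * R ^ ((N * n : ℕ) / 2 : ℝ) * R ^ (∑ j, ((n : ℝ) / p j - n / 2)) := by
    rw [mul_assoc (A * _), ← Real.rpow_add hR]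
    have : ((N * n : ℕ) : ℝ) / 2 + ∑ j, ((n : ℝ) / p j - n / 2) = ∑ j, (n : ℝ) / p j := by
      rw [Finset.sum_sub_distrib]; simp; ring
    rw [this]; ring
  have hpow' : ENNReal.ofReal (A * R ^ (∑ j, (n : ℝ) / p j)) * ENNReal.ofReal (Real.exp (4 * N)) =
      ENNReal.ofReal (A * Real.exp (4 * N) * R ^ ((N * n : ℕ) / 2 : ℝ)) *
        ENNReal.ofReal (R ^ (∑ j, ((n : ℝ) / p j - n / 2))) := by
    rw [← ENNReal.ofReal_mul (by positivity), ← ENNReal.ofReal_mul (by positivity), hpow]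
  calc _ = C₁ ^ (1 / (2 : ℝ)) * v ^ (1 / (2 : ℝ)) *
        (ENNReal.ofReal (A * Real.exp (4 * N) * R ^ ((N * n : ℕ) / 2 : ℝ)) *
          ENNReal.ofReal (R ^ (∑ j, ((n : ℝ) / p j - n / 2)))) * (∏ j, D j) *
        iterNorm (List.finRange N) p (fun _ x y => decay n τ (x - y)) f X := by ring
    _ = _ := by rw [← hpow']; ring

end Kernel

/-! ### Derivative bounds on a given scale -/

section DerivBound

variable {n N : ℕ}

/-- The derivatives of `g` at `Ξ` up to order `M`, taken in any order, are bounded by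
`A τ^{-r}` where `r` is the order. -/
def DerivBound (τ : ℝ) : ℕ → ℝ → (Space n N → ℂ) → Space n N → Prop
  | 0, A, g, Ξ => ‖g Ξ‖ ≤ A
  | M + 1, A, g, Ξ => ‖g Ξ‖ ≤ A ∧ ∀ i, DerivBound τ M (A / τ) (partialDeriv i g) Ξ

variable {τ : ℝ} {M : ℕ} {A B : ℝ} {g h : Space n N → ℂ} {Ξ : Space n N}

lemma DerivBound.norm_le (hg : DerivBound τ M A g Ξ) : ‖g Ξ‖ ≤ A := by
  cases M with
  | zero => exact hg
  | succ M => exact hg.1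

lemma DerivBound.mono (hτ : 0 < τ) (hg : DerivBound τ M A g Ξ) (hAB : A ≤ B) :
    DerivBound τ M B g Ξ := by
  induction M generalizing A B g with
  | zero => exact le_trans hg hAB
  | succ M ih => exact ⟨hg.1.trans hAB, fun i => ih (hg.2 i) (by gcongr)⟩

lemma DerivBound.of_succ (hg : DerivBound τ (M + 1) A g Ξ) : DerivBound τ M A g Ξ := by
  induction M generalizing A g with
  | zero => exact hg.1
  | succ M ih => exact ⟨hg.1, fun i => ih (hg.2 i)⟩

/-- Bounds on a coarse scale imply bounds on any finer scale. -/
lemma DerivBound.of_scale_le {σ : ℝ} (hσ : 0 < σ) (hστ : σ ≤ τ) (hg : DerivBound τ M A g Ξ) :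
    DerivBound σ M A g Ξ := by
  induction M generalizing A g with
  | zero => exact hg
  | succ M ih =>
    refine ⟨hg.1, fun i => (ih (hg.2 i)).mono hσ ?_⟩
    have hA : 0 ≤ A := (norm_nonneg _).trans hg.1
    gcongr

lemma derivBound_of_eventuallyEq_zero (hτ : 0 < τ) (hA : 0 ≤ A) (hg : g =ᶠ[nhds Ξ] 0) :
    DerivBound τ M A g Ξ := by
  induction M generalizing A g with
  | zero => simpa [DerivBound, hg.eq_of_nhds] using hA
  | succ M ih =>
    refine ⟨by simpa [hg.eq_of_nhds] using hA, fun i =>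
      ih (by positivity) (partialDeriv_eventuallyEq_zero hg i)⟩

lemma partialDeriv_add (hg : ContDiff ℝ ∞ g) (hh : ContDiff ℝ ∞ h) (i : Fin N × Fin n) :
    partialDeriv i (fun Y => g Y + h Y) = fun Y => partialDeriv i g Y + partialDeriv i h Y := by
  funext Y
  simp only [partialDeriv]
  rw [fderiv_fun_add (hg.differentiable (by simp) Y) (hh.differentiable (by simp) Y)]
  rfl

lemma partialDeriv_mul (hg : ContDiff ℝ ∞ g) (hh : ContDiff ℝ ∞ h) (i : Fin N × Fin n) :
    partialDeriv i (fun Y => g Y * h Y) =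
      fun Y => g Y * partialDeriv i h Y + partialDeriv i g Y * h Y := by
  funext Y
  simp only [partialDeriv]
  rw [fderiv_fun_mul (hg.differentiable (by simp) Y) (hh.differentiable (by simp) Y)]
  simp [mul_comm (h Y)]

lemma partialDeriv_const_mul (hg : ContDiff ℝ ∞ g) (c : ℂ) (i : Fin N × Fin n) :
    partialDeriv i (fun Y => c * g Y) = fun Y => c * partialDeriv i g Y := by
  funext Y
  simp only [partialDeriv]
  rw [fderiv_const_mul (hg.differentiable (by simp) Y)]
  rfl

lemma DerivBound.add (hgs : ContDiff ℝ ∞ g) (hhs : ContDiff ℝ ∞ h) (hg : DerivBound τ M A g Ξ)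
    (hh : DerivBound τ M B h Ξ) : DerivBound τ M (A + B) (fun Y => g Y + h Y) Ξ := by
  induction M generalizing A B g h with
  | zero => exact (norm_add_le _ _).trans (add_le_add hg hh)
  | succ M ih =>
    refine ⟨(norm_add_le _ _).trans (add_le_add hg.1 hh.1), fun i => ?_⟩
    rw [partialDeriv_add hgs hhs, add_div]
    exact ih (contDiff_partialDeriv hgs i) (contDiff_partialDeriv hhs i) (hg.2 i) (hh.2 i)

lemma DerivBound.const_mul (hgs : ContDiff ℝ ∞ g) (hg : DerivBound τ M A g Ξ) (c : ℂ) :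
    DerivBound τ M (‖c‖ * A) (fun Y => c * g Y) Ξ := by
  induction M generalizing A g with
  | zero =>
    change ‖c * g Ξ‖ ≤ _
    rw [norm_mul]
    exact mul_le_mul_of_nonneg_left hg (norm_nonneg c)
  | succ M ih =>
    refine ⟨?_, fun i => ?_⟩
    · rw [norm_mul]
      exact mul_le_mul_of_nonneg_left hg.1 (norm_nonneg c)
    · rw [partialDeriv_const_mul hgs, mul_div_assoc]
      exact ih (contDiff_partialDeriv hgs i) (hg.2 i)

/-- The Leibniz rule. -/
lemma DerivBound.mul (hτ : 0 < τ) (hgs : ContDiff ℝ ∞ g) (hhs : ContDiff ℝ ∞ h)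
    (hg : DerivBound τ M A g Ξ) (hh : DerivBound τ M B h Ξ) :
    DerivBound τ M (2 ^ M * (A * B)) (fun Y => g Y * h Y) Ξ := by
  have hmul : ‖g Ξ * h Ξ‖ ≤ A * B := by
    rw [norm_mul]
    exact mul_le_mul hg.norm_le hh.norm_le (norm_nonneg _) ((norm_nonneg _).trans hg.norm_le)
  induction M generalizing A B g h with
  | zero => simpa [DerivBound] using hmul
  | succ M ih =>
    have hAB : 0 ≤ A * B := (norm_nonneg _).trans hmul
    refine ⟨hmul.trans (le_mul_of_one_le_left hAB (one_le_pow₀ one_le_two)), fun i => ?_⟩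
    have hgi := contDiff_partialDeriv hgs i
    have hhi := contDiff_partialDeriv hhs i
    rw [partialDeriv_mul hgs hhs]
    have hm : ∀ {a b : Space n N → ℂ} {A' B' : ℝ}, DerivBound τ M A' a Ξ → DerivBound τ M B' b Ξ →
        ‖a Ξ * b Ξ‖ ≤ A' * B' := fun ha hb => by
      rw [norm_mul]
      exact mul_le_mul ha.norm_le hb.norm_le (norm_nonneg _) ((norm_nonneg _).trans ha.norm_le)
    refine (DerivBound.add (hgs.mul hhi) (hgi.mul hhs)
      (ih hgs hhi hg.of_succ (hh.2 i) (hm hg.of_succ (hh.2 i)))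
      (ih hgi hhs (hg.2 i) hh.of_succ (hm (hg.2 i) hh.of_succ))).mono hτ (le_of_eq ?_)
    rw [pow_succ]
    ring

lemma DerivBound.diffOp (hτ : 0 < τ) (hgs : ContDiff ℝ ∞ g) (hg : DerivBound τ (M + 2) A g Ξ)
    (i : Fin N × Fin n) : DerivBound τ M (2 * A) (diffOp τ i g) Ξ := by
  have h2 := (hg.2 i).2 i
  have hs := contDiff_partialDeriv (contDiff_partialDeriv hgs i) i
  have h3 := h2.const_mul hs (-((τ ^ 2 : ℝ) : ℂ))
  have h4 := DerivBound.add hgs (contDiff_const.mul hs) hg.of_succ.of_succ h3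
  have e : MixedPDO.diffOp τ i g =
      fun Y => g Y + -((τ ^ 2 : ℝ) : ℂ) * partialDeriv i (partialDeriv i g) Y := by
    funext Y; simp only [MixedPDO.diffOp]; ring
  rw [e]
  refine h4.mono hτ (le_of_eq ?_)
  rw [norm_neg, Complex.norm_real, Real.norm_of_nonneg (by positivity)]
  field_simp
  ring

lemma contDiff_diffOps (hgs : ContDiff ℝ ∞ g) (τ : ℝ) (l : List (Fin N × Fin n)) :
    ContDiff ℝ ∞ (diffOps τ l g) := by
  induction l with
  | nil => exact hgs
  | cons i l ih => exact contDiff_diffOp ih τ i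

lemma DerivBound.diffOps (hτ : 0 < τ) (hgs : ContDiff ℝ ∞ g) (l : List (Fin N × Fin n))
    (hg : DerivBound τ (M + 2 * l.length) A g Ξ) :
    DerivBound τ M (2 ^ l.length * A) (diffOps τ l g) Ξ := by
  induction l generalizing M with
  | nil => simpa [MixedPDO.diffOps] using hg
  | cons i l ih =>
    have h1 : DerivBound τ (M + 2 + 2 * l.length) A g Ξ := by
      rw [List.length_cons] at hg
      rwa [show M + 2 + 2 * l.length = M + 2 * (l.length + 1) by ring]
    refine ((ih h1).diffOp hτ (contDiff_diffOps hgs τ l) i).mono hτ (le_of_eq ?_)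
    rw [List.length_cons, pow_succ]
    ring

/-- A reformulation of `DerivBound` by words of partial derivatives. -/
lemma derivBound_of_foldr
    (hg : ∀ w : List (Fin N × Fin n), w.length ≤ M → ‖w.foldr partialDeriv g Ξ‖ ≤ A / τ ^ w.length) :
    DerivBound τ M A g Ξ := by
  have h0 : ‖g Ξ‖ ≤ A := by simpa using hg [] (by simp)
  induction M generalizing A g with
  | zero => exact h0
  | succ M ih =>
    refine ⟨h0, fun i => ?_⟩
    have h1 : ∀ w : List (Fin N × Fin n), w.length ≤ M →
        ‖w.foldr partialDeriv (partialDeriv i g) Ξ‖ ≤ A / τ / τ ^ w.length := by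
      intro w hw
      have := hg (w ++ [i]) (by simpa using hw)
      simp only [List.foldr_append, List.foldr_cons, List.foldr_nil, List.length_append,
        List.length_cons, List.length_nil, zero_add, pow_succ] at this
      rwa [div_div, mul_comm τ]
    exact ih h1 (by simpa using h1 [] (by simp))

lemma exists_derivBound_of_hasCompactSupport (hgs : ContDiff ℝ ∞ g) (hc : HasCompactSupport g)
    (M : ℕ) : ∃ B, 0 ≤ B ∧ ∀ Ξ, DerivBound 1 M B g Ξ := by
  induction M generalizing g with
  | zero =>
    obtain ⟨B, hB⟩ := hc.exists_bound_of_continuous hgs.continuous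
    exact ⟨B, (norm_nonneg _).trans (hB 0), hB⟩
  | succ M ih =>
    obtain ⟨B, hB⟩ := hc.exists_bound_of_continuous hgs.continuous
    choose D hD0 hD using fun i =>
      ih (contDiff_partialDeriv hgs i) (hasCompactSupport_partialDeriv hc i)
    have hB0 : 0 ≤ B := (norm_nonneg _).trans (hB 0)
    have hS : 0 ≤ ∑ i, D i := Finset.sum_nonneg fun i _ => hD0 i
    refine ⟨B + ∑ i, D i, by positivity, fun Ξ => ⟨(hB Ξ).trans (by linarith), fun i => ?_⟩⟩
    refine (hD i Ξ).mono one_pos ?_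
    rw [div_one]
    have := Finset.single_le_sum (fun i _ => hD0 i) (Finset.mem_univ i)
    linarith

lemma partialDeriv_comp_smul (hgs : ContDiff ℝ ∞ g) (s : ℝ) (i : Fin N × Fin n) :
    partialDeriv i (fun Y => g (s • Y)) = fun Y => (s : ℂ) * partialDeriv i g (s • Y) := by
  funext Y
  simp only [partialDeriv]
  have h1 : HasFDerivAt (fun Y : Space n N => s • Y) (s • ContinuousLinearMap.id ℝ (Space n N)) Y :=
    (hasFDerivAt_id Y).const_smul s
  have h2 := ((hgs.differentiable (by simp) (s • Y)).hasFDerivAt.comp Y h1).fderiv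
  rw [Function.comp_def] at h2
  rw [h2]
  simp

lemma DerivBound.comp_smul (hgs : ContDiff ℝ ∞ g) {s : ℝ} (hs : 0 < s)
    (hg : DerivBound 1 M A g (s • Ξ)) : DerivBound s⁻¹ M A (fun Y => g (s • Y)) Ξ := by
  induction M generalizing A g with
  | zero => exact hg
  | succ M ih =>
    refine ⟨hg.1, fun i => ?_⟩
    have hi := contDiff_partialDeriv hgs i
    rw [partialDeriv_comp_smul hgs]
    have h1 := hg.2 i
    rw [div_one] at h1
    refine ((ih hi h1).const_mul (hi.comp (contDiff_const_smul s)) (s : ℂ)).mono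
      (inv_pos.2 hs) (le_of_eq ?_)
    rw [Complex.norm_real, Real.norm_of_nonneg hs.le]
    field_simp

end DerivBound

/-! ### Partial derivatives in any order -/

section MultiDeriv

variable {n N : ℕ}

lemma partialDeriv_comm {g : Space n N → ℂ} (hg : ContDiff ℝ ∞ g) (i j : Fin N × Fin n) :
    partialDeriv i (partialDeriv j g) = partialDeriv j (partialDeriv i g) := by
  have key : ∀ (a b : Fin N × Fin n) (Y : Space n N), partialDeriv a (partialDeriv b g) Y =
      fderiv ℝ (fderiv ℝ g) Y (unitVec a) (unitVec b) := by
    intro a b Y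
    have hd : DifferentiableAt ℝ (fderiv ℝ g) Y :=
      (hg.fderiv_right (m := ∞) (by simp)).differentiable (by simp) Y
    have e : partialDeriv b g = fun Y => fderiv ℝ g Y (unitVec b) := rfl
    rw [e]
    change fderiv ℝ (fun Y => fderiv ℝ g Y (unitVec b)) Y (unitVec a) = _
    rw [fderiv_clm_apply hd (differentiableAt_const _)]
    simp
  funext Y
  rw [key, key]
  exact (hg.contDiffAt.isSymmSndFDerivAt (by
    rw [minSmoothness_of_isRCLikeNormedField]; exact WithTop.coe_le_coe.2 (le_top (a := (2 : ℕ∞))))) _ _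

lemma contDiff_foldr_partialDeriv {g : Space n N → ℂ} (hg : ContDiff ℝ ∞ g)
    (w : List (Fin N × Fin n)) : ContDiff ℝ ∞ (w.foldr partialDeriv g) := by
  induction w with
  | nil => exact hg
  | cons i w ih => exact contDiff_partialDeriv ih i

lemma foldr_partialDeriv_perm {g : Space n N → ℂ} (hg : ContDiff ℝ ∞ g)
    {w w' : List (Fin N × Fin n)} (h : w.Perm w') :
    w.foldr partialDeriv g = w'.foldr partialDeriv g := by
  induction h with
  | nil => rfl
  | cons i _ ih => simp only [List.foldr_cons, ih]
  | swap i j w =>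
    simp only [List.foldr_cons]
    exact partialDeriv_comm (contDiff_foldr_partialDeriv hg w) j i
  | trans _ _ ih1 ih2 => exact ih1.trans ih2

lemma multiDeriv_eq_foldr (α : MultiIndex n N) (g : Space n N → ℂ) :
    multiDeriv α g = ((List.finRange N ×ˢ List.finRange n).flatMap fun i =>
      List.replicate (α i) i).foldr partialDeriv g := by
  have hrep : ∀ (k : ℕ) (i : Fin N × Fin n) (f : Space n N → ℂ),
      (List.replicate k i).foldr partialDeriv f = (partialDeriv i)^[k] f := by
    intro k i f
    induction k with
    | zero => rfl
    | succ k ih => rw [List.replicate_succ, List.foldr_cons, ih, Function.iterate_succ_apply']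
  rw [multiDeriv]
  induction (List.finRange N ×ˢ List.finRange n) with
  | nil => rfl
  | cons i l ih => rw [List.foldr_cons, ih, List.flatMap_cons, List.foldr_append, hrep]

/-- Every iterated partial derivative of a smooth function is one of the derivatives `∂^α`. -/
lemma foldr_partialDeriv_eq_multiDeriv {g : Space n N → ℂ} (hg : ContDiff ℝ ∞ g)
    (w : List (Fin N × Fin n)) :
    w.foldr partialDeriv g = multiDeriv (fun i => w.count i) g := by
  rw [multiDeriv_eq_foldr]
  refine foldr_partialDeriv_perm hg (List.perm_iff_count.2 fun a => ?_)
  have hnd : (List.finRange N ×ˢ List.finRange n).Nodup :=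
    (List.nodup_finRange N).product (List.nodup_finRange n)
  rw [List.count_flatMap, ← List.sum_toFinset _ hnd]
  simp only [Function.comp_apply, List.count_replicate]
  have ha : a ∈ (List.finRange N ×ˢ List.finRange n).toFinset := by
    obtain ⟨a, b⟩ := a; simp
  simp [Finset.sum_ite_eq', ha]

lemma length_count (w : List (Fin N × Fin n)) :
    MultiIndex.length (fun i => w.count i) = w.length := by
  rw [MultiIndex.length]
  induction w with
  | nil => simp
  | cons i w ih => simp [List.count_cons, Finset.sum_add_distrib, ih]

end MultiDeriv

/-! ### The dyadic decomposition of symbols -/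

section Dyadic

variable {n N : ℕ}

/-- A smooth cutoff, equal to `1` for `‖Ξ‖ ≤ 1` and to `0` for `‖Ξ‖ ≥ 2`. -/
noncomputable def cutoff (n N : ℕ) (Ξ : Space n N) : ℂ :=
  ((⟨1, 2, one_pos, one_lt_two⟩ : ContDiffBump (0 : Space n N)) Ξ : ℂ)

lemma contDiff_cutoff : ContDiff ℝ ∞ (cutoff n N) :=
  Complex.ofRealCLM.contDiff.comp (ContDiffBump.contDiff _)

lemma cutoff_eq_one {Ξ : Space n N} (h : ‖Ξ‖ ≤ 1) : cutoff n N Ξ = 1 := by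
  rw [cutoff, ContDiffBump.one_of_mem_closedBall]
  · simp
  · simpa using h

lemma cutoff_eq_zero {Ξ : Space n N} (h : 2 ≤ ‖Ξ‖) : cutoff n N Ξ = 0 := by
  rw [cutoff, ContDiffBump.zero_of_le_dist]
  · simp
  · simpa using h

lemma norm_cutoff_le (Ξ : Space n N) : ‖cutoff n N Ξ‖ ≤ 1 := by
  rw [cutoff, Complex.norm_real, Real.norm_of_nonneg (ContDiffBump.nonneg _)]
  exact ContDiffBump.le_one _

lemma hasCompactSupport_of_zero {g : Space n N → ℂ} {R : ℝ} (h : ∀ Ξ, R < ‖Ξ‖ → g Ξ = 0) :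
    HasCompactSupport g := by
  refine HasCompactSupport.intro (isCompact_closedBall (0 : Space n N) R) fun Ξ hΞ => h Ξ ?_
  simpa using hΞ

/-- The smooth dyadic partition of unity: the `k`-th piece lives where `‖Ξ‖ ~ 2^k`. -/
noncomputable def dyadicPiece (n N : ℕ) : ℕ → Space n N → ℂ
  | 0 => cutoff n N
  | k + 1 => fun Ξ => cutoff n N (((2 : ℝ) ^ (k + 1))⁻¹ • Ξ) -
      cutoff n N ((2 : ℝ) • ((2 : ℝ) ^ (k + 1))⁻¹ • Ξ)

lemma contDiff_dyadicPiece (k : ℕ) : ContDiff ℝ ∞ (dyadicPiece n N k) := by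
  cases k with
  | zero => exact contDiff_cutoff
  | succ k =>
    exact (contDiff_cutoff.comp (contDiff_const_smul _)).sub
      (contDiff_cutoff.comp ((contDiff_const_smul _).comp (contDiff_const_smul _)))

lemma sum_dyadicPiece (K : ℕ) (Ξ : Space n N) :
    ∑ k ∈ Finset.range (K + 1), dyadicPiece n N k Ξ = cutoff n N (((2 : ℝ) ^ K)⁻¹ • Ξ) := by
  induction K with
  | zero => simp [dyadicPiece]
  | succ K ih =>
    rw [Finset.sum_range_succ, ih]
    simp only [dyadicPiece]
    rw [smul_smul 2, pow_succ,
      show (2 : ℝ) * ((2 : ℝ) ^ K * 2)⁻¹ = (2 ^ K)⁻¹ by field_simp]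
    ring

lemma dyadicPiece_eq_zero (k : ℕ) {Ξ : Space n N} (h : 2 * 2 ^ k < ‖Ξ‖) :
    dyadicPiece n N k Ξ = 0 := by
  cases k with
  | zero => exact cutoff_eq_zero (by simpa using h.le)
  | succ k =>
    have h2 : 2 ≤ ‖((2 : ℝ) ^ (k + 1))⁻¹ • Ξ‖ := by
      rw [norm_smul, norm_inv, norm_pow, Real.norm_ofNat, inv_mul_eq_div,
        le_div_iff₀ (by positivity)]
      exact h.le
    simp only [dyadicPiece]
    rw [cutoff_eq_zero h2, cutoff_eq_zero, sub_zero]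
    rw [norm_smul, Real.norm_ofNat]
    linarith

lemma dyadicPiece_succ_eq_zero (k : ℕ) {Ξ : Space n N} (h : 2 * ‖Ξ‖ ≤ 2 ^ (k + 1)) :
    dyadicPiece n N (k + 1) Ξ = 0 := by
  have h2 : 2 * ‖((2 : ℝ) ^ (k + 1))⁻¹ • Ξ‖ ≤ 1 := by
    rw [norm_smul, norm_inv, norm_pow, Real.norm_ofNat, inv_mul_eq_div, ← mul_div_assoc,
      div_le_one (by positivity)]
    exact h
  simp only [dyadicPiece]
  rw [cutoff_eq_one, cutoff_eq_one, sub_self]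
  · rwa [norm_smul, Real.norm_ofNat]
  · linarith [norm_nonneg (((2 : ℝ) ^ (k + 1))⁻¹ • Ξ)]

/-- The dyadic pieces with `k ≥ 1` are dilates of a single function, hence the uniform bound. -/
lemma exists_derivBound_dyadicPiece (n N M : ℕ) :
    ∃ B, 0 ≤ B ∧ ∀ k Ξ, DerivBound (2 ^ k) M B (dyadicPiece n N k) Ξ := by
  obtain ⟨B₀, hB₀, h₀⟩ := exists_derivBound_of_hasCompactSupport (M := M) contDiff_cutoff
    (hasCompactSupport_of_zero (g := cutoff n N) (R := 2) fun Ξ h => cutoff_eq_zero h.le)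
  set ψ : Space n N → ℂ := fun Ξ => cutoff n N Ξ - cutoff n N ((2 : ℝ) • Ξ) with hψ
  have hψs : ContDiff ℝ ∞ ψ :=
    contDiff_cutoff.sub (contDiff_cutoff.comp (contDiff_const_smul _))
  have hψc : HasCompactSupport ψ := by
    refine hasCompactSupport_of_zero (R := 2) fun Ξ h => ?_
    simp only [hψ]
    rw [cutoff_eq_zero h.le, cutoff_eq_zero, sub_zero]
    rw [norm_smul, Real.norm_ofNat]
    linarith
  obtain ⟨B₁, hB₁, h₁⟩ := exists_derivBound_of_hasCompactSupport (M := M) hψs hψc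
  refine ⟨max B₀ B₁, hB₀.trans (le_max_left _ _), fun k Ξ => ?_⟩
  cases k with
  | zero => simpa [dyadicPiece] using (h₀ Ξ).mono one_pos (le_max_left B₀ B₁)
  | succ k =>
    have := (h₁ (((2 : ℝ) ^ (k + 1))⁻¹ • Ξ)).comp_smul hψs (by positivity)
    rw [inv_inv] at this
    exact this.mono (by positivity) (le_max_right B₀ B₁)

/-- The symbol estimates up to order `M` at a fixed point `X`, for derivatives taken in any order
and with a single constant. -/
def SymbolBounds (m ρ : ℝ) (M : ℕ) (c : ℝ) (b : Space n N → ℂ) : Prop :=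
  ∀ w : List (Fin N × Fin n), w.length ≤ M → ∀ Ξ,
    ‖w.foldr partialDeriv b Ξ‖ ≤ c * bracket Ξ ^ (m - ρ * w.length)

lemma one_le_bracket (Ξ : Space n N) : 1 ≤ bracket Ξ := by
  rw [bracket, Real.one_le_sqrt]
  have : 0 ≤ ∑ j, ‖Ξ j‖ ^ 2 := by positivity
  linarith

lemma norm_le_bracket (Ξ : Space n N) : ‖Ξ‖ ≤ bracket Ξ := by
  refine (pi_norm_le_iff_of_nonneg (Real.sqrt_nonneg _)).2 fun j => Real.le_sqrt_of_sq_le ?_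
  have := Finset.single_le_sum (f := fun j => ‖Ξ j‖ ^ 2) (fun i _ => sq_nonneg _) (Finset.mem_univ j)
  linarith

lemma bracket_le (Ξ : Space n N) {R : ℝ} (hR : 1 ≤ R) (h : ‖Ξ‖ ≤ 2 * R) :
    bracket Ξ ≤ 2 * Real.sqrt (1 + N) * R := by
  rw [bracket]
  refine Real.sqrt_le_iff.2 ⟨by positivity, ?_⟩
  have h1 : ∑ j, ‖Ξ j‖ ^ 2 ≤ ∑ _j : Fin N, (2 * R) ^ 2 := by
    gcongr with j
    exact (norm_le_pi_norm Ξ j).trans h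
  rw [mul_pow, mul_pow, Real.sq_sqrt (by positivity)]
  simp only [Finset.sum_const, Finset.card_univ, Fintype.card_fin, nsmul_eq_mul] at h1
  nlinarith

/-- Powers of comparable numbers are comparable, uniformly for exponents in a bounded range. -/
lemma rpow_le_of_comparable {t R Λ e E : ℝ} (ht : 0 < t) (hR : 0 < R) (hΛ : 1 ≤ Λ) (h1 : R ≤ Λ * t)
    (h2 : t ≤ Λ * R) (he : |e| ≤ E) : t ^ e ≤ Λ ^ E * R ^ e := by
  have hΛ0 : 0 < Λ := by linarith
  rcases le_total 0 e with h | h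
  · calc t ^ e ≤ (Λ * R) ^ e := Real.rpow_le_rpow ht.le h2 h
      _ = Λ ^ e * R ^ e := Real.mul_rpow hΛ0.le hR.le
      _ ≤ _ := by
        gcongr
        exact (le_abs_self e).trans he
  · calc t ^ e ≤ (R / Λ) ^ e := by
          refine Real.rpow_le_rpow_of_nonpos (by positivity) ?_ h
          rw [div_le_iff₀ hΛ0, mul_comm]; exact h1
      _ = Λ ^ (-e) * R ^ e := by
          rw [Real.div_rpow hR.le hΛ0.le, Real.rpow_neg hΛ0.le]
          field_simp
      _ ≤ _ := by
          gcongr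
          exact (neg_le_abs e).trans he

/-- The dyadic pieces of a symbol satisfy derivative bounds on the scale `2^{kρ}`. -/
lemma exists_norm_diffOps_le (n N : ℕ) (m : ℝ) {ρ : ℝ} (hρ : ρ ∈ Set.Icc (0 : ℝ) 1)
    (l : List (Fin N × Fin n)) :
    ∃ B, 0 ≤ B ∧ ∀ (b : Space n N → ℂ) (c : ℝ), 0 ≤ c → ContDiff ℝ ∞ b →
      SymbolBounds m ρ (2 * l.length) c b → ∀ k Ξ,
        ‖diffOps (((2 : ℝ) ^ k) ^ ρ) l (fun Y => b Y * dyadicPiece n N k Y) Ξ‖ ≤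
          B * c * ((2 : ℝ) ^ k) ^ m := by
  set M := 2 * l.length with hM
  obtain ⟨B, hB, hψ⟩ := exists_derivBound_dyadicPiece n N M
  set Λ := 2 * Real.sqrt (1 + N) with hΛ
  have hΛ2 : 2 ≤ Λ := by
    have : 1 ≤ Real.sqrt (1 + N) := Real.one_le_sqrt.2 (by linarith [Nat.cast_nonneg (α := ℝ) N])
    linarith
  refine ⟨2 ^ l.length * (2 ^ M * (Λ ^ (|m| + M) * B)), by positivity, ?_⟩
  intro b c hc hb hbc k Ξ
  set R : ℝ := 2 ^ k with hR
  have hR1 : 1 ≤ R := one_le_pow₀ one_le_two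
  have hR0 : 0 < R := by linarith
  set τ := R ^ ρ with hτ
  have hτ0 : 0 < τ := by positivity
  have hτR : τ ≤ R := by
    calc R ^ ρ ≤ R ^ (1 : ℝ) := Real.rpow_le_rpow_of_exponent_le hR1 hρ.2
      _ = R := Real.rpow_one R
  have hgs : ContDiff ℝ ∞ fun Y => b Y * dyadicPiece n N k Y := hb.mul (contDiff_dyadicPiece k)
  have key : DerivBound τ M (2 ^ M * (Λ ^ (|m| + M) * B) * c * R ^ m)
      (fun Y => b Y * dyadicPiece n N k Y) Ξ := by
    -- off the annulus the piece vanishes near `Ξ`; on it `⟨Ξ⟩` is comparable to `R`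
    by_cases h1 : 2 * R < ‖Ξ‖
    · refine derivBound_of_eventuallyEq_zero hτ0 (by positivity) ?_
      filter_upwards [(isOpen_lt continuous_const continuous_norm).mem_nhds h1] with Y hY
      simp [dyadicPiece_eq_zero k hY]
    by_cases h2 : 0 < k ∧ 2 * ‖Ξ‖ < R
    · obtain ⟨k', rfl⟩ : ∃ k', k = k' + 1 := ⟨k - 1, by omega⟩
      refine derivBound_of_eventuallyEq_zero hτ0 (by positivity) ?_
      filter_upwards [(isOpen_lt (continuous_const.mul continuous_norm)
        continuous_const).mem_nhds h2.2] with Y hY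
      simp [dyadicPiece_succ_eq_zero k' (le_of_lt hY)]
    have hup : bracket Ξ ≤ Λ * R := bracket_le Ξ hR1 (not_lt.1 h1)
    have hlow : R ≤ Λ * bracket Ξ := by
      have hb1 := one_le_bracket Ξ
      rcases Nat.eq_zero_or_pos k with h0 | h0
      · have : R = 1 := by rw [hR, h0, pow_zero]
        nlinarith
      · have h3 : R ≤ 2 * ‖Ξ‖ := by
          by_contra hcon
          exact h2 ⟨h0, not_le.1 hcon⟩
        nlinarith [norm_le_bracket Ξ]
    have hbd : DerivBound τ M (c * Λ ^ (|m| + M) * R ^ m) b Ξ := by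
      refine derivBound_of_foldr fun w hw => (hbc w hw Ξ).trans ?_
      have he : |m - ρ * w.length| ≤ |m| + M := by
        refine (abs_sub _ _).trans ?_
        have h4 : (w.length : ℝ) ≤ M := by exact_mod_cast hw
        rw [abs_of_nonneg (mul_nonneg hρ.1 (Nat.cast_nonneg w.length))]
        nlinarith [hρ.1, hρ.2, Nat.cast_nonneg (α := ℝ) w.length]
      refine (mul_le_mul_of_nonneg_left (rpow_le_of_comparable
        (by linarith [one_le_bracket Ξ]) hR0 (by linarith) hlow hup he) hc).trans (le_of_eq ?_)
      rw [Real.rpow_sub hR0, Real.rpow_mul hR0.le, Real.rpow_natCast]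
      ring
    refine (DerivBound.mul hτ0 hb (contDiff_dyadicPiece k) hbd
      ((hψ k Ξ).of_scale_le hτ0 hτR)).mono hτ0 (le_of_eq ?_)
    ring
  have := DerivBound.diffOps (M := 0) hτ0 hgs l (by simpa using key)
  refine this.norm_le.trans (le_of_eq ?_)
  ring

/-- The kernel estimate for the dyadic pieces of a symbol. -/
lemma exists_dyadic_kernel_bound (n N : ℕ) (m : ℝ) {ρ : ℝ} (hρ : ρ ∈ Set.Icc (0 : ℝ) 1)
    {p : Fin N → ℝ} (hp : ∀ j, p j ∈ Set.Icc (1 : ℝ) 2) :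
    ∃ C : ℝ≥0∞, C ≠ ⊤ ∧ ∀ (b : Space n N → ℂ) (c : ℝ), 0 ≤ c → ContDiff ℝ ∞ b →
      SymbolBounds m ρ (2 * (coordList n N).length) c b →
      ∀ k, ∀ f : Space n N → ℝ≥0∞, Measurable f → ∀ X,
        ∫⁻ Y, ‖invFourier (fun Ξ => b Ξ * dyadicPiece n N k Ξ) (X - Y)‖ₑ * f Y ≤
          C * ENNReal.ofReal c * ENNReal.ofReal (((2 : ℝ) ^ k) ^ (m + ∑ j, (n : ℝ) / p j)) *
            iterNorm (List.finRange N) p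
              (fun _ x y => decay n (((2 : ℝ) ^ k) ^ ρ) (x - y)) f X := by
  obtain ⟨C, hC, hker⟩ := exists_kernel_bound n N hp
  obtain ⟨B, hB, hdiff⟩ := exists_norm_diffOps_le n N m hρ (coordList n N)
  refine ⟨C * ENNReal.ofReal B, ENNReal.mul_ne_top hC ENNReal.ofReal_ne_top, ?_⟩
  intro b c hc hb hbc k f hf X
  have hR0 : (0 : ℝ) < 2 ^ k := by positivity
  refine (hker (2 ^ k) (((2 : ℝ) ^ k) ^ ρ) (B * c * ((2 : ℝ) ^ k) ^ m) hR0 (by positivity)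
    (fun Ξ => b Ξ * dyadicPiece n N k Ξ) (hb.mul (contDiff_dyadicPiece k))
    (fun Ξ hΞ => by rw [dyadicPiece_eq_zero k hΞ, mul_zero])
    (fun Ξ => hdiff b c hc hb hbc k Ξ) f hf X).trans (le_of_eq ?_)
  rw [mul_assoc (B * c), ← Real.rpow_add hR0, ENNReal.ofReal_mul (by positivity),
    ENNReal.ofReal_mul hB]
  ring

/-- The total scaling factor of the iterated averages on the scale `1/τ`. -/
lemma prod_rpow_scale {τ : ℝ} (hτ : 0 < τ) {p : Fin N → ℝ} (hp : ∀ j, 0 < p j) (c : ℝ≥0∞) :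
    ((List.finRange N).map fun j => (ENNReal.ofReal (τ ^ n)⁻¹ * c) ^ (1 / p j)).prod =
      ENNReal.ofReal (τ ^ (-∑ j, (n : ℝ) / p j)) * ∏ j, c ^ (1 / p j) := by
  rw [← Fin.prod_univ_def]
  have h : ∀ j, (ENNReal.ofReal (τ ^ n)⁻¹ * c) ^ (1 / p j) =
      ENNReal.ofReal (τ ^ (-((n : ℝ) / p j))) * c ^ (1 / p j) := by
    intro j
    have := hp j
    rw [ENNReal.mul_rpow_of_nonneg _ _ (by positivity), ENNReal.ofReal_rpow_of_pos (by positivity),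
      ← Real.rpow_natCast, ← Real.rpow_neg hτ.le, ← Real.rpow_mul hτ.le]
    congr 3
    ring
  simp_rw [h]
  rw [Finset.prod_mul_distrib, ← ENNReal.ofReal_prod_of_nonneg fun j _ => by positivity,
    ← Real.rpow_sum_of_pos hτ, Finset.sum_neg_distrib]

/-- The gain `2^{-kδ}` at frequency `2^k`, with `δ = (ρ - 1) ∑ n/p_j - m`. -/
lemma rpow_gain (k : ℕ) (m ρ s : ℝ) :
    ENNReal.ofReal (((2 : ℝ) ^ k) ^ (m + s)) * ENNReal.ofReal ((((2 : ℝ) ^ k) ^ ρ) ^ (-s)) =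
      ENNReal.ofReal (2 ^ (m - (ρ - 1) * s)) ^ k := by
  have h2 : (0 : ℝ) < 2 ^ k := by positivity
  rw [← ENNReal.ofReal_mul (by positivity), ← Real.rpow_mul h2.le, ← Real.rpow_add h2,
    ← ENNReal.ofReal_pow (by positivity), ← Real.rpow_natCast, ← Real.rpow_mul (by norm_num),
    ← Real.rpow_natCast, ← Real.rpow_mul (by norm_num)]
  congr 2
  ring

lemma tsum_gain_ne_top {δ : ℝ} (hδ : δ < 0) :
    ∑' k : ℕ, ENNReal.ofReal ((2 : ℝ) ^ δ) ^ k ≠ ⊤ := by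
  rw [ENNReal.tsum_geometric]
  refine ENNReal.inv_ne_top.2 (tsub_pos_of_lt ?_).ne'
  rw [ENNReal.ofReal_lt_one]
  exact Real.rpow_lt_one_of_one_lt_of_neg one_lt_two hδ

end Dyadic

/-! ### The pointwise bound by iterated maximal functions -/

section Pointwise

variable {n N : ℕ}

instance hasTemperateGrowth_volume : (volume : Measure (Space n N)).HasTemperateGrowth := by
  have : (volume : Measure (Space n N)).IsAddHaarMeasure := inferInstance
  infer_instance

/-- The convolution kernel of the `k`-th dyadic piece of the Fourier multiplier `b`. For a symbol
`a` and a fixed point `X`, it is applied to `b = a(X, ·)`. -/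
noncomputable def dyadicKernel (b : Space n N → ℂ) (k : ℕ) : Space n N → ℂ :=
  invFourier fun Ξ => b Ξ * dyadicPiece n N k Ξ

lemma integrable_mul_dyadicPiece {b : Space n N → ℂ} (hb : Continuous b) (k : ℕ) :
    Integrable fun Ξ => b Ξ * dyadicPiece n N k Ξ :=
  (hb.mul (contDiff_dyadicPiece k).continuous).integrable_of_hasCompactSupport
    (hasCompactSupport_of_zero (R := 2 * 2 ^ k) fun Ξ h => by
      change b Ξ * dyadicPiece n N k Ξ = 0
      rw [dyadicPiece_eq_zero k h, mul_zero])

/-- A Fourier multiplier with integrable symbol is convolution with its kernel. -/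
lemma integral_mul_fourier_eq_conv {g u : Space n N → ℂ} (hg : Integrable g) (hu : Integrable u)
    (X : Space n N) :
    ∫ Ξ, g Ξ * fourier u Ξ * Complex.exp (Complex.I * (dot X Ξ : ℂ)) =
      ∫ Y, invFourier g (X - Y) * u Y := by
  have h1 : ∀ Ξ, g Ξ * fourier u Ξ * Complex.exp (Complex.I * (dot X Ξ : ℂ)) =
      ∫ Y, g Ξ * u Y * Complex.exp (Complex.I * (dot (X - Y) Ξ : ℂ)) := by
    intro Ξ
    rw [fourier, ← integral_const_mul, ← integral_mul_const]
    refine integral_congr_ae (Filter.Eventually.of_forall fun Y => ?_)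
    have : Complex.exp (Complex.I * (dot (X - Y) Ξ : ℂ)) =
        Complex.exp (-(Complex.I * (dot Y Ξ : ℂ))) * Complex.exp (Complex.I * (dot X Ξ : ℂ)) := by
      rw [← Complex.exp_add, dot_sub_left]
      push_cast
      ring_nf
    simp only [this]
    ring
  have h2 : ∀ Y, invFourier g (X - Y) * u Y =
      ∫ Ξ, g Ξ * u Y * Complex.exp (Complex.I * (dot (X - Y) Ξ : ℂ)) := by
    intro Y
    rw [invFourier, ← integral_mul_const]
    refine integral_congr_ae (Filter.Eventually.of_forall fun Ξ => ?_)
    simp only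
    ring
  simp_rw [h1, h2]
  refine integral_integral_swap (f := fun Ξ Y =>
    g Ξ * u Y * Complex.exp (Complex.I * (dot (X - Y) Ξ : ℂ))) ?_
  refine (hg.mul_prod hu).mul_bdd (c := 1) ?_ (Filter.Eventually.of_forall fun z => by simp)
  have := continuous_dot (n := n) (N := N)
  have h3 : Continuous fun z : Space n N × Space n N => dot (X - z.2) z.1 :=
    this.comp ((continuous_const.sub continuous_snd).prodMk continuous_fst)
  exact (by fun_prop : Continuous fun z : Space n N × Space n N =>
    Complex.exp (Complex.I * (dot (X - z.2) z.1 : ℂ))).aestronglyMeasurable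

lemma norm_le_of_symbolBounds {m ρ c : ℝ} (hm : m ≤ 0) {M : ℕ} {b : Space n N → ℂ} (hc : 0 ≤ c)
    (h : SymbolBounds m ρ M c b) (Ξ : Space n N) : ‖b Ξ‖ ≤ c := by
  have h0 := h [] (by simp) Ξ
  simp only [List.foldr_nil, List.length_nil, Nat.cast_zero, mul_zero, sub_zero] at h0
  refine h0.trans (mul_le_of_le_one_right hc ?_)
  exact Real.rpow_le_one_of_one_le_of_nonpos (one_le_bracket Ξ) hm

/-- The operator is the limit of the sums of its dyadic pieces. -/
lemma tendsto_sum_dyadicKernel {a : Space n N → Space n N → ℂ} {X : Space n N} {c : ℝ}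
    (ha : Continuous (a X)) (hc : ∀ Ξ, ‖a X Ξ‖ ≤ c) (u : 𝓢(Space n N, ℂ)) :
    Filter.Tendsto (fun K => ∑ k ∈ Finset.range K, ∫ Y, dyadicKernel (a X) k (X - Y) * u Y)
      Filter.atTop (nhds (pseudoOp a u X)) := by
  have hfu := integrable_fourier u
  have hfc : Continuous (fourier u) := by
    have h := (continuous_invFourier (g := u) u.integrable).comp continuous_neg
    refine h.congr fun Ξ => (fourier_eq_invFourier u Ξ).symm
  rw [← Filter.tendsto_add_atTop_iff_nat 1]
  have h1 : ∀ K, ∑ k ∈ Finset.range (K + 1), ∫ Y, dyadicKernel (a X) k (X - Y) * u Y =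
      ∫ Ξ, cutoff n N (((2 : ℝ) ^ K)⁻¹ • Ξ) *
        (a X Ξ * fourier u Ξ * Complex.exp (Complex.I * (dot X Ξ : ℂ))) := by
    intro K
    simp only [dyadicKernel]
    rw [Finset.sum_congr rfl fun k _ =>
      (integral_mul_fourier_eq_conv (integrable_mul_dyadicPiece ha k) u.integrable X).symm,
      ← integral_finsetSum]
    · refine integral_congr_ae (Filter.Eventually.of_forall fun Ξ => ?_)
      simp only [← sum_dyadicPiece, Finset.sum_mul]
      exact Finset.sum_congr rfl fun k _ => by ring
    · intro k _
      refine integrable_mul_phase ?_ X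
      refine Continuous.integrable_of_hasCompactSupport
        ((ha.mul (contDiff_dyadicPiece k).continuous).mul hfc) ?_
      exact hasCompactSupport_of_zero (R := 2 * 2 ^ k) fun Ξ h => by
        rw [dyadicPiece_eq_zero k h, mul_zero, zero_mul]
  simp_rw [h1]
  refine tendsto_integral_of_dominated_convergence (fun Ξ => c * ‖fourier u Ξ‖) (fun K => ?_)
    (hfu.norm.const_mul c) (fun K => Filter.Eventually.of_forall fun Ξ => ?_)
    (Filter.Eventually.of_forall fun Ξ => ?_)
  · exact ((contDiff_cutoff.continuous.comp (continuous_const_smul _)).mul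
      ((ha.mul hfc).mul (continuous_phase_right X))).aestronglyMeasurable
  · rw [norm_mul, norm_mul, norm_mul, norm_exp_I_mul, mul_one]
    calc _ ≤ 1 * (‖a X Ξ‖ * ‖fourier u Ξ‖) := by
          gcongr
          exact norm_cutoff_le _
      _ ≤ _ := by
          rw [one_mul]
          gcongr
          exact hc Ξ
  · refine tendsto_const_nhds.congr' ?_
    have h2 : Filter.Tendsto (fun K : ℕ => (2 : ℝ) ^ K) Filter.atTop Filter.atTop :=
      tendsto_pow_atTop_atTop_of_one_lt one_lt_two
    filter_upwards [h2.eventually_ge_atTop ‖Ξ‖] with K hK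
    rw [cutoff_eq_one, one_mul]
    rw [norm_smul, norm_inv, norm_pow, Real.norm_ofNat, inv_mul_eq_div,
      div_le_one (by positivity)]
    exact hK

lemma enorm_pseudoOp_le_tsum {a : Space n N → Space n N → ℂ} {X : Space n N} {c : ℝ}
    (ha : Continuous (a X)) (hc : ∀ Ξ, ‖a X Ξ‖ ≤ c) (u : 𝓢(Space n N, ℂ)) :
    ‖pseudoOp a u X‖ₑ ≤ ∑' k, ∫⁻ Y, ‖dyadicKernel (a X) k (X - Y)‖ₑ * ‖u Y‖ₑ := by
  refine le_of_tendsto ((tendsto_sum_dyadicKernel ha hc u).enorm)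
    (Filter.Eventually.of_forall fun K => ?_)
  refine (enorm_sum_le _ _).trans ((Finset.sum_le_sum fun k _ => ?_).trans (ENNReal.sum_le_tsum _))
  refine (enorm_integral_le_lintegral_enorm _).trans (le_of_eq ?_)
  simp only [enorm_mul]

/-- The pointwise estimate: each dyadic piece is dominated by iterated local averages on the scale
`2^{-kρ}`, with a constant that gains a power of `2^{-k}`. -/
lemma exists_pseudoOp_bound {n : ℕ} (hn : 1 ≤ n) (N : ℕ) {p : Fin N → ℝ}
    (hp : ∀ j, p j ∈ Set.Icc (1 : ℝ) 2) {m ρ : ℝ} (hρ : ρ ∈ Set.Icc (0 : ℝ) 1)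
    (hm : m < (ρ - 1) * ∑ j, (n : ℝ) / p j) :
    ∃ C : ℝ≥0∞, C ≠ ⊤ ∧ ∀ (a : Space n N → Space n N → ℂ) (X : Space n N) (c : ℝ), 0 ≤ c →
      ContDiff ℝ ∞ (a X) → SymbolBounds m ρ (2 * (coordList n N).length) c (a X) →
      ∀ u : 𝓢(Space n N, ℂ), ‖pseudoOp a u X‖ₑ ≤
        C * ENNReal.ofReal c * iteratedMaximal p (fun Y => ‖u Y‖ₑ) X := by
  have hp0 : ∀ j, 0 < p j := fun j => lt_of_lt_of_le one_pos (hp j).1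
  have hs : 0 ≤ ∑ j, (n : ℝ) / p j :=
    Finset.sum_nonneg fun j _ => div_nonneg (Nat.cast_nonneg n) (hp0 j).le
  have hm0 : m ≤ 0 := hm.le.trans (mul_nonpos_of_nonpos_of_nonneg (by linarith [hρ.2]) hs)
  obtain ⟨C, hC, hker⟩ := exists_dyadic_kernel_bound n N m hρ hp
  set V : ℝ≥0∞ := 2 * 4 ^ n * volume (Metric.ball (0 : EuclideanSpace ℝ (Fin n)) 1) with hV
  have hVt : V ≠ ⊤ := ENNReal.mul_ne_top (by finiteness) measure_ball_lt_top.ne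
  set D : ℝ≥0∞ := ∏ j, V ^ (1 / p j) with hD
  have hDt : D ≠ ⊤ := ENNReal.prod_ne_top fun j _ =>
    ENNReal.rpow_ne_top_of_nonneg (by have := hp0 j; positivity) hVt
  set G : ℝ≥0∞ := ∑' k : ℕ, ENNReal.ofReal ((2 : ℝ) ^ (m - (ρ - 1) * ∑ j, (n : ℝ) / p j)) ^ k
    with hG
  have hGt : G ≠ ⊤ := tsum_gain_ne_top (by linarith)
  refine ⟨C * G * D, by finiteness, fun a X c hc ha hb u => ?_⟩
  refine (enorm_pseudoOp_le_tsum ha.continuous (norm_le_of_symbolBounds hm0 hc hb) u).trans ?_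
  calc _ ≤ ∑' k, C * ENNReal.ofReal c *
        (ENNReal.ofReal ((2 : ℝ) ^ (m - (ρ - 1) * ∑ j, (n : ℝ) / p j)) ^ k * D) *
          iteratedMaximal p (fun Y => ‖u Y‖ₑ) X := by
        refine ENNReal.tsum_le_tsum fun k => ?_
        refine (hker (a X) c hc ha hb k (fun Y => ‖u Y‖ₑ) u.continuous.measurable.enorm X).trans ?_
        rw [← rpow_gain k m ρ, mul_assoc (ENNReal.ofReal _) (ENNReal.ofReal _) D,
          ← prod_rpow_scale (by positivity) hp0, ← mul_assoc, mul_assoc _ (List.prod _)]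
        exact mul_le_mul_right (iterNorm_decay_le_maximal hn _ hp0 (by positivity) _ X) _
    _ = _ := by
        rw [ENNReal.tsum_mul_right, ENNReal.tsum_mul_left, ENNReal.tsum_mul_right]
        ring

end Pointwise

/-! ### From multi-indices to symbol estimates at a fixed point -/

section Multi

variable {n N : ℕ}

/-- The multi-indices with all entries at most `M`. -/
def boxIndices (n N M : ℕ) : Finset (MultiIndex n N) :=
  Fintype.piFinset fun _ => Finset.range (M + 1)

/-- The symbol estimates for finitely many multi-indices control the derivatives of order at most `M`
in any order, with the sum of the constants as a single constant. -/
lemma symbolBounds_of_multiDeriv {m ρ : ℝ} {M : ℕ} {b : Space n N → ℂ} (hb : ContDiff ℝ ∞ b)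
    (c : boxIndices n N M → ℝ)
    (h : ∀ (α : boxIndices n N M) (Ξ : Space n N), ‖multiDeriv (α : MultiIndex n N) b Ξ‖ ≤
      c α * bracket Ξ ^ (m - ρ * ((α : MultiIndex n N).length : ℝ))) :
    SymbolBounds m ρ M (∑ α, |c α|) b := by
  intro w hw Ξ
  have hmem : (fun i => w.count i : MultiIndex n N) ∈ boxIndices n N M := by
    simp only [boxIndices, Fintype.mem_piFinset, Finset.mem_range]
    intro i
    have := w.count_le_length (a := i)
    omega
  rw [foldr_partialDeriv_eq_multiDeriv hb]
  have h1 := h ⟨_, hmem⟩ Ξ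
  simp only [length_count] at h1
  refine h1.trans (mul_le_mul_of_nonneg_right ?_
    (Real.rpow_nonneg (by linarith [one_le_bracket Ξ]) _))
  exact (le_abs_self _).trans
    (Finset.single_le_sum (f := fun α => |c α|) (fun _ _ => abs_nonneg _) (Finset.mem_univ _))

lemma continuous_multiDeriv {b : Space n N → ℂ} (hb : ContDiff ℝ ∞ b) (α : MultiIndex n N) :
    Continuous (multiDeriv α b) := by
  rw [multiDeriv_eq_foldr]
  exact (contDiff_foldr_partialDeriv hb _).continuous

lemma continuous_bracket_rpow (e : ℝ) : Continuous fun Ξ : Space n N => bracket Ξ ^ e := by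
  refine Continuous.rpow_const ?_ fun Ξ => Or.inl (by linarith [one_le_bracket Ξ])
  unfold bracket
  fun_prop

/-- The exceptional null sets of the symbol estimates can be chosen independent of `Ξ`. -/
lemma ae_forall_of_symbolBound {m ρ : ℝ} {a : Space n N → Space n N → ℂ}
    (ha : ∀ᵐ X : Space n N, ContDiff ℝ ∞ (a X)) {F : Finset (MultiIndex n N)} (c : F → ℝ)
    (h : ∀ α : F, SymbolBound m ρ a α (c α)) :
    ∀ᵐ X : Space n N, ContDiff ℝ ∞ (a X) ∧ ∀ (α : F) (Ξ : Space n N),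
      ‖multiDeriv (α : MultiIndex n N) (a X) Ξ‖ ≤
        c α * bracket Ξ ^ (m - ρ * ((α : MultiIndex n N).length : ℝ)) := by
  have h1 : ∀ᵐ X : Space n N, ∀ (α : F) (i : ℕ),
      ‖multiDeriv (α : MultiIndex n N) (a X) (TopologicalSpace.denseSeq (Space n N) i)‖ ≤
        c α * bracket (TopologicalSpace.denseSeq (Space n N) i) ^
          (m - ρ * ((α : MultiIndex n N).length : ℝ)) :=
    ae_all_iff.2 fun α => ae_all_iff.2 fun i => h α _
  filter_upwards [ha, h1] with X hX hb
  refine ⟨hX, fun α Ξ => ?_⟩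
  have hcl : IsClosed {Ξ : Space n N | ‖multiDeriv (α : MultiIndex n N) (a X) Ξ‖ ≤
      c α * bracket Ξ ^ (m - ρ * ((α : MultiIndex n N).length : ℝ))} :=
    isClosed_le (continuous_multiDeriv hX _).norm
      (continuous_const.mul (continuous_bracket_rpow _))
  have hd := (TopologicalSpace.denseRange_denseSeq (Space n N)).closure_eq
  have hsub : closure (Set.range (TopologicalSpace.denseSeq (Space n N))) ⊆ _ :=
    closure_minimal (by rintro _ ⟨i, rfl⟩; exact hb α i) hcl
  rw [hd] at hsub
  exact hsub (Set.mem_univ Ξ)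

end Multi

/-! ### Density of Schwartz functions in mixed norm spaces -/

section Density

variable {n N : ℕ} {l : List (Fin N)} {q : Fin N → ℝ}

/-- Iterated norms of bounded functions are bounded if the weights have bounded mass. -/
lemma exists_iterNorm_le (l : List (Fin N)) (hq : ∀ j, 0 < q j)
    {κ : Fin N → EuclideanSpace ℝ (Fin n) → EuclideanSpace ℝ (Fin n) → ℝ≥0∞}
    {D : ℝ≥0∞} (hD : D ≠ ⊤) (hκ : ∀ j x, ∫⁻ y, κ j x y ≤ D) {f : Space n N → ℝ≥0∞} {c : ℝ≥0∞}
    (hc : c ≠ ⊤) (hf : ∀ X, f X ≤ c) : ∃ c' : ℝ≥0∞, c' ≠ ⊤ ∧ ∀ X, iterNorm l q κ f X ≤ c' := by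
  induction l generalizing f c with
  | nil => exact ⟨c, hc, hf⟩
  | cons j l ih =>
    have hqj := hq j
    refine ih (c := (D * c ^ q j) ^ (1 / q j)) ?_ fun X => ?_
    · exact ENNReal.rpow_ne_top_of_nonneg (by positivity)
        (ENNReal.mul_ne_top hD (ENNReal.rpow_ne_top_of_nonneg hqj.le hc))
    · refine ENNReal.rpow_le_rpow ?_ (by positivity)
      calc _ ≤ ∫⁻ y, κ j (X j) y * c ^ q j := by
            gcongr with y
            exact hf _
        _ = (∫⁻ y, κ j (X j) y) * c ^ q j :=
            lintegral_mul_const' _ _ (ENNReal.rpow_ne_top_of_nonneg hqj.le hc)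
        _ ≤ _ := by
            gcongr
            exact hκ j _

lemma iterNorm_prod_decay_ne_top (hn : 1 ≤ n) (hl : l.Nodup) (hq : ∀ j, 1 ≤ q j) (X : Space n N) :
    iterNorm l q (fun _ _ _ => 1) (fun Y => (l.map fun j => decay n 1 (Y j)).prod) X ≠ ⊤ := by
  have hq0 : ∀ j, 0 < q j := fun j => one_pos.trans_le (hq j)
  have hle : ∀ (j : Fin N) (_x : EuclideanSpace ℝ (Fin n)),
      ∫⁻ y, decay n 1 y ^ q j ≤ ∫⁻ y, decay n 1 y := by
    intro j _
    refine lintegral_mono fun y => ?_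
    calc decay n 1 y ^ q j ≤ decay n 1 y ^ (1 : ℝ) :=
          ENNReal.rpow_le_rpow_of_exponent_ge (decay_le_one 1 y) (hq j)
      _ = _ := ENNReal.rpow_one _
  obtain ⟨c, hc, h⟩ := exists_iterNorm_le (n := n) (N := N) l hq0
    (κ := fun j _ y => decay n 1 y ^ q j) (f := fun _ => 1)
    (lintegral_decay_one_ne_top hn) hle ENNReal.one_ne_top (fun _ => le_rfl)
  rw [iterNorm_one_mul_eq (f := fun _ => 1) hl hq0 (fun _ _ y => decay n 1 y)
    (fun _ _ y => decay_ne_top 1 y) (κ := fun j _ y => decay n 1 y ^ q j) (fun _ _ _ => rfl)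
    (fun Y _ => by simp)]
  exact ne_top_of_le_ne_top hc (h X)

/-- Functions of sufficient polynomial decay are dominated by a product of integrable functions of the
blocks. -/
lemma enorm_le_prod_decay (hl : l.Nodup) {f : Space n N → ℂ} {A : ℝ} (hA : 0 ≤ A)
    (hf : ∀ X, (1 + ‖X‖) ^ (2 * n * N) * ‖f X‖ ≤ A) (X : Space n N) :
    ‖f X‖ₑ ≤ ENNReal.ofReal A * (l.map fun j => decay n 1 (X j)).prod := by
  have hX := norm_nonneg X
  have h1 : ∀ l : List (Fin N), (l.map fun j => decay n 1 (X j)).prod =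
      ENNReal.ofReal ((l.map fun j => ((1 + ‖X j‖ ^ 2) ^ n)⁻¹).prod) := by
    intro l
    induction l with
    | nil => simp
    | cons j l ih =>
      simp only [List.map_cons, List.prod_cons]
      rw [ih, ENNReal.ofReal_mul (by positivity), decay, one_smul]
  have h2 : ∀ l : List (Fin N), (((1 + ‖X‖) ^ (2 * n)) ^ l.length)⁻¹ ≤
      (l.map fun j => ((1 + ‖X j‖ ^ 2) ^ n)⁻¹).prod := by
    intro l
    induction l with
    | nil => simp
    | cons j l ih =>
      simp only [List.map_cons, List.prod_cons, List.length_cons]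
      rw [pow_succ', mul_inv]
      refine mul_le_mul ?_ ih (by positivity) (by positivity)
      rw [pow_mul]
      gcongr
      have := norm_le_pi_norm X j
      nlinarith [norm_nonneg (X j)]
  have h3 : l.length ≤ N := by simpa using hl.length_le_card
  rw [h1, ← ENNReal.ofReal_mul hA, ← ofReal_norm]
  refine ENNReal.ofReal_le_ofReal ?_
  calc ‖f X‖ ≤ A * (((1 + ‖X‖) ^ (2 * n)) ^ N)⁻¹ := by
        rw [← div_eq_mul_inv, le_div_iff₀ (by positivity), ← pow_mul, mul_comm]
        exact hf X
    _ ≤ A * (((1 + ‖X‖) ^ (2 * n)) ^ l.length)⁻¹ := by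
        gcongr
        exact one_le_pow₀ (by linarith)
    _ ≤ _ := mul_le_mul_of_nonneg_left (h2 l) hA

lemma iterNorm_ne_top_of_decay (hn : 1 ≤ n) (hl : l.Nodup) (hq : ∀ j, 1 ≤ q j) {f : Space n N → ℂ}
    {A : ℝ} (hf : ∀ X, (1 + ‖X‖) ^ (2 * n * N) * ‖f X‖ ≤ A) (X : Space n N) :
    iterNorm l q (fun _ _ _ => 1) (fun X => ‖f X‖ₑ) X ≠ ⊤ := by
  have hA : 0 ≤ A := le_trans (by positivity) (hf 0)
  have h1 := iterNorm_mono (n := n) (κ := fun _ _ _ => 1) l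
    (fun j => zero_le_one.trans (hq j)) (enorm_le_prod_decay hl hA hf) X
  rw [iterNorm_const_mul l (fun j => one_pos.trans_le (hq j)) ENNReal.ofReal_ne_top] at h1
  exact ne_top_of_le_ne_top
    (ENNReal.mul_ne_top ENNReal.ofReal_ne_top (iterNorm_prod_decay_ne_top hn hl hq X)) h1

/-- Schwartz functions have finite mixed norm. -/
lemma mixedNorm_schwartz_ne_top (hn : 1 ≤ n) (hl : l.Nodup) (hq : ∀ j, 1 ≤ q j)
    (u : 𝓢(Space n N, ℂ)) : mixedNorm l q u ≠ ⊤ := by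
  rw [mixedNorm_eq_iterNorm]
  have h := fun X => SchwartzMap.one_add_le_sup_seminorm_apply (𝕜 := ℝ) (m := (2 * n * N, 0))
    (k := 2 * n * N) (n := 0) le_rfl le_rfl u X
  simp only [norm_iteratedFDeriv_zero] at h
  exact iterNorm_ne_top_of_decay hn hl hq h 0

lemma mixedNorm_congr_ae (hl : ∀ j, j ∈ l) {f g : Space n N → ℂ} (h : f =ᵐ[volume] g) :
    mixedNorm l q f = mixedNorm l q g := by
  rw [mixedNorm_eq_iterNorm, mixedNorm_eq_iterNorm]
  exact iterNorm_eq_of_ae_eq hl (h.mono fun X hX => by simp only [hX])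

lemma mixedNorm_add_le (hl : ∀ j, j ∈ l) (hq : ∀ j, 1 ≤ q j) {f g : Space n N → ℂ}
    (hf : AEStronglyMeasurable f volume) (hg : AEStronglyMeasurable g volume) :
    mixedNorm l q (fun X => f X + g X) ≤ mixedNorm l q f + mixedNorm l q g := by
  obtain ⟨f', hf', hff'⟩ := hf
  obtain ⟨g', hg', hgg'⟩ := hg
  rw [mixedNorm_congr_ae hl hff', mixedNorm_congr_ae hl hgg',
    mixedNorm_congr_ae hl (g := fun X => f' X + g' X)
      (by filter_upwards [hff', hgg'] with X h1 h2; rw [h1, h2])]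
  simp only [mixedNorm_eq_iterNorm]
  refine le_trans (iterNorm_mono l (fun j => zero_le_one.trans (hq j)) (fun X => ?_) 0)
    (iterNorm_add_le l hq hf'.measurable.enorm hg'.measurable.enorm 0)
  exact enorm_add_le _ _

lemma MemMixed.mixedNorm_ne_top (hn : 1 ≤ n) (hl : l.Nodup) (hl' : ∀ j, j ∈ l) (hq : ∀ j, 1 ≤ q j)
    {f : Space n N → ℂ} (hf : MemMixed l q f) : mixedNorm l q f ≠ ⊤ := by
  obtain ⟨u, hu⟩ := hf.2 1 one_pos
  have h := mixedNorm_add_le hl' hq (hf.1.sub u.continuous.aestronglyMeasurable)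
    u.continuous.aestronglyMeasurable
  simp only [Pi.sub_apply, sub_add_cancel] at h
  refine ne_top_of_le_ne_top (ENNReal.add_ne_top.2 ⟨?_, mixedNorm_schwartz_ne_top hn hl hq u⟩) h
  exact ne_top_of_le_ne_top ENNReal.one_ne_top hu

/-- Bounded functions of bounded support are approximated by mollification. -/
lemma exists_schwartz_of_bounded (hn : 1 ≤ n) (hl : l.Nodup) (hl' : ∀ j, j ∈ l)
    (hq : ∀ j, 1 ≤ q j) {g : Space n N → ℂ} (hg : StronglyMeasurable g) {R : ℝ}
    (hR : ∀ X, ‖g X‖ ≤ R) (hsupp : ∀ X, R < ‖X‖ → g X = 0) {ε : ℝ≥0∞} (hε : 0 < ε) :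
    ∃ u : 𝓢(Space n N, ℂ), mixedNorm l q (fun X => g X - u X) ≤ ε := by
  have hR0 : 0 ≤ R := (norm_nonneg _).trans (hR 0)
  have : (volume : Measure (Space n N)).IsAddHaarMeasure := inferInstance
  have hgi : LocallyIntegrable g volume := by
    refine Integrable.locallyIntegrable ?_
    have h1 : IntegrableOn g (Metric.closedBall 0 R) volume :=
      Measure.integrableOn_of_bounded (M := R) (isCompact_closedBall _ _).measure_lt_top.ne
        hg.aestronglyMeasurable (Filter.Eventually.of_forall fun X => hR X)
    refine (integrableOn_iff_integrable_of_support_subset fun X hX => ?_).1 h1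
    by_contra hcon
    exact hX (hsupp X (by simpa using hcon))
  set φ : ℕ → ContDiffBump (0 : Space n N) := fun k =>
    ⟨1 / ((k : ℝ) + 1), 2 * (1 / ((k : ℝ) + 1)), by positivity, by
      have : 0 < 1 / ((k : ℝ) + 1) := by positivity
      linarith⟩ with hφ
  have hφ2 : ∀ k, (φ k).rOut ≤ 2 := by
    intro k
    have : 1 / ((k : ℝ) + 1) ≤ 1 := by
      rw [div_le_one (by positivity)]
      linarith [Nat.cast_nonneg (α := ℝ) k]
    simp only [hφ]
    linarith
  set v : ℕ → Space n N → ℂ := fun k =>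
    convolution ((φ k).normed volume) g (ContinuousLinearMap.lsmul ℝ ℝ) volume with hv
  have hlim : ∀ᵐ X, Filter.Tendsto (fun k => v k X) Filter.atTop (nhds (g X)) := by
    refine ContDiffBump.ae_convolution_tendsto_right_of_locallyIntegrable (K := 2) ?_
      (Filter.Eventually.of_forall fun k => le_rfl) hgi
    simpa [hφ] using (tendsto_one_div_add_atTop_nhds_zero_nat (𝕜 := ℝ)).const_mul 2
  have hdist : ∀ k X, dist (v k X) (g X) ≤ 2 * R := fun k X =>
    (φ k).dist_normed_convolution_le hg.aestronglyMeasurable fun Y _ => by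
      rw [dist_eq_norm]
      linarith [norm_sub_le (g Y) (g X), hR X, hR Y]
  have hzero : ∀ k X, R + 2 < ‖X‖ → v k X = 0 := by
    intro k X hX
    have h0 : g X = 0 := hsupp X (by linarith)
    have h1 : dist (v k X) (g X) ≤ 0 :=
      (φ k).dist_normed_convolution_le hg.aestronglyMeasurable fun Y hY => by
        have h2 : ‖X‖ ≤ ‖Y‖ + dist Y X := by
          rw [dist_comm, dist_eq_norm]
          linarith [norm_sub_norm_le X Y]
        have h3 : dist Y X < 2 := (Metric.mem_ball.1 hY).trans_le (hφ2 k)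
        rw [h0, hsupp Y (by linarith), dist_self]
    rw [h0, dist_zero_right] at h1
    simpa using h1
  have hvs : ∀ k, ContDiff ℝ ∞ (v k) := fun k =>
    HasCompactSupport.contDiff_convolution_left (n := ⊤) _ (φ k).hasCompactSupport_normed
      (φ k).contDiff_normed hgi
  -- all mollifications are dominated by one bounded function of bounded support
  set G : Space n N → ℂ := (Metric.closedBall (0 : Space n N) (R + 2)).indicator
    (fun _ => ((2 * R : ℝ) : ℂ)) with hG
  have hGm : Measurable G := measurable_const.indicator Metric.isClosed_closedBall.measurableSet
  have hGfin : iterNorm l q (fun _ _ _ => 1) (fun X => ‖G X‖ₑ) 0 < ⊤ := by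
    refine (iterNorm_ne_top_of_decay hn hl hq
      (A := (1 + (R + 2)) ^ (2 * n * N) * (2 * R)) (fun X => ?_) 0).lt_top
    by_cases hX : X ∈ Metric.closedBall (0 : Space n N) (R + 2)
    · rw [hG, Set.indicator_of_mem hX, Complex.norm_real, Real.norm_of_nonneg (by positivity)]
      have := mem_closedBall_zero_iff.1 hX
      gcongr
    · rw [hG, Set.indicator_of_notMem hX, norm_zero, mul_zero]
      positivity
  have ht := tendsto_iterNorm_zero_of_mem (h := fun k X => ‖g X - v k X‖ₑ) hl'
    (fun j => one_pos.trans_le (hq j)) hGm.enorm hGfin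
    (fun k => (hg.measurable.sub (hvs k).continuous.measurable).enorm) (fun k X => ?_) ?_
  · obtain ⟨k, hk⟩ := (ht.eventually_le_const hε).exists
    have hcs := hasCompactSupport_of_zero (hzero k)
    refine ⟨hcs.toSchwartzMap (hvs k), ?_⟩
    rw [mixedNorm_eq_iterNorm]
    exact hk
  · by_cases hX : X ∈ Metric.closedBall (0 : Space n N) (R + 2)
    · simp only [hG, Set.indicator_of_mem hX]
      rw [← ofReal_norm, ← ofReal_norm, Complex.norm_real, Real.norm_of_nonneg (by positivity)]
      refine ENNReal.ofReal_le_ofReal ?_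
      rw [← dist_eq_norm, dist_comm]
      exact hdist k X
    · have hX' : R + 2 < ‖X‖ := by simpa using hX
      simp [hzero k X hX', hsupp X (by linarith)]
  · filter_upwards [hlim] with X hX
    have := (tendsto_const_nhds (x := g X)).sub hX
    simpa using this.enorm

/-- For exponents in `[1, ∞)`, the closure of the Schwartz class in the mixed norm consists of all
measurable functions of finite mixed norm. -/
lemma memMixed_of_ne_top (hn : 1 ≤ n) (hl : l.Nodup) (hl' : ∀ j, j ∈ l) (hq : ∀ j, 1 ≤ q j)
    {f : Space n N → ℂ} (hf : AEStronglyMeasurable f volume) (hfin : mixedNorm l q f ≠ ⊤) :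
    MemMixed l q f := by
  refine ⟨hf, fun ε hε => ?_⟩
  obtain ⟨g, hg, hfg⟩ := hf
  rw [mixedNorm_congr_ae hl' hfg, mixedNorm_eq_iterNorm] at hfin
  set s : ℕ → Set (Space n N) := fun k => {X | ‖X‖ ≤ k ∧ ‖g X‖ ≤ k} with hs
  have hsm : ∀ k, MeasurableSet (s k) := fun k =>
    (measurableSet_le measurable_norm measurable_const).inter
      (measurableSet_le hg.norm.measurable measurable_const)
  set h : ℕ → Space n N → ℂ := fun k => (s k).indicator g with hh
  have hhm : ∀ k, StronglyMeasurable (h k) := fun k => hg.indicator (hsm k)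
  have ht := tendsto_iterNorm_zero_of_mem (h := fun k X => ‖g X - h k X‖ₑ) hl'
    (fun j => one_pos.trans_le (hq j)) hg.measurable.enorm hfin.lt_top
    (fun k => (hg.sub (hhm k)).measurable.enorm) (fun k X => ?_)
    (Filter.Eventually.of_forall fun X => ?_)
  · have hε2 : 0 < ε / 2 := ENNReal.half_pos hε.ne'
    obtain ⟨k, hk⟩ := (ht.eventually_le_const hε2).exists
    have hbd : ∀ X, ‖h k X‖ ≤ k := by
      intro X
      by_cases hX : X ∈ s k
      · simp only [hh, Set.indicator_of_mem hX]
        exact hX.2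
      · simp [hh, Set.indicator_of_notMem hX]
    obtain ⟨u, hu⟩ := exists_schwartz_of_bounded hn hl hl' hq (hhm k) hbd
      (fun X hX => Set.indicator_of_notMem (fun hX' => absurd hX'.1 (not_le.2 hX)) _) hε2
    refine ⟨u, ?_⟩
    have h1 := mixedNorm_add_le (q := q) hl' hq (f := fun X => g X - h k X)
      (g := fun X => h k X - u X) (hg.sub (hhm k)).aestronglyMeasurable
      ((hhm k).aestronglyMeasurable.sub u.continuous.aestronglyMeasurable)
    simp only [sub_add_sub_cancel] at h1
    rw [mixedNorm_congr_ae hl' (g := fun X => g X - u X)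
      (hfg.mono fun X hX => by simp only [hX])]
    refine h1.trans ((add_le_add ?_ hu).trans (ENNReal.add_halves ε).le)
    rw [mixedNorm_eq_iterNorm]
    exact hk
  · by_cases hX : X ∈ s k
    · simp [hh, Set.indicator_of_mem hX]
    · simp [hh, Set.indicator_of_notMem hX]
  · refine tendsto_const_nhds.congr' ?_
    filter_upwards [Filter.eventually_ge_atTop ⌈max ‖X‖ ‖g X‖⌉₊] with k hk
    have h1 : max ‖X‖ ‖g X‖ ≤ k := (Nat.le_ceil _).trans (by exact_mod_cast hk)
    have hX : X ∈ s k := ⟨(le_max_left _ _).trans h1, (le_max_right _ _).trans h1⟩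
    simp [hh, Set.indicator_of_mem hX]

end Density

/-! ### Boundedness between mixed norm spaces -/

section Bounded

variable {n N : ℕ}

lemma foldr_partialDeriv_zero (w : List (Fin N × Fin n)) :
    w.foldr partialDeriv (fun _ => (0 : ℂ)) = fun _ => 0 := by
  induction w with
  | nil => rfl
  | cons i w ih =>
    rw [List.foldr_cons, ih]
    funext Ξ
    simp [partialDeriv]

/-- A symbol agrees, off a null set of points `X`, with a jointly measurable one that satisfies the
symbol estimates everywhere. -/
lemma exists_measurable_symbol {m ρ : ℝ} {a : Space n N → Space n N → ℂ} (ha : IsSymbol m ρ a)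
    {M : ℕ} (c : boxIndices n N M → ℝ) (h : ∀ α : boxIndices n N M, SymbolBound m ρ a α (c α)) :
    ∃ a' : Space n N → Space n N → ℂ, StronglyMeasurable (Function.uncurry a') ∧
      (∀ X, ContDiff ℝ ∞ (a' X)) ∧ (∀ X, SymbolBounds m ρ M (∑ α, |c α|) (a' X)) ∧
      ∀ᵐ X, a' X = a X := by
  classical
  -- by continuity in `Ξ`, measurability in `X` is only needed for countably many `Ξ`
  set d := TopologicalSpace.denseSeq (Space n N) with hd
  have h1 : ∀ᵐ X : Space n N, ∀ i : ℕ, a X (d i) = (ha.measurable (d i)).mk _ X :=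
    ae_all_iff.2 fun i => (ha.measurable (d i)).ae_eq_mk
  have h2 := (ae_forall_of_symbolBound ha.smooth c h).and h1
  obtain ⟨t, hst, ht, ht0⟩ := exists_measurable_superset_of_null (ae_iff.1 h2)
  have hgood : ∀ X ∉ t, (ContDiff ℝ ∞ (a X) ∧ ∀ (α : boxIndices n N M) (Ξ : Space n N),
      ‖multiDeriv (α : MultiIndex n N) (a X) Ξ‖ ≤
        c α * bracket Ξ ^ (m - ρ * ((α : MultiIndex n N).length : ℝ))) ∧
      ∀ i : ℕ, a X (d i) = (ha.measurable (d i)).mk _ X := by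
    intro X hX
    by_contra hcon
    exact hX (hst hcon)
  have hc0 : 0 ≤ ∑ α, |c α| := Finset.sum_nonneg fun _ _ => abs_nonneg _
  set a' : Space n N → Space n N → ℂ := fun X => if X ∈ t then fun _ => 0 else a X with ha'
  have hsm : ∀ X, ContDiff ℝ ∞ (a' X) := by
    intro X
    by_cases hX : X ∈ t
    · simp only [ha', if_pos hX]
      exact contDiff_const
    · simp only [ha', if_neg hX]
      exact (hgood X hX).1.1
  refine ⟨a', ?_, hsm, fun X => ?_, ?_⟩
  · have hdense : ∀ i, StronglyMeasurable fun X => a' X (d i) := by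
      intro i
      have h3 : (fun X => a' X (d i)) = tᶜ.indicator ((ha.measurable (d i)).mk _) := by
        funext X
        by_cases hX : X ∈ t
        · simp [ha', hX]
        · simp [ha', hX, (hgood X hX).2 i]
      rw [h3]
      exact (ha.measurable (d i)).stronglyMeasurable_mk.indicator ht.compl
    have hall : ∀ Ξ, StronglyMeasurable fun X => a' X Ξ := by
      intro Ξ
      have hmem : Ξ ∈ closure (Set.range d) := by
        rw [(TopologicalSpace.denseRange_denseSeq (Space n N)).closure_eq]
        trivial
      obtain ⟨x, hx, hxt⟩ := mem_closure_iff_seq_limit.1 hmem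
      refine stronglyMeasurable_of_tendsto (f := fun k X => a' X (x k)) Filter.atTop (fun k => ?_)
        (tendsto_pi_nhds.2 fun X => ((hsm X).continuous.tendsto Ξ).comp hxt)
      obtain ⟨i, hi⟩ := hx k
      rw [← hi]
      exact hdense i
    have h4 := stronglyMeasurable_uncurry_of_continuous_of_stronglyMeasurable
      (u := fun Ξ X => a' X Ξ) (fun X => (hsm X).continuous) hall
    exact h4.comp_measurable measurable_swap
  · by_cases hX : X ∈ t
    · simp only [ha', if_pos hX]
      intro w _ Ξ
      rw [foldr_partialDeriv_zero, norm_zero]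
      exact mul_nonneg hc0 (Real.rpow_nonneg (by linarith [one_le_bracket Ξ]) _)
    · simp only [ha', if_neg hX]
      exact symbolBounds_of_multiDeriv (hgood X hX).1.1 c (hgood X hX).1.2
  · filter_upwards [measure_eq_zero_iff_ae_notMem.1 ht0] with X hX
    simp [ha', hX]

lemma stronglyMeasurable_dyadicKernel {a : Space n N → Space n N → ℂ}
    (ha : StronglyMeasurable (Function.uncurry a)) (k : ℕ) :
    StronglyMeasurable fun z : Space n N × Space n N => dyadicKernel (a z.1) k (z.1 - z.2) := by
  refine StronglyMeasurable.integral_prod_right (f := fun (z : Space n N × Space n N) Ξ =>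
    a z.1 Ξ * dyadicPiece n N k Ξ * Complex.exp (Complex.I * (dot (z.1 - z.2) Ξ : ℂ))) ?_
  have h1 : Continuous fun w : (Space n N × Space n N) × Space n N => dot (w.1.1 - w.1.2) w.2 :=
    (continuous_dot (n := n) (N := N)).comp
      (((continuous_fst.comp continuous_fst).sub (continuous_snd.comp continuous_fst)).prodMk
        continuous_snd)
  have h2 : Continuous fun w : (Space n N × Space n N) × Space n N =>
      Complex.exp (Complex.I * (dot (w.1.1 - w.1.2) w.2 : ℂ)) := by fun_prop
  have h3 : Continuous fun w : (Space n N × Space n N) × Space n N => dyadicPiece n N k w.2 :=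
    (contDiff_dyadicPiece k).continuous.comp continuous_snd
  exact ((ha.comp_measurable ((measurable_fst.comp measurable_fst).prodMk
    measurable_snd)).mul h3.stronglyMeasurable).mul h2.stronglyMeasurable

/-- The sum over all dyadic pieces of the integrals of `f` against the absolute values of the
kernels. Where it is finite, the operator is given by absolutely convergent integrals. -/
noncomputable def absKernelSum (a : Space n N → Space n N → ℂ) (f : Space n N → ℝ≥0∞)
    (X : Space n N) : ℝ≥0∞ :=
  ∑' k, ∫⁻ Y, ‖dyadicKernel (a X) k (X - Y)‖ₑ * f Y

/-- The operator defined by summing the dyadic pieces, for functions that need not be Schwartz. -/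
noncomputable def kernelOp (a : Space n N → Space n N → ℂ) (f : Space n N → ℂ)
    (X : Space n N) : ℂ :=
  ∑' k, ∫ Y, dyadicKernel (a X) k (X - Y) * f Y

lemma measurable_absKernelSum {a : Space n N → Space n N → ℂ}
    (ha : StronglyMeasurable (Function.uncurry a)) {f : Space n N → ℝ≥0∞} (hf : Measurable f) :
    Measurable (absKernelSum a f) := by
  refine Measurable.tsum fun k => ?_
  refine Measurable.lintegral_prod_right' (f := fun z : Space n N × Space n N =>
    ‖dyadicKernel (a z.1) k (z.1 - z.2)‖ₑ * f z.2) ?_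
  exact (stronglyMeasurable_dyadicKernel ha k).measurable.enorm.mul (hf.comp measurable_snd)

lemma kernelOp_congr_ae (a : Space n N → Space n N → ℂ) {f g : Space n N → ℂ}
    (h : f =ᵐ[volume] g) : kernelOp a f = kernelOp a g := by
  funext X
  simp only [kernelOp]
  congr 1
  funext k
  exact integral_congr_ae (h.mono fun Y hY => by simp only [hY])

lemma integrable_dyadicKernel_mul {a : Space n N → Space n N → ℂ}
    (ha : ∀ X, Continuous (a X)) {f : Space n N → ℂ} (hf : AEStronglyMeasurable f volume)
    {X : Space n N} (h : absKernelSum a (fun Y => ‖f Y‖ₑ) X ≠ ⊤) (k : ℕ) :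
    Integrable fun Y => dyadicKernel (a X) k (X - Y) * f Y := by
  refine ⟨?_, ?_⟩
  · have h1 : Continuous fun Y => dyadicKernel (a X) k (X - Y) :=
      (continuous_invFourier (integrable_mul_dyadicPiece (ha X) k)).comp
        (continuous_const.sub continuous_id)
    exact h1.aestronglyMeasurable.mul hf
  · rw [hasFiniteIntegral_iff_enorm]
    simp only [enorm_mul]
    exact (ENNReal.ne_top_of_tsum_ne_top h k).lt_top

lemma tsum_enorm_integral_le (a : Space n N → Space n N → ℂ) (f : Space n N → ℂ)
    (X : Space n N) :
    ∑' k, ‖∫ Y, dyadicKernel (a X) k (X - Y) * f Y‖ₑ ≤ absKernelSum a (fun Y => ‖f Y‖ₑ) X := by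
  refine ENNReal.tsum_le_tsum fun k => (enorm_integral_le_lintegral_enorm _).trans (le_of_eq ?_)
  simp only [enorm_mul]

lemma summable_kernelOp {a : Space n N → Space n N → ℂ} {f : Space n N → ℂ} {X : Space n N}
    (h : absKernelSum a (fun Y => ‖f Y‖ₑ) X ≠ ⊤) :
    Summable fun k => ∫ Y, dyadicKernel (a X) k (X - Y) * f Y := by
  have h1 := ne_top_of_le_ne_top h (tsum_enorm_integral_le a f X)
  refine Summable.of_norm ?_
  have h2 := ENNReal.summable_toReal h1
  simpa only [toReal_enorm] using h2

lemma enorm_kernelOp_le (a : Space n N → Space n N → ℂ) (f : Space n N → ℂ) (X : Space n N) :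
    ‖kernelOp a f X‖ₑ ≤ absKernelSum a (fun Y => ‖f Y‖ₑ) X := by
  by_cases h : absKernelSum a (fun Y => ‖f Y‖ₑ) X = ⊤
  · rw [h]
    exact le_top
  refine le_of_tendsto (summable_kernelOp h).hasSum.tendsto_sum_nat.enorm
    (Filter.Eventually.of_forall fun K => ?_)
  exact (enorm_sum_le _ _).trans ((ENNReal.sum_le_tsum _).trans (tsum_enorm_integral_le a f X))

/-- The mixed norm estimate: the pointwise bound by local averages, summed over the dyadic pieces,
and the mixed-norm estimate for iterated averages. -/
lemma exists_absKernelSum_bound {n : ℕ} (hn : 1 ≤ n) (N : ℕ) {p : Fin N → ℝ}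
    (hp : ∀ j, p j ∈ Set.Icc (1 : ℝ) 2) {m ρ : ℝ} (hρ : ρ ∈ Set.Icc (0 : ℝ) 1)
    (hm : m < (ρ - 1) * ∑ j, (n : ℝ) / p j) {q : Fin N → ℝ} (hpq : ∀ j, p j ≤ q j)
    (hq : Antitone q) :
    ∃ C : ℝ≥0∞, C ≠ ⊤ ∧ ∀ (a : Space n N → Space n N → ℂ) (c : ℝ), 0 ≤ c →
      (∀ X, ContDiff ℝ ∞ (a X)) →
      (∀ X, SymbolBounds m ρ (2 * (coordList n N).length) c (a X)) →
      ∀ f : Space n N → ℝ≥0∞, Measurable f → ∀ X,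
        iterNorm (List.finRange N).reverse q (fun _ _ _ => 1) (absKernelSum a f) X ≤
          C * ENNReal.ofReal c * iterNorm (List.finRange N) q (fun _ _ _ => 1) f X := by
  have hp0 : ∀ j, 0 < p j := fun j => lt_of_lt_of_le one_pos (hp j).1
  have hq1 : ∀ j, 1 ≤ q j := fun j => (hp j).1.trans (hpq j)
  have hq0 : ∀ j, 0 < q j := fun j => one_pos.trans_le (hq1 j)
  obtain ⟨C, hC, hker⟩ := exists_dyadic_kernel_bound n N m hρ hp
  set V : ℝ≥0∞ := ∫⁻ z : EuclideanSpace ℝ (Fin n), decay n 1 z with hV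
  have hVt : V ≠ ⊤ := lintegral_decay_one_ne_top hn
  set D : ℝ≥0∞ := ∏ j, V ^ (1 / p j) with hD
  have hDt : D ≠ ⊤ := ENNReal.prod_ne_top fun j _ =>
    ENNReal.rpow_ne_top_of_nonneg (by have := hp0 j; positivity) hVt
  set G : ℝ≥0∞ := ∑' k : ℕ, ENNReal.ofReal ((2 : ℝ) ^ (m - (ρ - 1) * ∑ j, (n : ℝ) / p j)) ^ k
    with hG
  have hGt : G ≠ ⊤ := tsum_gain_ne_top (by linarith)
  have hpair : (List.finRange N).Pairwise fun i j => i ≠ j ∧ q j ≤ q i :=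
    (List.pairwise_lt_finRange N).imp fun h => ⟨h.ne, hq h.le⟩
  refine ⟨C * G * D, by finiteness, fun a c hc ha hb f hf X => ?_⟩
  have hm1 : ∀ k : ℕ, Measurable (iterNorm (List.finRange N) p
      (fun _ x y => decay n (((2 : ℝ) ^ k) ^ ρ) (x - y)) f) := fun k =>
    measurable_iterNorm _ (fun _ => measurable_uncurry_sub (measurable_decay _)) hf
  calc _ ≤ iterNorm (List.finRange N).reverse q (fun _ _ _ => 1) (fun X => ∑' k : ℕ,
        C * ENNReal.ofReal c * ENNReal.ofReal (((2 : ℝ) ^ k) ^ (m + ∑ j, (n : ℝ) / p j)) *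
          iterNorm (List.finRange N) p
            (fun _ x y => decay n (((2 : ℝ) ^ k) ^ ρ) (x - y)) f X) X :=
        iterNorm_mono _ (fun j => (hq0 j).le)
          (fun X => ENNReal.tsum_le_tsum fun k => hker (a X) c hc (ha X) (hb X) k f hf X) X
    _ ≤ ∑' k : ℕ, C * ENNReal.ofReal c *
        (ENNReal.ofReal ((2 : ℝ) ^ (m - (ρ - 1) * ∑ j, (n : ℝ) / p j)) ^ k * D) *
          iterNorm (List.finRange N) q (fun _ _ _ => 1) f X := by
        refine (iterNorm_tsum_le _ hq1 (fun k => (hm1 k).const_mul _) X).trans ?_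
        refine ENNReal.tsum_le_tsum fun k => ?_
        have hτ : (0 : ℝ) < ((2 : ℝ) ^ k) ^ ρ := by positivity
        rw [iterNorm_const_mul _ hq0 (by finiteness), ← rpow_gain k m ρ,
          mul_assoc (ENNReal.ofReal _) (ENNReal.ofReal _) D, ← prod_rpow_scale hτ hp0,
          ← mul_assoc, mul_assoc _ (List.prod _)]
        refine mul_le_mul_right ?_ _
        have h1 := iterNorm_reverse_average_le hpair hp0 hpq
          (measurable_decay (n := n) (((2 : ℝ) ^ k) ^ ρ))
          (by rw [lintegral_decay hτ]; exact ENNReal.mul_ne_top ENNReal.ofReal_ne_top hVt) hf X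
        rwa [lintegral_decay hτ] at h1
    _ = _ := by
        rw [ENNReal.tsum_mul_right, ENNReal.tsum_mul_left, ENNReal.tsum_mul_right]
        ring

/-- The summed operator `kernelOp` is the extension to the mixed norm spaces. -/
lemma extendsBoundedly_of_bound (hn : 1 ≤ n) {q : Fin N → ℝ} (hq : ∀ j, 1 ≤ q j)
    {l l' : List (Fin N)} (hl : l.Nodup) (hlm : ∀ j, j ∈ l) (hl' : l'.Nodup) (hlm' : ∀ j, j ∈ l')
    {a a' : Space n N → Space n N → ℂ} (ha' : StronglyMeasurable (Function.uncurry a'))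
    (hcont : ∀ X, Continuous (a' X)) {B : ℝ} (hB : ∀ X Ξ, ‖a' X Ξ‖ ≤ B)
    (haa : ∀ᵐ X, a' X = a X) {C : ℝ}
    (hC : ∀ f : Space n N → ℝ≥0∞, Measurable f →
      iterNorm l' q (fun _ _ _ => 1) (absKernelSum a' f) 0 ≤
        ENNReal.ofReal C * iterNorm l q (fun _ _ _ => 1) f 0) :
    ExtendsBoundedly l l' q (pseudoOp a) C := by
  have hq0 : ∀ j, 0 < q j := fun j => one_pos.trans_le (hq j)
  -- absolute convergence almost everywhere
  have hconv : ∀ f : Space n N → ℂ, AEStronglyMeasurable f volume → mixedNorm l q f ≠ ⊤ →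
      ∀ᵐ X, absKernelSum a' (fun Y => ‖f Y‖ₑ) X ≠ ⊤ := by
    intro f hf hfin
    obtain ⟨g, hg, hfg⟩ := hf
    have h1 : absKernelSum a' (fun Y => ‖f Y‖ₑ) = absKernelSum a' (fun Y => ‖g Y‖ₑ) := by
      funext X
      refine tsum_congr fun k => lintegral_congr_ae (hfg.mono fun Y hY => by simp only [hY])
    rw [mixedNorm_congr_ae hlm hfg, mixedNorm_eq_iterNorm] at hfin
    have h2 := ae_lt_top_of_iterNorm l' hq0 (measurable_absKernelSum ha' hg.measurable.enorm)
      (Filter.Eventually.of_forall fun X => ?_)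
    · rw [h1]
      exact h2.mono fun X hX => hX.ne
    · rw [iterNorm_one_congr (Y := 0) l' (fun j hj => absurd (hlm' j) hj)]
      exact (hC _ hg.measurable.enorm).trans_lt
        (ENNReal.mul_lt_top ENNReal.ofReal_lt_top hfin.lt_top)
  refine ⟨kernelOp a', fun u => ?_, fun f g hf hg => ?_, fun c f _ => ?_, fun f hf => ?_⟩
  · filter_upwards [haa, hconv u u.continuous.aestronglyMeasurable
      (mixedNorm_schwartz_ne_top hn hl hq u)] with X hX hfin
    have h1 : pseudoOp a u X = pseudoOp a' u X := by simp only [pseudoOp, hX]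
    rw [h1]
    exact tendsto_nhds_unique (summable_kernelOp hfin).hasSum.tendsto_sum_nat
      (tendsto_sum_dyadicKernel (hcont X) (hB X) u)
  · filter_upwards [hconv f hf.1 (hf.mixedNorm_ne_top hn hl hlm hq),
      hconv g hg.1 (hg.mixedNorm_ne_top hn hl hlm hq)] with X h1 h2
    rw [Pi.add_apply, kernelOp, kernelOp, kernelOp,
      ← (summable_kernelOp h1).tsum_add (summable_kernelOp h2)]
    refine tsum_congr fun k => ?_
    rw [← integral_add (integrable_dyadicKernel_mul hcont hf.1 h1 k)
      (integrable_dyadicKernel_mul hcont hg.1 h2 k)]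
    simp only [Pi.add_apply, mul_add]
  · refine Filter.Eventually.of_forall fun X => ?_
    rw [Pi.smul_apply, kernelOp, kernelOp, smul_eq_mul, ← tsum_mul_left]
    refine tsum_congr fun k => ?_
    rw [← integral_const_mul]
    refine integral_congr_ae (Filter.Eventually.of_forall fun Y => ?_)
    simp only [Pi.smul_apply, smul_eq_mul]
    ring
  · have hfin := hf.mixedNorm_ne_top hn hl hlm hq
    obtain ⟨g, hg, hfg⟩ := hf.1
    rw [mixedNorm_congr_ae hlm hfg] at hfin ⊢
    rw [kernelOp_congr_ae a' hfg]
    have hbound : mixedNorm l' q (kernelOp a' g) ≤ ENNReal.ofReal C * mixedNorm l q g := by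
      rw [mixedNorm_eq_iterNorm, mixedNorm_eq_iterNorm]
      exact (iterNorm_mono l' (fun j => (hq0 j).le) (enorm_kernelOp_le a' g) 0).trans
        (hC _ hg.measurable.enorm)
    refine ⟨memMixed_of_ne_top hn hl' hlm' hq ?_
      (ne_top_of_le_ne_top (ENNReal.mul_ne_top ENNReal.ofReal_ne_top hfin) hbound), hbound⟩
    refine aestronglyMeasurable_of_tendsto_ae Filter.atTop (f := fun K X =>
      ∑ k ∈ Finset.range K, ∫ Y, dyadicKernel (a' X) k (X - Y) * g Y) (fun K => ?_) ?_
    · refine (Finset.stronglyMeasurable_fun_sum _ fun k _ => ?_).aestronglyMeasurable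
      refine StronglyMeasurable.integral_prod_right (f := fun X Y =>
        dyadicKernel (a' X) k (X - Y) * g Y) ?_
      exact (stronglyMeasurable_dyadicKernel ha' k).mul (hg.comp_measurable measurable_snd)
    · filter_upwards [hconv g hg.aestronglyMeasurable hfin] with X hX
      exact (summable_kernelOp hX).hasSum.tendsto_sum_nat

end Bounded

end MixedPDO

open MixedPDO
theorem theorem4p1 (n N : ℕ) (hn : 1 ≤ n) (hN : 1 ≤ N)
    (p : Fin N → ℝ) (hp : ∀ j, p j ∈ Set.Icc (1 : ℝ) 2)
    (m ρ : ℝ) (hρ : ρ ∈ Set.Icc (0 : ℝ) 1)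
    (hm : m < (ρ - 1) * ∑ j, (n : ℝ) / p j) :
    ∃ F : Finset (MultiIndex n N), ∀ c : F → ℝ,
      (∃ C : ℝ, 0 ≤ C ∧
        ∀ a : Space n N → Space n N → ℂ, IsSymbol m ρ a →
          (∀ α : F, SymbolBound m ρ a α (c α)) →
          (∀ᵐ X : Space n N, ∀ u : 𝓢(Space n N, ℂ),
            ‖pseudoOp a u X‖ₑ ≤
              ENNReal.ofReal C * iteratedMaximal p (fun Y => ‖u Y‖ₑ) X) ∧
          (∀ X : Space n N, ContDiff ℝ ∞ (a X) →
            (∀ (α : F) (Ξ : Space n N), ‖multiDeriv (α : MultiIndex n N) (a X) Ξ‖ ≤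
              c α * bracket Ξ ^ (m - ρ * ((α : MultiIndex n N).length : ℝ))) →
            ∀ u : 𝓢(Space n N, ℂ), ‖pseudoOp a u X‖ₑ ≤
              ENNReal.ofReal C * iteratedMaximal p (fun Y => ‖u Y‖ₑ) X)) ∧
      (∀ q : Fin N → ℝ, (∀ j, p j < q j) → Antitone q → (∀ j, q j ∈ Set.Icc (1 : ℝ) 2) →
        ∃ C : ℝ, 0 ≤ C ∧
          ∀ a : Space n N → Space n N → ℂ, IsSymbol m ρ a →
            (∀ α : F, SymbolBound m ρ a α (c α)) →
            ExtendsBoundedly (List.finRange N) (List.finRange N).reverse q (pseudoOp a) C) := by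
  -- the weight uses `2 n` derivatives in each of the `n N` coordinates
  refine ⟨boxIndices n N (2 * (coordList n N).length), fun c => ⟨?_, fun q hpq hanti hq => ?_⟩⟩
  · obtain ⟨C, hC, hpt⟩ := exists_pseudoOp_bound hn N hp hρ hm
    have hC' : C * ENNReal.ofReal (∑ α, |c α|) ≠ ⊤ := by finiteness
    have hgood : ∀ (a : Space n N → Space n N → ℂ) (X : Space n N), ContDiff ℝ ∞ (a X) →
        (∀ (α : boxIndices n N (2 * (coordList n N).length)) (Ξ : Space n N),
          ‖multiDeriv (α : MultiIndex n N) (a X) Ξ‖ ≤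
            c α * bracket Ξ ^ (m - ρ * ((α : MultiIndex n N).length : ℝ))) →
        ∀ u : 𝓢(Space n N, ℂ), ‖pseudoOp a u X‖ₑ ≤
          ENNReal.ofReal (C * ENNReal.ofReal (∑ α, |c α|)).toReal *
            iteratedMaximal p (fun Y => ‖u Y‖ₑ) X := by
      intro a X hX hb u
      rw [ENNReal.ofReal_toReal hC']
      exact hpt a X _ (Finset.sum_nonneg fun _ _ => abs_nonneg _) hX
        (symbolBounds_of_multiDeriv hX c hb) u
    refine ⟨_, ENNReal.toReal_nonneg, fun a ha hb => ⟨?_, hgood a⟩⟩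
    filter_upwards [ae_forall_of_symbolBound ha.smooth c hb] with X hX
    exact hgood a X hX.1 hX.2
  · obtain ⟨C, hC, hmix⟩ := exists_absKernelSum_bound hn N hp hρ hm (fun j => (hpq j).le) hanti
    have hC' : C * ENNReal.ofReal (∑ α, |c α|) ≠ ⊤ := by finiteness
    have hc0 : 0 ≤ ∑ α, |c α| := Finset.sum_nonneg fun _ _ => abs_nonneg _
    have hm0 : m ≤ 0 := hm.le.trans (mul_nonpos_of_nonpos_of_nonneg (by linarith [hρ.2])
      (Finset.sum_nonneg fun j _ => div_nonneg (Nat.cast_nonneg n) (by linarith [(hp j).1])))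
    refine ⟨(C * ENNReal.ofReal (∑ α, |c α|)).toReal, ENNReal.toReal_nonneg, fun a ha hb => ?_⟩
    obtain ⟨a', hmeas, hsm, hbd, haa⟩ := exists_measurable_symbol ha c hb
    refine extendsBoundedly_of_bound hn (fun j => (hq j).1) (List.nodup_finRange N)
      (fun j => List.mem_finRange j) (List.nodup_reverse.2 (List.nodup_finRange N))
      (fun j => List.mem_reverse.2 (List.mem_finRange j)) hmeas (fun X => (hsm X).continuous)
      (fun X => norm_le_of_symbolBounds hm0 hc0 (hbd X)) haa fun f hf => ?_
    rw [ENNReal.ofReal_toReal hC']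
    exact hmix a' _ hc0 hsm hbd f hf 0
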